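/- **Conventions.** For $n\ge 1$, let $P(n)$ be the set of partitions of $[n]=\{1,\dots,n\}$ and $NC(n)\subset P(n)$ the set of non-crossing partitions; $|V|$ is the size of a block $V$, and $|\pi|$ is the number of blocks of $\pi$. For a sequence $(u_k)_{k\ge1}$ put $u_\pi=\prod_{V\in\pi}u_{|V|}$ and $u_{\pi\setminus V}=\prod_{W\in\pi,\,W\ne V}u_{|W|}$. For a permutation $\sigma$, $|\sigma|$ is its number of cycles (fixed points included) and $u_\sigma$ is the product of $u_{|c|}$ over all cycles $c$ of $\sigma$, where $|c|$ is the length of $c$. For $t,s\ge1$ let $\gamma_{t,s}=(1,\dots,t)(t+1,\dots,t+s)$, and let $S_{NC}(t,s)$ be the set of permutations $\sigma$ of $[t+s]$ such that $\langle\sigma,\gamma_{t,s}\rangle$ acts transitively on $[t+s]$ and $|\sigma|+|\sigma^{-1}\gamma_{t,s}|=t+s$. For a probability measure $\mu$ on $\mathbb R$ with finite moments $m_n(\mu)$ of all orders, its free cumulants $(r_n(\mu))_{n\ge1}$ are defined recursively by $m_n(\mu)=\sum_{\pi\in NC(n)}r_\pi(\mu)$. The free additive convolution $\mu\boxplus\nu$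 is a probability measure with finite moments of all orders such that $r_n(\mu\boxplus\nu)=r_n(\mu)+r_n(\nu)$ for all $n\ge1$. (If several measures have this property, the theorem below holds for each of them.) Let $\mathcal P_d(\mathbb R)$ be the set of monic real-rooted polynomials of degree $d$. Write $p\in\mathcal P_d(\mathbb R)$ as $p(x)=\sum_{k=0}^d x^{d-k}(-1)^k\binom dk a_k(p)$, with roots $\lambda_1,\dots,\lambda_d$ counted with multiplicity. Put $m_n(p)=\frac1d\sum_{i=1}^d\lambda_i^n$ and, for $1\le n\le d$, $$\kappa_n(p)=\frac{(-d)^{n-1}}{(n-1)!}\sum_{\pi\in P(n)}(-1)^{|\pi|-1}(|\pi|-1)!\prod_{V\in\pi}a_{|V|}(p).$$ The finite free additive convolution of $p,q\in\mathcal P_d(\mathbb R)$ is $$[p\boxplus_d q](x)=\sum_{k=0}^d x^{d-k}(-1)^k\binom dk\sum_{i=0}^k\binom ki a_i(p)\,a_{k-i}(q).$$ A sequence $\mathfrak p=(p_d)_{d\ge1}$ with $p_d\in\mathcal P_d(\mathbb R)$ has *infinitesimal distribution* $(\mu,\mu')$, where $\mu$ is a probability measure on $\mathbb R$ with finite moments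 of all orders and $\mu':\mathbb R[x]\to\mathbb R$ is a linear functional with $\mu'(1)=0$, if $m_n(p_d)\to m_n(\mu)$ for all $n\ge0$ and $d\,(m_n(p_d)-m_n(\mu))\to m_n(\mu'):=\mu'(x^n)$ for all $n\ge1$, as $d\to\infty$. The *cumulant fluctuations* of such a $\mathfrak p$ are the numbers $\widehat r_n(\mathfrak p)$, $n\ge 1$, such that $\kappa_n(p_d)=r_n(\mu)+\frac1d\,\widehat r_n(\mathfrak p)+o(1/d)$ as $d\to\infty$. **Theorem.** Let $\mathfrak p=(p_d)_{d\ge1}$ and $\mathfrak q=(q_d)_{d\ge1}$ be sequences of polynomials with $p_d,q_d\in\mathcal P_d(\mathbb R)$ and with infinitesimal distributions $(\mu,\mu')$ and $(\nu,\nu')$, respectively. Then the cumulant fluctuations $\widehat r_n(\mathfrak p)$ and $\widehat r_n(\mathfrak q)$ exist for all $n\ge1$, the free additive convolution $\rho=\mu\boxplus\nu$ exists, and $\mathfrak p\boxplus\mathfrak q=(p_d\boxplus_d q_d)_{d\ge1}$ is a sequence of polynomials in $\mathcal P_d(\mathbb R)$ which has an infinitesimal distribution $(\rho,\rho')$. Its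 cumulant fluctuations exist and satisfy $\widehat r_n(\mathfrak p\boxplus\mathfrak q)=\widehat r_n(\mathfrak p)+\widehat r_n(\mathfrak q)$ for all $n\ge1$, and for all $n\ge1$ $$m_n(\rho')=\sum_{\pi\in NC(n)}\sum_{V\in\pi}\big[\widehat r_{|V|}(\mathfrak p)+\widehat r_{|V|}(\mathfrak q)\big]\,r_{\pi\setminus V}(\mu\boxplus\nu)\;-\;\frac n2\sum_{\substack{t+s=n\\ t,s\ge1}}\ \sum_{\sigma\in S_{NC}(t,s)}\frac{r_\sigma(\mu\boxplus\nu)}{ts}.$$ -/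

import Mathlib

open Polynomial MeasureTheory Filter Topology

namespace FiniteFree

/-! ## Non-crossing partitions and annular non-crossing permutations -/

/-- The set `P(n)` of all set partitions of an `n`-element (linearly ordered) set. -/
abbrev SetPartition (n : ℕ) : Type := Finpartition (Finset.univ : Finset (Fin n))

/-- A partition is non-crossing if whenever `a < b < c < d` with `a, c` in a block `V` and
`b, d` in a block `W`, then `V = W`. -/
def IsNonCrossing {n : ℕ} (π : SetPartition n) : Prop :=
  ∀ a b c d : Fin n, a < b → b < c → c < d →
    ∀ V ∈ π.parts, ∀ W ∈ π.parts, a ∈ V → c ∈ V → b ∈ W → d ∈ W → V = W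

open Classical in
/-- The finite set `NC(n)` of non-crossing partitions. -/
noncomputable def NC (n : ℕ) : Finset (SetPartition n) :=
  Finset.univ.filter IsNonCrossing

/-- The multiplicative extension `u_π = ∏_{V ∈ π} u_{|V|}` of a sequence to partitions. -/
noncomputable def partProd {n : ℕ} (u : ℕ → ℝ) (π : SetPartition n) : ℝ :=
  ∏ V ∈ π.parts, u V.card

/-- `∑_{V ∈ π} v_{|V|} · u_{π ∖ V}`. -/
noncomputable def partDeriv {n : ℕ} (u v : ℕ → ℝ) (π : SetPartition n) : ℝ :=
  ∑ V ∈ π.parts, v V.card * ∏ W ∈ π.parts.erase V, u W.card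

/-- The number `|σ|` of cycles of a permutation, fixed points included. -/
noncomputable def numCycles {t s : ℕ} (σ : Equiv.Perm (Fin t ⊕ Fin s)) : ℕ :=
  Multiset.card σ.partition.parts

/-- The multiplicative extension `u_σ = ∏_{c cycle of σ} u_{|c|}` of a sequence to permutations
(fixed points count as cycles of length one). -/
noncomputable def permProd {t s : ℕ} (u : ℕ → ℝ) (σ : Equiv.Perm (Fin t ⊕ Fin s)) : ℝ :=
  (σ.partition.parts.map u).prod

/-- The permutation `γ_{t,s} = (1,2,…,t)(t+1,…,t+s)`; the points `1,…,t` are the left summand and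
`t+1,…,t+s` the right one. -/
def gammaPerm (t s : ℕ) : Equiv.Perm (Fin t ⊕ Fin s) :=
  Equiv.sumCongr (finRotate t) (finRotate s)

/-- `σ` is non-crossing in the `(t,s)`-annulus: `σ` and `γ_{t,s}` generate a transitive group, and
`|σ| + |σ⁻¹ γ_{t,s}| = t + s`. -/
def IsAnnularNonCrossing {t s : ℕ} (σ : Equiv.Perm (Fin t ⊕ Fin s)) : Prop :=
  MulAction.IsPretransitive
      (Subgroup.closure ({σ, gammaPerm t s} : Set (Equiv.Perm (Fin t ⊕ Fin s)))) (Fin t ⊕ Fin s) ∧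
    numCycles σ + numCycles (σ⁻¹ * gammaPerm t s) = t + s

open Classical in
/-- The finite set `S_NC(t,s)`. -/
noncomputable def SNC (t s : ℕ) : Finset (Equiv.Perm (Fin t ⊕ Fin s)) :=
  Finset.univ.filter IsAnnularNonCrossing

/-- `(n/2) ∑_{t + s = n, t, s ≥ 1} ∑_{σ ∈ S_NC(t,s)} u_σ / (t s)`. -/
noncomputable def annularSum (u : ℕ → ℝ) (n : ℕ) : ℝ :=
  (n : ℝ) / 2 *
    ∑ ts ∈ (Finset.HasAntidiagonal.antidiagonal n).filter (fun ts => 1 ≤ ts.1 ∧ 1 ≤ ts.2),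
      ∑ σ ∈ SNC ts.1 ts.2, permProd u σ / ((ts.1 : ℝ) * (ts.2 : ℝ))

/-! ## Moments and free cumulants -/

/-- The free cumulants of a moment sequence `m`, defined recursively by solving
`m_n = ∑_{π ∈ NC(n)} r_π` for the term `r_n` of the one-block partition
(see `moment_eq_sum_NC`). -/
noncomputable def cumulantOfMoments (m : ℕ → ℝ) (n : ℕ) : ℝ :=
  m n - ∑ π ∈ ((NC n).filter (fun π => ∀ V ∈ π.parts, V.card < n)).attach,
    ∏ V ∈ π.1.parts.attach, cumulantOfMoments m V.1.card
termination_by n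
decreasing_by exact (Finset.mem_filter.mp π.2).2 V.1 V.2

theorem cumulantOfMoments_eq (m : ℕ → ℝ) (n : ℕ) :
    cumulantOfMoments m n =
      m n - ∑ π ∈ (NC n).filter (fun π => ∀ V ∈ π.parts, V.card < n),
        partProd (cumulantOfMoments m) π := by
  rw [cumulantOfMoments, ← Finset.sum_attach (Finset.filter _ _)]
  congr 1
  refine Finset.sum_congr rfl fun π _ => ?_
  exact Finset.prod_attach π.1.parts (fun V => cumulantOfMoments m V.card)

/-- The moment-cumulant formula `m_n = ∑_{π ∈ NC(n)} r_π` for `n ≥ 1`. -/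
theorem moment_eq_sum_NC (m : ℕ → ℝ) {n : ℕ} (hn : 1 ≤ n) :
    m n = ∑ π ∈ NC n, partProd (cumulantOfMoments m) π := by
  have hne : (Finset.univ : Finset (Fin n)) ≠ ⊥ := by
    intro h
    have h1 := congrArg Finset.card h
    simp at h1
    omega
  have hfull : ∀ π : SetPartition n, ¬ (∀ V ∈ π.parts, V.card < n) →
      π = Finpartition.indiscrete hne := by
    intro π hπ
    push Not at hπ
    obtain ⟨V, hV, hVn⟩ := hπ
    have hVu : V = Finset.univ := by
      apply Finset.eq_univ_of_card
      have := Finset.card_le_univ V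
      simp only [Fintype.card_fin] at this ⊢
      omega
    subst hVu
    apply Finpartition.ext
    ext W
    simp only [Finpartition.indiscrete_parts, Finset.mem_singleton]
    constructor
    · intro hW
      by_contra hWne
      have hd := π.disjoint hW hV hWne
      simp only [Function.onFun, id] at hd
      exact π.ne_bot hW (hd.eq_bot_of_le (Finset.subset_univ W))
    · rintro rfl
      exact hV
  have hcomp : (NC n).filter (fun π => ¬ ∀ V ∈ π.parts, V.card < n) =
      {Finpartition.indiscrete hne} := by
    ext π
    simp only [Finset.mem_filter, Finset.mem_singleton]
    constructor
    · rintro ⟨-, h⟩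
      exact hfull π h
    · rintro rfl
      refine ⟨?_, ?_⟩
      · simp only [NC, Finset.mem_filter, Finset.mem_univ, true_and]
        intro a b c d _ _ _ V hV W hW _ _ _ _
        simp only [Finpartition.indiscrete_parts, Finset.mem_singleton] at hV hW
        rw [hV, hW]
      · simp
  rw [← Finset.sum_filter_add_sum_filter_not (NC n) (fun π => ∀ V ∈ π.parts, V.card < n), hcomp,
    Finset.sum_singleton]
  have h1 : partProd (cumulantOfMoments m) (Finpartition.indiscrete hne) =
      cumulantOfMoments m n := by
    simp [partProd]
  rw [h1, cumulantOfMoments_eq m n]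
  ring

/-- The `n`-th moment `m_n(μ)` of a measure on the real line. -/
noncomputable def moment (μ : Measure ℝ) (n : ℕ) : ℝ := ∫ x, x ^ n ∂μ

/-- The measure `μ` has finite moments of all orders. -/
def HasFiniteMoments (μ : Measure ℝ) : Prop := ∀ n : ℕ, Integrable (fun x : ℝ => x ^ n) μ

/-- The `n`-th free cumulant `r_n(μ)`. -/
noncomputable def freeCumulant (μ : Measure ℝ) (n : ℕ) : ℝ := cumulantOfMoments (moment μ) n

/-- `ρ` is a free additive convolution `μ ⊞ ν`: a probability measure with finite moments of all
orders whose free cumulants are `r_n(ρ) = r_n(μ) + r_n(ν)`, `n ≥ 1`. -/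
structure IsFreeAddConv (μ ν ρ : Measure ℝ) : Prop where
  isProbabilityMeasure : IsProbabilityMeasure ρ
  finiteMoments : HasFiniteMoments ρ
  freeCumulant_add : ∀ n, 1 ≤ n → freeCumulant ρ n = freeCumulant μ n + freeCumulant ν n

/-! ## Real-rooted polynomials, finite free convolution and cumulants -/

/-- The set `𝒫_d(ℝ)` of monic real-rooted polynomials of degree `d`. -/
def realRooted (d : ℕ) : Set ℝ[X] := {p | p.Monic ∧ p.natDegree = d ∧ p.Splits}

/-- The coefficient `a_k(p)`, `0 ≤ k ≤ d`, in `p = ∑_k x^{d-k} (-1)^k (d choose k) a_k(p)`. -/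
noncomputable def coefA (d k : ℕ) (p : ℝ[X]) : ℝ :=
  (-1) ^ k * p.coeff (d - k) / (d.choose k : ℝ)

/-- The finite free additive convolution `p ⊞_d q`. -/
noncomputable def finiteFreeAdd (d : ℕ) (p q : ℝ[X]) : ℝ[X] :=
  ∑ k ∈ Finset.range (d + 1),
    C ((-1) ^ k * (d.choose k : ℝ) *
      ∑ i ∈ Finset.range (k + 1), (k.choose i : ℝ) * coefA d i p * coefA d (k - i) q) * X ^ (d - k)

/-- The `n`-th moment `m_n(p) = (1/d) ∑ λ^n` of the root distribution of `p ∈ 𝒫_d(ℝ)`, the roots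
`λ` being counted with multiplicity. -/
noncomputable def rootMoment (d : ℕ) (p : ℝ[X]) (n : ℕ) : ℝ :=
  (1 / (d : ℝ)) * (p.roots.map (fun x => x ^ n)).sum

/-- The `n`-th finite free cumulant `κ_n(p)` of `p ∈ 𝒫_d(ℝ)`, `1 ≤ n ≤ d`; the Möbius function of
the partition lattice is `Möb(π, 1_n) = (-1)^{|π|-1} (|π|-1)!`. -/
noncomputable def finiteFreeCumulant (d n : ℕ) (p : ℝ[X]) : ℝ :=
  (-(d : ℝ)) ^ (n - 1) / ((n - 1).factorial : ℝ) *
    ∑ π : SetPartition n,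
      (-1) ^ (π.parts.card - 1) * ((π.parts.card - 1).factorial : ℝ) *
        partProd (fun k => coefA d k p) π

/-! ## Infinitesimal distributions and cumulant fluctuations -/

/-- The sequence `(p_d)_{d ≥ 1}`, `p_d ∈ 𝒫_d(ℝ)`, has infinitesimal distribution `(μ, μ')`: its root
distributions converge in moments to the probability measure `μ`, and
`d (m_n(p_d) - m_n(μ)) → μ'(x^n)` for `n ≥ 1`, while `μ'(1) = 0`. The term `p 0` is irrelevant. -/
structure HasInfinitesimalDistribution (p : ℕ → ℝ[X]) (μ : Measure ℝ) (μ' : ℝ[X] →ₗ[ℝ] ℝ) :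
    Prop where
  realRooted : ∀ d, 1 ≤ d → p d ∈ realRooted d
  isProbabilityMeasure : IsProbabilityMeasure μ
  finiteMoments : HasFiniteMoments μ
  tendsto_moment : ∀ n, Tendsto (fun d => rootMoment d (p d) n) atTop (𝓝 (moment μ n))
  map_one : μ' 1 = 0
  tendsto_infinitesimal : ∀ n, 1 ≤ n →
    Tendsto (fun d : ℕ => (d : ℝ) * (rootMoment d (p d) n - moment μ n)) atTop (𝓝 (μ' (X ^ n)))

/-- `(r_n)_{n ≥ 1}` is the sequence of cumulant fluctuations of `(p_d)_{d ≥ 1}` with limiting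
distribution `μ`, that is, `κ_n(p_d) = r_n(μ) + r_n / d + o(1/d)` for every `n ≥ 1`. -/
def HasCumulantFluctuations (p : ℕ → ℝ[X]) (μ : Measure ℝ) (r : ℕ → ℝ) : Prop :=
  ∀ n, 1 ≤ n →
    Tendsto (fun d : ℕ => (d : ℝ) * (finiteFreeCumulant d n (p d) - freeCumulant μ n))
      atTop (𝓝 (r n))

end FiniteFree

/-!
Up to sign and a power of `d`, `n!` times the coefficient of `x ^ (d - n)` in `p` is the sum of
`(-d κ)_σ (-d)^{|σ⁻¹ α|}` over all pairs `(σ, α)` of permutations of `n` points, where `κ` is the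
sequence of finite free cumulants. Splitting the pairs along the orbit of a point, and comparing
with Newton's identities for the roots, shows that `(n - 1)! m_n(p)` is the sum of `(-1 / d)^g κ_σ`
over the pairs that generate a transitive group, where `g = n + 1 - |σ| - |σ⁻¹ α|`.

For such pairs `|σ| + |α| + |σ⁻¹ α| ≤ n + 2`, both sides having the same parity, so that
`g ≥ |α| - 1`. Hence `g = 0` forces `α` to be a long cycle and `σ` a non-crossing partition of it,
and `g = 1` forces `α` to have two cycles and `σ` to be an annular non-crossing permutation. The
terms `g = 0` and `g = 1` give the first-order expansion in `1 / d` of the moments in terms of that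
of the cumulants, and the formula is triangular, so it can be inverted.

Finite free cumulants are the cumulants of the coefficients `a_k` with respect to all set
partitions, up to a constant factor. They are additive because `⊞_d` multiplies the exponential
generating functions of these sequences. Real-rootedness of `p ⊞_d q` follows from Grace's theorem,
and `μ ⊞ ν` is a weak limit of the root distributions of `p_d ⊞_d q_d`.
-/

namespace FiniteFree

open Equiv Equiv.Perm

/-! ## Cycle counts and the genus of a pair of permutations -/

section ClassCount

variable {X : Type*}

/-- The number of classes of an equivalence relation. -/
noncomputable def classCount (r : Setoid X) : ℕ := Nat.card (Quotient r)

theorem classCount_ker {Y : Type*} (f : X → Y) :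
    classCount (Setoid.ker f) = (Set.range f).ncard :=
  Nat.card_congr (Setoid.quotientKerEquivRange f)

theorem classCount_eq_one_iff {r : Setoid X} : classCount r = 1 ↔ Nonempty X ∧ r = ⊤ := by
  rw [classCount, Nat.card_eq_one_iff_unique, Quotient.subsingleton_iff, nonempty_quotient_iff,
    and_comm]

theorem classCount_top [Nonempty X] : classCount (⊤ : Setoid X) = 1 :=
  classCount_eq_one_iff.mpr ⟨inferInstance, rfl⟩

variable [Finite X]

theorem classCount_anti : Antitone (classCount : Setoid X → ℕ) := fun _ _ h =>
  Nat.card_le_card_of_surjective (Quotient.map id h)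
    (Quotient.map_surjective h Function.surjective_id)

theorem classCount_le_card (r : Setoid X) : classCount r ≤ Nat.card X :=
  Nat.card_le_card_of_surjective (Quotient.mk r) Quotient.mk_surjective

theorem eq_of_le_of_classCount_le {r s : Setoid X} (h : r ≤ s)
    (hcard : classCount r ≤ classCount s) : r = s := by
  have hsurj : Function.Surjective (Quotient.map (sa := r) (sb := s) id h) :=
    Quotient.map_surjective h Function.surjective_id
  have hinj := ((Nat.bijective_iff_surjective_and_card _).mpr
    ⟨hsurj, hcard.antisymm (classCount_anti h)⟩).injective
  exact h.antisymm fun x y hxy =>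
    Quotient.exact (hinj (Quotient.sound hxy : (⟦x⟧ : Quotient s) = ⟦y⟧))

theorem exists_le_rel_classCount_le_add_one (r : Setoid X) (a b : X) :
    ∃ s : Setoid X, r ≤ s ∧ s a b ∧ classCount r ≤ classCount s + 1 := by
  classical
  let f : X → Quotient r := Function.update id ⟦b⟧ ⟦a⟧ ∘ Quotient.mk r
  refine ⟨Setoid.ker f, fun x y hxy => congrArg (Function.update id ⟦b⟧ ⟦a⟧)
    (Quotient.sound hxy), ?_, ?_⟩
  · simp [f, Setoid.ker_def, Function.update_apply]
  · have hrange : (Set.univ : Set (Quotient r)) ⊆ insert ⟦b⟧ (Set.range f) := by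
      intro q _
      obtain ⟨x, rfl⟩ := Quotient.exists_rep q
      by_cases hx : (⟦x⟧ : Quotient r) = ⟦b⟧
      · exact Or.inl hx
      · exact Or.inr ⟨x, Function.update_of_ne hx _ _⟩
    rw [classCount_ker, classCount, ← Set.ncard_univ]
    exact (Set.ncard_le_ncard hrange).trans (Set.ncard_insert_le _ _)

end ClassCount

theorem card_ofSetoid_parts {X : Type*} [Fintype X] [DecidableEq X] (r : Setoid X)
    [DecidableRel r.r] : (Finpartition.ofSetoid r).parts.card = classCount r := by
  have hker : Setoid.ker (fun a => Finset.univ.filter (r.r a)) = r := by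
    ext a b
    simp only [Setoid.ker_def, Finset.ext_iff, Finset.mem_filter_univ]
    exact ⟨fun h => (h b).mpr (r.refl b), fun h c =>
      ⟨fun hac => r.trans' (r.symm' h) hac, fun hbc => r.trans' h hbc⟩⟩
  conv_rhs => rw [← hker, classCount_ker]
  rw [Finpartition.ofSetoid, Finpartition.ofSetSetoid_parts, ← Set.ncard_coe_finset,
    Finset.coe_image, Finset.coe_univ, Set.image_univ]

theorem setoid_sameCycle_le_iff {X : Type*} [Finite X] {σ : Perm X} {r : Setoid X} :
    SameCycle.setoid σ ≤ r ↔ ∀ x, r x (σ x) := by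
  refine ⟨fun h x => h (SameCycle.refl σ x).apply_right, fun h x y hxy => ?_⟩
  obtain ⟨n, rfl⟩ := SameCycle.exists_nat_pow_eq hxy
  clear hxy
  induction n with
  | zero => exact r.refl' x
  | succ n ih =>
    rw [pow_succ', Perm.mul_apply]
    exact r.trans' ih (h _)

section Cycles

variable {X : Type*} [Fintype X] [DecidableEq X]

/-- The number of cycles of a permutation, fixed points included. It agrees with `numCycles` on
`Fin t ⊕ Fin s`. -/
noncomputable def cycleCount (σ : Perm X) : ℕ := Multiset.card σ.partition.parts

/-- The multiplicative extension `u_σ`: the product of `u |c|` over all cycles `c` of `σ`, fixed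
points included. It agrees with `permProd` on `Fin t ⊕ Fin s`. -/
noncomputable def cycleProd (u : ℕ → ℝ) (σ : Perm X) : ℝ := (σ.partition.parts.map u).prod

open Classical in
/-- The partition of the ground set into the cycles of a permutation. -/
noncomputable def cyclePartition (σ : Perm X) : Finpartition (Finset.univ : Finset X) :=
  Finpartition.ofSetoid (SameCycle.setoid σ)

theorem cyclePartition_parts (σ : Perm X) :
    (cyclePartition σ).parts = Finset.univ.image fun a => Finset.univ.filter (SameCycle σ a) := by
  unfold cyclePartition Finpartition.ofSetoid
  rw [Finpartition.ofSetSetoid_parts]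
  congr! 3

theorem cyclePartition_parts_eq_union (σ : Perm X) :
    (cyclePartition σ).parts =
      σ.cycleFactorsFinset.image Perm.support ∪ σ.supportᶜ.image fun a => {a} := by
  classical
  have hmoved : ∀ a ∈ σ.support,
      Finset.univ.filter (SameCycle σ a) = (σ.cycleOf a).support := fun a ha => by
    ext b
    rw [Finset.mem_filter_univ, mem_support_cycleOf_iff, and_iff_left ha]
  have hfixed : ∀ a ∈ σ.supportᶜ, Finset.univ.filter (SameCycle σ a) = {a} := fun a ha => by
    ext b
    have hfix : Function.IsFixedPt σ a := by simpa [Function.IsFixedPt] using ha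
    simp only [Finset.mem_filter_univ, Finset.mem_singleton]
    exact ⟨fun h => (h.eq_of_left hfix).symm, fun h => h ▸ SameCycle.refl σ a⟩
  have hcycles : σ.cycleFactorsFinset = σ.support.image σ.cycleOf := by
    ext c
    rw [Finset.mem_image]
    constructor
    · intro hc
      obtain ⟨a, ha⟩ := (mem_cycleFactorsFinset_iff.mp hc).1.nonempty_support
      exact ⟨a, mem_cycleFactorsFinset_support_le hc ha, (cycle_is_cycleOf ha hc).symm⟩
    · rintro ⟨a, ha, rfl⟩
      exact cycleOf_mem_cycleFactorsFinset_iff.mpr ha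
  have himage : ∀ F : X → Finset X,
      Finset.univ.image F = σ.support.image F ∪ σ.supportᶜ.image F := fun F => by
    rw [← Finset.image_union, Finset.union_compl]
  rw [cyclePartition_parts, himage, Finset.image_congr hmoved, Finset.image_congr hfixed,
    hcycles, Finset.image_image]
  rfl

theorem partition_parts_eq_map_card (σ : Perm X) :
    σ.partition.parts = (cyclePartition σ).parts.val.map Finset.card := by
  have hinj : Set.InjOn Perm.support (σ.cycleFactorsFinset : Set (Perm X)) := by
    intro c hc c' hc' h
    obtain ⟨a, ha⟩ := (mem_cycleFactorsFinset_iff.mp hc).1.nonempty_support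
    rw [cycle_is_cycleOf ha hc, cycle_is_cycleOf (h ▸ ha) hc']
  have hdisj : Disjoint (σ.cycleFactorsFinset.image Perm.support)
      (σ.supportᶜ.image fun a => ({a} : Finset X)) := by
    simp only [Finset.disjoint_left, Finset.mem_image]
    rintro _ ⟨c, hc, rfl⟩ ⟨a, -, ha⟩
    have := (mem_cycleFactorsFinset_iff.mp hc).1.two_le_card_support
    simp [← ha] at this
  rw [cyclePartition_parts_eq_union, ← Finset.disjUnion_eq_union _ _ hdisj, Finset.disjUnion_val,
    Multiset.map_add, Finset.image_val_of_injOn hinj,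
    Finset.image_val_of_injOn Finset.singleton_injective.injOn, Multiset.map_map,
    Multiset.map_map, parts_partition, cycleType_def]
  simp only [Function.comp_def, Finset.card_singleton, Multiset.map_const', Finset.card_val,
    Finset.card_compl]

theorem cycleCount_eq_card_parts (σ : Perm X) :
    cycleCount σ = (cyclePartition σ).parts.card := by
  rw [cycleCount, partition_parts_eq_map_card, Multiset.card_map, Finset.card_val]

theorem cycleCount_eq_classCount (σ : Perm X) :
    cycleCount σ = classCount (SameCycle.setoid σ) := by
  rw [cycleCount_eq_card_parts, cyclePartition, card_ofSetoid_parts]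

theorem cycleCount_le_card (σ : Perm X) : cycleCount σ ≤ Fintype.card X := by
  rw [cycleCount_eq_classCount, ← Nat.card_eq_fintype_card]
  exact classCount_le_card _

theorem cycleCount_one : cycleCount (1 : Perm X) = Fintype.card X := by
  simp [cycleCount, parts_partition]

theorem cycleCount_mul_comm (σ τ : Perm X) : cycleCount (σ * τ) = cycleCount (τ * σ) := by
  have hconj : IsConj (σ * τ) (τ * σ) := isConj_iff.mpr ⟨τ, by group⟩
  rw [cycleCount, cycleCount, partition_eq_of_isConj.mp hconj]

theorem even_card_add_cycleCount_iff (σ : Perm X) :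
    Even (Fintype.card X + cycleCount σ) ↔ sign σ = 1 := by
  have hsupp : σ.support.card ≤ Fintype.card X := σ.support.card_le_univ
  have hcount : Fintype.card X + cycleCount σ =
      (σ.cycleType.sum + Multiset.card σ.cycleType) + 2 * (Fintype.card X - σ.support.card) := by
    rw [cycleCount, parts_partition, Multiset.card_add, Multiset.card_replicate, sum_cycleType]
    omega
  rw [sign_of_cycleType, hcount, Nat.even_add, iff_true_right (even_two_mul _)]
  rcases Nat.even_or_odd (σ.cycleType.sum + Multiset.card σ.cycleType) with h | h
  · simp [h.neg_one_pow, h]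
  · simp [h.neg_one_pow, Nat.not_even_iff_odd.mpr h]

theorem even_cycleCount_swap_mul_iff (σ : Perm X) {a b : X} (hab : a ≠ b) :
    Even (cycleCount (swap a b * σ)) ↔ ¬ Even (cycleCount σ) := by
  have h₁ := even_card_add_cycleCount_iff (swap a b * σ)
  have h₂ := even_card_add_cycleCount_iff σ
  rw [Perm.sign_mul, sign_swap hab] at h₁
  rcases Int.units_eq_one_or (sign σ) with hσ | hσ <;> simp [hσ, Nat.even_add] at h₁ h₂ <;> tauto

theorem setoid_swap_mul_le {X : Type*} [Finite X] [DecidableEq X] {σ : Perm X} {a b : X}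
    {r : Setoid X} (h : SameCycle.setoid σ ≤ r) (hab : r a b) :
    SameCycle.setoid (swap a b * σ) ≤ r := by
  rw [setoid_sameCycle_le_iff] at h ⊢
  intro x
  refine r.trans' (h x) ?_
  rw [Perm.mul_apply, swap_apply_def]
  split_ifs with ha hb
  · rwa [ha]
  · rw [hb]
    exact r.symm' hab
  · exact r.refl' _

theorem cycleCount_le_cycleCount_swap_mul_add_one (σ : Perm X) (a b : X) :
    cycleCount σ ≤ cycleCount (swap a b * σ) + 1 := by
  obtain ⟨s, hσs, hab, hcount⟩ := exists_le_rel_classCount_le_add_one (SameCycle.setoid σ) a b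
  rw [cycleCount_eq_classCount, cycleCount_eq_classCount]
  exact hcount.trans (Nat.add_le_add_right (classCount_anti (setoid_swap_mul_le hσs hab)) 1)

theorem cycleCount_swap_mul_le_add_one (σ : Perm X) (a b : X) :
    cycleCount (swap a b * σ) ≤ cycleCount σ + 1 := by
  simpa using cycleCount_le_cycleCount_swap_mul_add_one (swap a b * σ) a b

theorem cycleCount_swap_mul_of_sameCycle {σ : Perm X} {a b : X} (hab : a ≠ b)
    (h : SameCycle σ a b) : cycleCount (swap a b * σ) = cycleCount σ + 1 := by
  have hle : cycleCount σ ≤ cycleCount (swap a b * σ) := by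
    rw [cycleCount_eq_classCount, cycleCount_eq_classCount]
    exact classCount_anti (setoid_swap_mul_le le_rfl h)
  have hparity := even_cycleCount_swap_mul_iff σ hab
  have := cycleCount_swap_mul_le_add_one σ a b
  grind

theorem sameCycle_swap_mul_of_not_sameCycle {X : Type*} [Finite X] [DecidableEq X] {σ : Perm X}
    {a b : X} (h : ¬ SameCycle σ a b) : SameCycle (swap a b * σ) a b := by
  -- Follow the `σ`-orbit of `b` until its first return: up to there the transposition is not
  -- felt, and at the return it sends `b` to `a`.
  have hex : ∃ k, (σ ^ (k + 1)) b = b :=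
    ⟨orderOf σ - 1, by rw [Nat.sub_add_cancel (orderOf_pos σ), pow_orderOf_eq_one, one_apply]⟩
  have hfollow : ∀ i ≤ Nat.find hex, ((swap a b * σ) ^ i) b = (σ ^ i) b := by
    intro i
    induction i with
    | zero => exact fun _ => rfl
    | succ i ih =>
      intro hi
      rw [pow_succ', Perm.mul_apply, ih (by omega), Perm.mul_apply, pow_succ', Perm.mul_apply]
      refine swap_apply_of_ne_of_ne ?_ ?_ <;> rw [← Perm.mul_apply, ← pow_succ']
      · rintro heq
        exact h (SameCycle.symm ⟨(i + 1 : ℕ), by rwa [zpow_natCast]⟩)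
      · exact Nat.find_min hex hi
  refine SameCycle.symm ⟨(Nat.find hex + 1 : ℕ), ?_⟩
  rw [zpow_natCast, pow_succ', Perm.mul_apply, hfollow _ le_rfl, Perm.mul_apply,
    ← Perm.mul_apply σ, ← pow_succ', Nat.find_spec hex, swap_apply_right]

theorem cycleCount_swap_mul_of_not_sameCycle {σ : Perm X} {a b : X} (h : ¬ SameCycle σ a b) :
    cycleCount (swap a b * σ) + 1 = cycleCount σ := by
  have hab : a ≠ b := fun he => h (he ▸ SameCycle.refl _ _)
  simpa using (cycleCount_swap_mul_of_sameCycle hab (sameCycle_swap_mul_of_not_sameCycle h)).symm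

theorem exists_apply_ne_of_ne_one {X : Type*} {σ : Perm X} (h : σ ≠ 1) : ∃ a, σ a ≠ a := by
  by_contra! hall
  exact h (Perm.ext hall)

theorem cycleCount_eq_card_iff {σ : Perm X} : cycleCount σ = Fintype.card X ↔ σ = 1 := by
  refine ⟨fun h => ?_, fun h => h ▸ cycleCount_one⟩
  by_contra hne
  obtain ⟨a, ha⟩ := exists_apply_ne_of_ne_one hne
  have := cycleCount_swap_mul_of_sameCycle ha.symm (SameCycle.refl σ a).apply_right
  have := cycleCount_le_card (swap a (σ a) * σ)
  omega

end Cycles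

section JoinSetoid

/-- The orbit equivalence relation of the group generated by two permutations. -/
def joinSetoid {X : Type*} (σ α : Perm X) : Setoid X := SameCycle.setoid σ ⊔ SameCycle.setoid α

variable {X : Type*} [Finite X]

theorem joinSetoid_le_iff {σ α : Perm X} {r : Setoid X} :
    joinSetoid σ α ≤ r ↔ (∀ x, r x (σ x)) ∧ ∀ x, r x (α x) := by
  rw [joinSetoid, sup_le_iff, setoid_sameCycle_le_iff, setoid_sameCycle_le_iff]

theorem joinSetoid_apply_left (σ α : Perm X) (x : X) : joinSetoid σ α x (σ x) :=
  (joinSetoid_le_iff.mp le_rfl).1 x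

theorem joinSetoid_apply_right (σ α : Perm X) (x : X) : joinSetoid σ α x (α x) :=
  (joinSetoid_le_iff.mp le_rfl).2 x

theorem setoid_mul_inv_le_joinSetoid (σ α : Perm X) :
    SameCycle.setoid (α * σ⁻¹) ≤ joinSetoid σ α := by
  refine setoid_sameCycle_le_iff.mpr fun x => ?_
  have hσ : joinSetoid σ α (σ⁻¹ x) x := by
    simpa using joinSetoid_apply_left σ α (σ⁻¹ x)
  exact (joinSetoid σ α).trans' ((joinSetoid σ α).symm' hσ) (joinSetoid_apply_right σ α _)

variable [DecidableEq X]

theorem joinSetoid_swap_mul_le {σ α : Perm X} {a b : X} {r : Setoid X}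
    (h : joinSetoid σ α ≤ r) (hab : r a b) : joinSetoid (swap a b * σ) α ≤ r :=
  sup_le (setoid_swap_mul_le (le_sup_left.trans h) hab) (le_sup_right.trans h)

end JoinSetoid

section Genus

variable {X : Type*} [Fintype X] [DecidableEq X]

theorem cycleCount_swap_mul_inv_mul_add_le (σ α : Perm X) (a b : X) :
    cycleCount ((swap a b * σ)⁻¹ * α) + 2 * classCount (joinSetoid σ α) ≤
      cycleCount (σ⁻¹ * α) + 1 + 2 * classCount (joinSetoid (swap a b * σ) α) := by
  have hleft : cycleCount ((swap a b * σ)⁻¹ * α) = cycleCount (swap a b * (α * σ⁻¹)) := by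
    rw [mul_inv_rev, swap_inv, mul_assoc, cycleCount_mul_comm, mul_assoc]
  rw [hleft, cycleCount_mul_comm σ⁻¹]
  by_cases hab : joinSetoid σ α a b
  · have := classCount_anti (joinSetoid_swap_mul_le le_rfl hab)
    have := cycleCount_swap_mul_le_add_one (α * σ⁻¹) a b
    omega
  · obtain ⟨s, hle, hs, hcount⟩ := exists_le_rel_classCount_le_add_one (joinSetoid σ α) a b
    have := classCount_anti (joinSetoid_swap_mul_le hle hs)
    have := cycleCount_swap_mul_of_not_sameCycle fun h =>
      hab (setoid_mul_inv_le_joinSetoid σ α h)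
    omega

/-- The genus of a pair of permutations is nonnegative. -/
theorem cycleCount_add_cycleCount_add_cycleCount_le (σ α : Perm X) :
    cycleCount σ + cycleCount α + cycleCount (σ⁻¹ * α) ≤
      Fintype.card X + 2 * classCount (joinSetoid σ α) := by
  induction hk : Fintype.card X - cycleCount σ generalizing σ with
  | zero =>
    have hle := cycleCount_le_card σ
    obtain rfl : σ = 1 := cycleCount_eq_card_iff.mp (by omega)
    have hα := classCount_anti
      (joinSetoid_le_iff.mpr ⟨(SameCycle.setoid α).refl',
        setoid_sameCycle_le_iff.mp le_rfl⟩ : joinSetoid 1 α ≤ SameCycle.setoid α)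
    rw [← cycleCount_eq_classCount] at hα
    rw [cycleCount_one, inv_one, one_mul]
    omega
  | succ k ih =>
    obtain ⟨a, ha⟩ := exists_apply_ne_of_ne_one (σ := σ) fun h => by
      rw [h, cycleCount_one] at hk
      omega
    have hsplit := cycleCount_swap_mul_of_sameCycle ha.symm (SameCycle.refl σ a).apply_right
    have hstep := cycleCount_swap_mul_inv_mul_add_le (swap a (σ a) * σ) α a (σ a)
    rw [swap_mul_self_mul] at hstep
    have := ih (swap a (σ a) * σ) (by omega)
    omega

end Genus

/-! ## Non-crossing partitions as permutations of genus zero -/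

theorem cycleCount_eq_one_iff {X : Type*} [Fintype X] [DecidableEq X] {σ : Perm X} :
    cycleCount σ = 1 ↔ Nonempty X ∧ ∀ x y, SameCycle σ x y := by
  rw [cycleCount_eq_classCount, classCount_eq_one_iff, Setoid.eq_top_iff]
  rfl

section LongCycle

variable {n : ℕ}

theorem val_finRotate (x : Fin n) :
    (finRotate n x : ℕ) = if (x : ℕ) + 1 = n then 0 else (x : ℕ) + 1 := by
  cases n with
  | zero => exact x.elim0
  | succ n => simp only [coe_finRotate, Fin.ext_iff, Fin.val_last, Nat.add_right_cancel_iff]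

theorem sameCycle_finRotate (x y : Fin n) : SameCycle (finRotate n) x y := by
  rcases lt_or_ge n 2 with hn | hn
  · have : Subsingleton (Fin n) := Fin.subsingleton_iff_le_one.mpr (by omega)
    rw [Subsingleton.elim x y]
  · have hmoved (z : Fin n) : finRotate n z ≠ z :=
      mem_support.mp (support_finRotate_of_le hn ▸ Finset.mem_univ z)
    exact (isCycle_finRotate_of_le hn).sameCycle (hmoved x) (hmoved y)

theorem cycleCount_finRotate (hn : 1 ≤ n) : cycleCount (finRotate n) = 1 :=
  cycleCount_eq_one_iff.mpr ⟨⟨⟨0, hn⟩⟩, sameCycle_finRotate⟩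

end LongCycle

section Arc

variable {X : Type*}

/-- The equivalence relation whose classes are the interval `[a, b)` and its complement. -/
def arcSetoid [Preorder X] (a b : X) : Setoid X := Setoid.ker (· ∈ Set.Ico a b)

theorem arcSetoid_iff [Preorder X] {a b x y : X} :
    arcSetoid a b x y ↔ (x ∈ Set.Ico a b ↔ y ∈ Set.Ico a b) := by
  rw [arcSetoid, Setoid.ker_def, eq_iff_iff]

theorem not_arcSetoid_of_lt [Preorder X] {a b : X} (hab : a < b) : ¬ arcSetoid a b a b := by
  simp [arcSetoid_iff, hab]

theorem sameCycle_swap_mul_finRotate_le {n : ℕ} {a b : Fin n} (hab : a < b) :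
    SameCycle.setoid (swap a b * finRotate n) ≤ arcSetoid a b := by
  refine setoid_sameCycle_le_iff.mpr fun x => ?_
  rw [arcSetoid_iff, Perm.mul_apply, swap_apply_def]
  have hx := val_finRotate x
  have hbn := b.isLt
  split_ifs with hxa hxb <;> simp only [Set.mem_Ico, Fin.le_def, Fin.lt_def, Fin.ext_iff] at * <;>
    split_ifs at hx <;> omega

end Arc

section NonCrossingRel

variable {X : Type*}

/-- An equivalence relation on an ordered set is non-crossing if the classes of `a < b < c < d`
with `a ~ c` and `b ~ d` coincide. -/
def IsNonCrossingRel [Preorder X] (r : Setoid X) : Prop :=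
  ∀ ⦃a b c d⦄, a < b → b < c → c < d → r a c → r b d → r a b

/-- The equivalence relation obtained from `r` by making `a` a class of its own. -/
def detach (r : Setoid X) (a : X) : Setoid X := r ⊓ Setoid.ker (· = a)

theorem detach_iff {r : Setoid X} {a x y : X} : detach r a x y ↔ r x y ∧ (x = a ↔ y = a) := by
  rw [detach, Setoid.inf_iff_and, Setoid.ker_def, eq_iff_iff]

theorem detach_le (r : Setoid X) (a : X) : detach r a ≤ r := inf_le_left

theorem not_detach_of_ne {r : Setoid X} {a b : X} (hab : a ≠ b) : ¬ detach r a a b :=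
  fun h => hab ((detach_iff.mp h).2.mp rfl).symm

theorem le_of_detach_le {r s : Setoid X} {a b : X} (hab : a ≠ b) (hr : r a b)
    (h : detach r a ≤ s) (hs : s a b) : r ≤ s := by
  have hclass {z : X} (hz : r a z) : s a z := by
    by_cases hza : z = a
    · exact hza ▸ s.refl' z
    · exact s.trans' hs (h (detach_iff.mpr ⟨r.trans' (r.symm' hr) hz, by simp [hab.symm, hza]⟩))
  intro x y hxy
  by_cases hx : x = a
  · exact hx ▸ hclass (hx ▸ hxy)
  by_cases hy : y = a
  · exact hy ▸ s.symm' (hclass (hy ▸ r.symm' hxy))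
  · exact h (detach_iff.mpr ⟨hxy, by simp [hx, hy]⟩)

theorem isNonCrossingRel_detach [Preorder X] {r : Setoid X} (hr : IsNonCrossingRel r) (e : X) :
    IsNonCrossingRel (detach r e) := by
  intro a b c d hab hbc hcd hac hbd
  rw [detach_iff] at hac hbd ⊢
  have hae : a ≠ e := fun h => (hab.trans hbc).ne (h.trans (hac.2.mp h).symm)
  have hbe : b ≠ e := fun h => (hbc.trans hcd).ne (h.trans (hbd.2.mp h).symm)
  exact ⟨hr hab hbc hcd hac.1 hbd.1, by simp [hae, hbe]⟩

theorem IsNonCrossingRel.detach_le_arcSetoid [LinearOrder X] {r : Setoid X}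
    (hr : IsNonCrossingRel r) {a b : X} (hb : IsLeast {c | a < c ∧ r a c} b) :
    detach r a ≤ arcSetoid a b := by
  obtain ⟨⟨-, hrab⟩, hmin⟩ := hb
  have hgap {x : X} (hax : a < x) (hxb : x < b) : ¬ r a x := fun h => (hmin ⟨hax, h⟩).not_gt hxb
  have hstay {x y : X} (hxy : r x y) (hxa : x ≠ a) (hx : x ∈ Set.Ico a b) : y ∈ Set.Ico a b := by
    have hax : a < x := hx.1.lt_of_ne' hxa
    by_contra hy
    refine hgap hax hx.2 ?_
    rcases lt_or_ge y a with hya | hay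
    · exact r.trans' (r.symm' (hr hya hax hx.2 (r.symm' hxy) hrab)) (r.symm' hxy)
    rcases (not_lt.mp fun hyb => hy ⟨hay, hyb⟩ : b ≤ y).eq_or_lt with rfl | hby
    · exact r.trans' hrab (r.symm' hxy)
    · exact hr hax hx.2 hby hrab hxy
  intro x y hxy
  obtain ⟨hr, ha⟩ := detach_iff.mp hxy
  by_cases hx : x = a
  · rw [hx, ha.mp hx]
  · rw [arcSetoid_iff]
    exact ⟨hstay hr hx, hstay (r.symm' hr) (mt ha.mpr hx)⟩

end NonCrossingRel

theorem setoid_swap_mul_eq_of_eq_detach {X : Type*} [Finite X] [DecidableEq X] {ρ : Perm X}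
    {r : Setoid X} {a b : X} (hab : a ≠ b) (hr : r a b) (hρ : SameCycle.setoid ρ = detach r a) :
    SameCycle.setoid (swap a b * ρ) = r := by
  have hnot : ¬ SameCycle ρ a b := fun h =>
    not_detach_of_ne hab (hρ ▸ (h : SameCycle.setoid ρ a b) : detach r a a b)
  have hmerge : SameCycle.setoid (swap a b * ρ) a b := sameCycle_swap_mul_of_not_sameCycle hnot
  refine le_antisymm (setoid_swap_mul_le (hρ ▸ detach_le r a) hr)
    (le_of_detach_le hab hr ?_ hmerge)
  simpa [← hρ] using setoid_swap_mul_le le_rfl hmerge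

section GenusZero

variable {n : ℕ} {σ : Perm (Fin n)}

/-- The permutations of `Fin n` of genus zero relative to the long cycle. Their cycle partitions
are the non-crossing partitions, see `bijOn_cyclePartition`. -/
def IsGenusZero (σ : Perm (Fin n)) : Prop :=
  cycleCount σ + cycleCount (σ⁻¹ * finRotate n) = n + 1

theorem IsGenusZero.setoid_swap_mul_le (hσ : IsGenusZero σ) {a b : Fin n} (hab : a < b)
    (h : SameCycle σ a b) : SameCycle.setoid (swap a b * σ) ≤ arcSetoid a b := by
  have hcycle := cycleCount_finRotate a.pos
  have hsplitσ := cycleCount_swap_mul_of_sameCycle hab.ne h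
  have hsplitγ := cycleCount_swap_mul_of_sameCycle hab.ne (sameCycle_finRotate a b)
  have hgenus := cycleCount_add_cycleCount_add_cycleCount_le (swap a b * σ) (swap a b * finRotate n)
  rw [mul_inv_rev, swap_inv, mul_assoc, swap_mul_self_mul, Fintype.card_fin] at hgenus
  have hjoin : SameCycle.setoid (swap a b * finRotate n) =
      joinSetoid (swap a b * σ) (swap a b * finRotate n) := by
    refine eq_of_le_of_classCount_le le_sup_right ?_
    rw [← cycleCount_eq_classCount]
    unfold IsGenusZero at hσ
    omega
  exact (le_sup_left.trans hjoin.ge).trans (sameCycle_swap_mul_finRotate_le hab)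

theorem IsGenusZero.mem_Ico_iff (hσ : IsGenusZero σ) {a b : Fin n} (hab : a < b)
    (h : SameCycle σ a b) (x : Fin n) :
    x ∈ Set.Ico a b ↔ swap a b (σ x) ∈ Set.Ico a b :=
  arcSetoid_iff.mp (setoid_sameCycle_le_iff.mp (hσ.setoid_swap_mul_le hab h) x)

theorem IsGenusZero.isNonCrossingRel (hσ : IsGenusZero σ) :
    IsNonCrossingRel (SameCycle.setoid σ) := by
  intro a b c d hab hbc hcd hac hbd
  by_contra hnot
  have hstay (k : ℕ) : (σ ^ k) b ∈ Set.Ico a c := by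
    induction k with
    | zero => exact ⟨hab.le, hbc⟩
    | succ k ih =>
      have hb : SameCycle σ b ((σ ^ (k + 1)) b) := sameCycle_pow_right.mpr (SameCycle.refl σ b)
      have hne_a : (σ ^ (k + 1)) b ≠ a := fun h => hnot (h ▸ hb).symm
      have hne_c : (σ ^ (k + 1)) b ≠ c := fun h => hnot (hac.trans (h ▸ hb).symm)
      have hstep := (hσ.mem_Ico_iff (hab.trans hbc) hac _).mp ih
      rw [pow_succ', Perm.mul_apply] at hne_a hne_c ⊢
      rwa [swap_apply_of_ne_of_ne hne_a hne_c] at hstep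
  obtain ⟨k, rfl⟩ := SameCycle.exists_nat_pow_eq hbd
  exact (hstay k).2.not_gt hcd

theorem IsGenusZero.not_apply_lt_apply {τ : Perm (Fin n)} (hσ : IsGenusZero σ)
    (hτ : IsGenusZero τ) {a : Fin n} (h₁ : SameCycle σ (σ a) (τ a))
    (h₂ : SameCycle τ (σ a) (τ a)) : ¬ σ a < τ a := fun hlt => by
  have hσa := hσ.mem_Ico_iff hlt h₁ a
  have hτa := hτ.mem_Ico_iff hlt h₂ a
  rw [swap_apply_left] at hσa
  rw [swap_apply_right] at hτa
  exact (hσa.mp (hτa.mpr ⟨le_rfl, hlt⟩)).2.false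

theorem IsGenusZero.eq_of_setoid_eq {τ : Perm (Fin n)} (hσ : IsGenusZero σ) (hτ : IsGenusZero τ)
    (h : SameCycle.setoid σ = SameCycle.setoid τ) : σ = τ := by
  have hiff (x y : Fin n) : SameCycle σ x y ↔ SameCycle τ x y := Setoid.ext_iff.mp h x y
  ext1 a
  have hσa : SameCycle σ (σ a) (τ a) := sameCycle_apply_left.mpr
    ((hiff _ _).mpr (SameCycle.refl τ a).apply_right)
  have hτa : SameCycle τ (σ a) (τ a) := (hiff _ _).mp hσa
  exact le_antisymm (not_lt.mp (hτ.not_apply_lt_apply hσ hτa.symm hσa.symm))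
    (not_lt.mp (hσ.not_apply_lt_apply hτ hσa hτa))

theorem isGenusZero_one (hn : 1 ≤ n) : IsGenusZero (1 : Perm (Fin n)) := by
  rw [IsGenusZero, inv_one, one_mul, cycleCount_finRotate hn, cycleCount_one, Fintype.card_fin]

theorem IsGenusZero.swap_mul {a b : Fin n} (hab : a < b) (hσ : IsGenusZero σ)
    (harc : SameCycle.setoid σ ≤ arcSetoid a b) : IsGenusZero (swap a b * σ) := by
  have hmerge := cycleCount_swap_mul_of_not_sameCycle fun h =>
    not_arcSetoid_of_lt hab (harc h)
  set γ := swap a b * finRotate n with hγ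
  have hγarc : SameCycle.setoid (γ * σ⁻¹) ≤ arcSetoid a b :=
    (setoid_mul_inv_le_joinSetoid σ γ).trans (sup_le harc (sameCycle_swap_mul_finRotate_le hab))
  have hsplit := cycleCount_swap_mul_of_not_sameCycle fun h =>
    not_arcSetoid_of_lt hab (hγarc h)
  rw [cycleCount_mul_comm γ, hγ, mul_assoc, swap_mul_self_mul, cycleCount_mul_comm (finRotate n),
    ← hγ] at hsplit
  unfold IsGenusZero at hσ ⊢
  rw [mul_inv_rev, swap_inv, mul_assoc, ← hγ]
  omega

theorem IsNonCrossingRel.exists_isGenusZero (hn : 1 ≤ n) {r : Setoid (Fin n)}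
    (hr : IsNonCrossingRel r) :
    ∃ σ : Perm (Fin n), IsGenusZero σ ∧ SameCycle.setoid σ = r := by
  induction hk : n - classCount r using Nat.strong_induction_on generalizing r with
  | _ k ih =>
    by_cases hlast : ∀ a b, a < b → ¬ r a b
    · have hbot : r ≤ ⊥ := fun x y hxy => by
        rcases lt_trichotomy x y with h | h | h
        · exact absurd hxy (hlast x y h)
        · exact h
        · exact absurd (r.symm' hxy) (hlast y x h)
      refine ⟨1, isGenusZero_one hn, le_antisymm ?_ (hbot.trans bot_le)⟩
      exact setoid_sameCycle_le_iff.mpr r.refl'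
    push Not at hlast
    obtain ⟨a, hlast⟩ := hlast
    obtain ⟨b, hbr, hbmin⟩ := Set.exists_min_image {c | a < c ∧ r a c} id (Set.toFinite _) hlast
    obtain ⟨hab, hrab⟩ := hbr
    have hcount : classCount r < classCount (detach r a) := by
      by_contra! hle
      exact not_detach_of_ne hab.ne (eq_of_le_of_classCount_le (detach_le r a) hle ▸ hrab)
    have hcount_le : classCount (detach r a) ≤ n := by
      simpa using classCount_le_card (detach r a)
    obtain ⟨ρ, hρ, hρr⟩ := ih _ (by omega) (isNonCrossingRel_detach hr a) rfl
    exact ⟨swap a b * ρ, hρ.swap_mul hab (hρr ▸ hr.detach_le_arcSetoid ⟨⟨hab, hrab⟩, hbmin⟩),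
      setoid_swap_mul_eq_of_eq_detach hab.ne hrab hρr⟩

end GenusZero

section NonCrossingPartitions

theorem ker_part_iff {X : Type*} [Fintype X] [DecidableEq X]
    (π : Finpartition (Finset.univ : Finset X)) {x y : X} :
    Setoid.ker π.part x y ↔ x ∈ π.part y := by
  rw [Setoid.ker_def, π.mem_part_iff_part_eq_part (Finset.mem_univ x) (Finset.mem_univ y)]

theorem ker_part_injective {X : Type*} [Fintype X] [DecidableEq X] :
    Function.Injective fun π : Finpartition (Finset.univ : Finset X) => Setoid.ker π.part := by
  intro π π' h
  have hpart : π.part = π'.part := by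
    ext x y
    rw [← ker_part_iff, ← ker_part_iff]
    exact Setoid.ext_iff.mp h y x
  have hparts (π : Finpartition (Finset.univ : Finset X)) :
      Finset.univ.image π.part = π.parts := by
    refine subset_antisymm (Finset.image_subset_iff.mpr fun _ => π.part_mem.mpr)
      fun V hV => ?_
    obtain ⟨x, hx, rfl⟩ := π.part_surjOn hV
    exact Finset.mem_image_of_mem _ hx
  exact Finpartition.ext (by rw [← hparts π, hpart, hparts π'])

theorem ker_cyclePartition_part {X : Type*} [Fintype X] [DecidableEq X] (σ : Perm X) :
    Setoid.ker (cyclePartition σ).part = SameCycle.setoid σ := by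
  ext x y
  rw [ker_part_iff, cyclePartition]
  convert (Finpartition.mem_part_ofSetoid_iff_rel (s := SameCycle.setoid σ) (a := y) (b := x)).trans
    (SameCycle.setoid σ).comm' using 1

variable {n : ℕ}

theorem isNonCrossing_iff_isNonCrossingRel (π : SetPartition n) :
    IsNonCrossing π ↔ IsNonCrossingRel (Setoid.ker π.part) := by
  have hmem (x : Fin n) : x ∈ π.part x := π.mem_part (Finset.mem_univ x)
  have hparts (x : Fin n) : π.part x ∈ π.parts := π.part_mem.mpr (Finset.mem_univ x)
  refine ⟨fun h a b c d hab hbc hcd hac hbd => ?_, ?_⟩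
  · rw [Setoid.ker_def] at hac hbd ⊢
    exact h a b c d hab hbc hcd _ (hparts a) _ (hparts b) (hmem a) (hac ▸ hmem c) (hmem b)
      (hbd ▸ hmem d)
  · intro h a b c d hab hbc hcd V hV W hW ha hc hb hd
    have hpart {x : Fin n} {U : Finset (Fin n)} (hU : U ∈ π.parts) (hx : x ∈ U) :
        π.part x = U := π.part_eq_of_mem hU hx
    have := h hab hbc hcd ((hpart hV ha).trans (hpart hV hc).symm)
      ((hpart hW hb).trans (hpart hW hd).symm)
    exact (hpart hV ha).symm.trans (this.trans (hpart hW hb))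

theorem bijOn_cyclePartition (hn : 1 ≤ n) :
    Set.BijOn (cyclePartition : Perm (Fin n) → SetPartition n) {σ | IsGenusZero σ}
      {π | IsNonCrossing π} := by
  refine ⟨fun σ hσ => ?_, fun σ hσ τ hτ h => ?_, fun π hπ => ?_⟩
  · rw [Set.mem_ofPred_eq, isNonCrossing_iff_isNonCrossingRel, ker_cyclePartition_part]
    exact hσ.isNonCrossingRel
  · refine hσ.eq_of_setoid_eq hτ ?_
    rw [← ker_cyclePartition_part, h, ker_cyclePartition_part]
  · rw [Set.mem_ofPred_eq, isNonCrossing_iff_isNonCrossingRel] at hπ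
    obtain ⟨σ, hσ, hσπ⟩ := hπ.exists_isGenusZero hn
    exact ⟨σ, hσ, ker_part_injective ((ker_cyclePartition_part σ).trans hσπ)⟩

open Classical in
theorem sum_NC_eq_sum_isGenusZero {M : Type*} [AddCommMonoid M] (hn : 1 ≤ n)
    (F : Multiset ℕ → M) :
    ∑ π ∈ NC n, F (π.parts.val.map Finset.card) =
      ∑ σ : Perm (Fin n) with IsGenusZero σ, F σ.partition.parts := by
  symm
  refine Finset.sum_nbij cyclePartition ?_ ?_ ?_ fun σ _ => by rw [partition_parts_eq_map_card]
  · intro σ hσ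
    simpa [NC] using (bijOn_cyclePartition hn).mapsTo (by simpa using hσ)
  · simpa using (bijOn_cyclePartition hn).injOn
  · simpa [NC] using (bijOn_cyclePartition hn).surjOn

end NonCrossingPartitions

/-! ## Splitting a pair of permutations along an orbit -/

section Transport

variable {X Y : Type*}

theorem joinSetoid_le_comap_of_semiconj [Finite X] [Finite Y] {f : X → Y} {σ α : Perm X}
    {σ' α' : Perm Y} (hσ : Function.Semiconj f σ σ') (hα : Function.Semiconj f α α') :
    joinSetoid σ α ≤ (joinSetoid σ' α').comap f := by
  refine joinSetoid_le_iff.mpr ⟨fun x => ?_, fun x => ?_⟩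
  · rw [Setoid.comap_rel, hσ x]
    exact joinSetoid_apply_left σ' α' (f x)
  · rw [Setoid.comap_rel, hα x]
    exact joinSetoid_apply_right σ' α' (f x)

theorem joinSetoid_permCongrHom_eq_top_iff [Finite X] [Finite Y] (e : X ≃ Y) {σ α : Perm X} :
    joinSetoid (e.permCongrHom σ) (e.permCongrHom α) = ⊤ ↔ joinSetoid σ α = ⊤ := by
  have hforth (τ : Perm X) : Function.Semiconj e τ (e.permCongrHom τ) := fun x => by simp
  have hback (τ : Perm X) : Function.Semiconj e.symm (e.permCongrHom τ) τ := fun x => by simp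
  simp only [eq_top_iff]
  refine ⟨fun h x y _ => ?_, fun h x y _ => ?_⟩
  · simpa only [Setoid.comap_rel, e.symm_apply_apply] using
      joinSetoid_le_comap_of_semiconj (hback σ) (hback α) (h (x := e x) (y := e y) trivial)
  · simpa only [Setoid.comap_rel, e.apply_symm_apply] using joinSetoid_le_comap_of_semiconj
      (hforth σ) (hforth α) (h (x := e.symm x) (y := e.symm y) trivial)

variable [Fintype X] [DecidableEq X] [Fintype Y] [DecidableEq Y]

theorem parts_permCongrHom (e : X ≃ Y) (σ : Perm X) :
    (e.permCongrHom σ).partition.parts = σ.partition.parts := by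
  let f : X ≃ {_y : Y // True} := e.trans (subtypeUnivEquiv fun _ => trivial).symm
  have hext : e.permCongrHom σ = σ.extendDomain f := by
    ext y
    simp [f, extendDomain_apply_subtype]
  have htype : (e.permCongrHom σ).cycleType = σ.cycleType := by rw [hext, cycleType_extendDomain]
  rw [parts_partition, parts_partition, ← sum_cycleType, ← sum_cycleType, htype,
    Fintype.card_congr e]

theorem cycleProd_permCongrHom (u : ℕ → ℝ) (e : X ≃ Y) (σ : Perm X) :
    cycleProd u (e.permCongrHom σ) = cycleProd u σ := by
  rw [cycleProd, cycleProd, parts_permCongrHom]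

end Transport

section SubtypeCongr

variable {X : Type*} {p : X → Prop} [DecidablePred p]

theorem apply_subtypeCongrHom_iff (P : Perm {x // p x} × Perm {x // ¬ p x}) (x : X) :
    p (subtypeCongrHom p P x) ↔ p x := by
  by_cases hx : p x
  · simpa [subtypeCongr.left_apply P.1 P.2 hx, hx] using (P.1 ⟨x, hx⟩).2
  · simpa [subtypeCongr.right_apply P.1 P.2 hx, hx] using (P.2 ⟨x, hx⟩).2

theorem mem_range_subtypeCongrHom_iff {σ : Perm X} :
    σ ∈ Set.range (subtypeCongrHom p) ↔ ∀ x, p (σ x) ↔ p x := by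
  refine ⟨?_, fun h => ⟨(σ.subtypePerm h, σ.subtypePerm fun x => not_congr (h x)), ?_⟩⟩
  · rintro ⟨P, rfl⟩ x
    exact apply_subtypeCongrHom_iff P x
  · ext x
    by_cases hx : p x <;> simp [hx]

theorem subtypeCongrHom_eq_mul (P : Perm {x // p x} × Perm {x // ¬ p x}) :
    subtypeCongrHom p P = ofSubtype P.1 * ofSubtype P.2 := by
  ext x
  rw [Perm.mul_apply]
  by_cases hx : p x
  · rw [ofSubtype_apply_of_not_mem P.2 (not_not_intro hx), ofSubtype_apply_of_mem P.1 hx,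
      subtypeCongrHom_apply, subtypeCongr.left_apply _ _ hx]
  · rw [ofSubtype_apply_of_mem P.2 hx, ofSubtype_apply_of_not_mem P.1 (P.2 ⟨x, hx⟩).2,
      subtypeCongrHom_apply, subtypeCongr.right_apply _ _ hx]

theorem parts_subtypeCongrHom [Fintype X] [DecidableEq X] [Fintype {x // p x}]
    [Fintype {x // ¬ p x}] (P : Perm {x // p x} × Perm {x // ¬ p x}) :
    (subtypeCongrHom p P).partition.parts = P.1.partition.parts + P.2.partition.parts := by
  have hdisj : Perm.Disjoint (ofSubtype P.1) (ofSubtype P.2) := fun x => by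
    by_cases hx : p x
    · exact Or.inr (ofSubtype_apply_of_not_mem P.2 (not_not_intro hx))
    · exact Or.inl (ofSubtype_apply_of_not_mem P.1 hx)
  have htype : (subtypeCongrHom p P).cycleType = P.1.cycleType + P.2.cycleType := by
    rw [subtypeCongrHom_eq_mul, hdisj.cycleType_mul, cycleType_ofSubtype, cycleType_ofSubtype]
  have hcard : Fintype.card X = Fintype.card {x // p x} + Fintype.card {x // ¬ p x} := by
    rw [← Fintype.card_sum, Fintype.card_congr (sumCompl p)]
  have hsupp₁ : P.1.support.card ≤ Fintype.card {x // p x} := Finset.card_le_univ _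
  have hsupp₂ : P.2.support.card ≤ Fintype.card {x // ¬ p x} := Finset.card_le_univ _
  simp only [parts_partition, ← sum_cycleType, htype, hcard, Multiset.sum_add] at hsupp₁ hsupp₂ ⊢
  rw [← tsub_add_tsub_comm hsupp₁ hsupp₂, Multiset.replicate_add]
  abel

theorem cycleProd_subtypeCongrHom [Fintype X] [DecidableEq X] [Fintype {x // p x}]
    [Fintype {x // ¬ p x}] (u : ℕ → ℝ) (P : Perm {x // p x} × Perm {x // ¬ p x}) :
    cycleProd u (subtypeCongrHom p P) = cycleProd u P.1 * cycleProd u P.2 := by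
  rw [cycleProd, parts_subtypeCongrHom, Multiset.map_add, Multiset.prod_add]
  rfl

/-- The extension to `X` of an equivalence relation on the points satisfying `p`, with the
remaining points as one further class. -/
def extendSetoid (r : Setoid {x // p x}) : Setoid X where
  r x y := (p x ↔ p y) ∧ ∀ hx hy, r ⟨x, hx⟩ ⟨y, hy⟩
  iseqv :=
    { refl := fun _ => ⟨Iff.rfl, fun _ _ => r.refl' _⟩
      symm := fun h => ⟨h.1.symm, fun hx hy => r.symm' (h.2 hy hx)⟩
      trans := fun h h' => ⟨h.1.trans h'.1,
        fun hx hz => r.trans' (h.2 hx (h.1.mp hx)) (h'.2 (h.1.mp hx) hz)⟩ }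

variable [Finite X] (P Q : Perm {x // p x} × Perm {x // ¬ p x})

theorem joinSetoid_subtypeCongrHom_le :
    joinSetoid (subtypeCongrHom p P) (subtypeCongrHom p Q) ≤
      extendSetoid (joinSetoid P.1 Q.1) := by
  refine joinSetoid_le_iff.mpr ⟨fun x => ⟨(apply_subtypeCongrHom_iff P x).symm, fun hx _ => ?_⟩,
    fun x => ⟨(apply_subtypeCongrHom_iff Q x).symm, fun hx _ => ?_⟩⟩
  · simpa [subtypeCongr.left_apply P.1 P.2 hx] using joinSetoid_apply_left P.1 Q.1 ⟨x, hx⟩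
  · simpa [subtypeCongr.left_apply Q.1 Q.2 hx] using joinSetoid_apply_right P.1 Q.1 ⟨x, hx⟩

theorem joinSetoid_subtypeCongrHom_iff {x y : X} (hx : p x) (hy : p y) :
    joinSetoid (subtypeCongrHom p P) (subtypeCongrHom p Q) x y ↔
      joinSetoid P.1 Q.1 ⟨x, hx⟩ ⟨y, hy⟩ := by
  have hsemiconj (R : Perm {x // p x} × Perm {x // ¬ p x}) :
      Function.Semiconj Subtype.val R.1 (subtypeCongrHom p R) := fun z => by simp
  refine ⟨fun h => (joinSetoid_subtypeCongrHom_le P Q h).2 hx hy, fun h => ?_⟩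
  exact joinSetoid_le_comap_of_semiconj (hsemiconj P) (hsemiconj Q) h

theorem forall_joinSetoid_subtypeCongrHom_iff {x₀ : X} (hx₀ : p x₀) :
    (∀ x, joinSetoid (subtypeCongrHom p P) (subtypeCongrHom p Q) x₀ x ↔ p x) ↔
      joinSetoid P.1 Q.1 = ⊤ := by
  constructor
  · intro h
    have hall (x : {x // p x}) : joinSetoid P.1 Q.1 ⟨x₀, hx₀⟩ x :=
      (joinSetoid_subtypeCongrHom_iff P Q hx₀ x.2).mp ((h x).mpr x.2)
    exact Setoid.eq_top_iff.mpr fun x y =>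
      Setoid.trans' _ (Setoid.symm' _ (hall x)) (hall y)
  · refine fun h x => ⟨fun hx => (joinSetoid_subtypeCongrHom_le P Q hx).1.mp hx₀, fun hx => ?_⟩
    exact (joinSetoid_subtypeCongrHom_iff P Q hx₀ hx).mpr (Setoid.eq_top_iff.mp h _ _)

/-- Pairs of permutations for which the orbit of `x₀` is `{x | p x}` correspond to a transitive pair
on the orbit together with an arbitrary pair on its complement. -/
theorem bijOn_subtypeCongrHom_pairs {x₀ : X} (hx₀ : p x₀) :
    Set.BijOn (fun R : (Perm {x // p x} × Perm {x // p x}) ×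
        (Perm {x // ¬ p x} × Perm {x // ¬ p x}) =>
        (subtypeCongrHom p (R.1.1, R.2.1), subtypeCongrHom p (R.1.2, R.2.2)))
      {R | joinSetoid R.1.1 R.1.2 = ⊤} {q | ∀ x, joinSetoid q.1 q.2 x₀ x ↔ p x} := by
  refine ⟨fun R hR => (forall_joinSetoid_subtypeCongrHom_iff _ _ hx₀).mpr hR, ?_, ?_⟩
  · rintro ⟨⟨σ, α⟩, τ, β⟩ _ ⟨⟨σ', α'⟩, τ', β'⟩ _ h
    obtain ⟨hσ, hα⟩ := Prod.mk.inj h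
    have := subtypeCongrHom_injective p hσ
    have := subtypeCongrHom_injective p hα
    simp_all
  · rintro ⟨σ, α⟩ hq
    have hinv {τ : Perm X} (hτ : ∀ x, joinSetoid σ α x (τ x)) :
        τ ∈ Set.range (subtypeCongrHom p) := by
      refine mem_range_subtypeCongrHom_iff.mpr fun x => ?_
      rw [← hq, ← hq]
      exact ⟨fun h => Setoid.trans' _ h (Setoid.symm' _ (hτ x)),
        fun h => Setoid.trans' _ h (hτ x)⟩
    obtain ⟨P, rfl⟩ := hinv (joinSetoid_apply_left σ α)
    obtain ⟨Q, rfl⟩ := hinv (joinSetoid_apply_right _ α)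
    exact ⟨((P.1, Q.1), (P.2, Q.2)), (forall_joinSetoid_subtypeCongrHom_iff P Q hx₀).mp hq, rfl⟩

end SubtypeCongr

section PairSums

variable {X : Type*} [Fintype X] [DecidableEq X]

open Classical in
theorem sum_pairs_eq_sum_orbit {M : Type*} [AddCommMonoid M] (x₀ : X) (F : Perm X × Perm X → M) :
    ∑ q, F q = ∑ A : Finset X with x₀ ∈ A,
      ∑ P : Perm {x // x ∈ A} × Perm {x // x ∈ A} with joinSetoid P.1 P.2 = ⊤,
        ∑ Q : Perm {x // x ∉ A} × Perm {x // x ∉ A},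
          F (subtypeCongrHom (· ∈ A) (P.1, Q.1), subtypeCongrHom (· ∈ A) (P.2, Q.2)) := by
  let orbit (q : Perm X × Perm X) : Finset X := Finset.univ.filter (joinSetoid q.1 q.2 x₀)
  have horbit {q : Perm X × Perm X} {A : Finset X} :
      orbit q = A ↔ ∀ x, joinSetoid q.1 q.2 x₀ x ↔ x ∈ A := by
    simp only [orbit, Finset.ext_iff, Finset.mem_filter_univ]
  have hmem (q : Perm X × Perm X) : x₀ ∈ orbit q := by simp [orbit]
  rw [← Finset.sum_fiberwise_of_maps_to (g := orbit)
    (t := Finset.univ.filter fun A : Finset X => x₀ ∈ A) fun q _ => by simpa using hmem q]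
  refine Finset.sum_congr rfl fun A hA => ?_
  have hbij := bijOn_subtypeCongrHom_pairs (p := (· ∈ A)) (x₀ := x₀) (by simpa using hA)
  simp only [← Finset.sum_product', horbit]
  symm
  refine Finset.sum_nbij _ (fun R hR => ?_) ?_ ?_ fun R _ => rfl
  · simpa using hbij.mapsTo (by simpa using hR)
  · exact hbij.injOn.mono fun R hR => by simpa using hR
  · rintro q hq
    obtain ⟨R, hR, rfl⟩ := hbij.surjOn (by simpa using hq)
    exact ⟨R, by simpa using hR, rfl⟩

theorem sum_card_of_mem {M : Type*} [AddCommMonoid M] {n : ℕ} (hX : Fintype.card X = n + 1)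
    (x₀ : X) (φ : ℕ → M) :
    ∑ A : Finset X with x₀ ∈ A, φ A.card =
      ∑ j ∈ Finset.range (n + 1), n.choose j • φ (j + 1) := by
  have hcard : (Finset.univ.erase x₀).card = n := by
    rw [Finset.card_erase_of_mem (Finset.mem_univ _), Finset.card_univ, hX, Nat.add_sub_cancel]
  rw [← hcard, ← Finset.sum_powerset_apply_card fun j => φ (j + 1)]
  refine Finset.sum_bij' (fun A _ => A.erase x₀) (fun B _ => insert x₀ B) ?_ ?_ ?_ ?_ ?_
  · exact fun A _ => Finset.mem_powerset.mpr (Finset.erase_subset_erase _ (Finset.subset_univ _))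
  · simp
  · exact fun A hA => Finset.insert_erase (by simpa using hA)
  · exact fun B hB => Finset.erase_insert fun h => by simpa using Finset.mem_powerset.mp hB h
  · exact fun A hA => by rw [Finset.card_erase_add_one (by simpa using hA)]

/-- The sum over all permutations of `n` points of the product of `f` over the cycle lengths. -/
noncomputable def permSum (f : ℕ → ℝ) (n : ℕ) : ℝ := ∑ σ : Perm (Fin n), cycleProd f σ

theorem sum_cycleProd (f : ℕ → ℝ) :
    ∑ σ : Perm X, cycleProd f σ = permSum f (Fintype.card X) := by
  rw [permSum, ← Equiv.sum_comp (Fintype.equivFin X).permCongrHom.toEquiv]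
  exact Finset.sum_congr rfl fun σ _ => (cycleProd_permCongrHom f _ σ).symm

open Classical in
/-- The sum of `f_σ g_{σ⁻¹α}` over the pairs `(σ, α)` of permutations of `n` points generating a
transitive group. -/
noncomputable def pairSum (f g : ℕ → ℝ) (n : ℕ) : ℝ :=
  ∑ p : Perm (Fin n) × Perm (Fin n) with joinSetoid p.1 p.2 = ⊤,
    cycleProd f p.1 * cycleProd g (p.1⁻¹ * p.2)

open Classical in
theorem sum_transitive_pairs (f g : ℕ → ℝ) :
    ∑ p : Perm X × Perm X with joinSetoid p.1 p.2 = ⊤,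
      cycleProd f p.1 * cycleProd g (p.1⁻¹ * p.2) = pairSum f g (Fintype.card X) := by
  let e := (Fintype.equivFin X).permCongrHom
  rw [pairSum, Finset.sum_filter, Finset.sum_filter,
    ← Equiv.sum_comp (e.toEquiv.prodCongr e.toEquiv)]
  refine Finset.sum_congr rfl fun p _ => ?_
  change _ = if joinSetoid (e p.1) (e p.2) = ⊤ then
    cycleProd f (e p.1) * cycleProd g ((e p.1)⁻¹ * e p.2) else 0
  simp only [← map_inv, ← map_mul, e, joinSetoid_permCongrHom_eq_top_iff, cycleProd_permCongrHom]

theorem sum_pairs (f g : ℕ → ℝ) :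
    ∑ p : Perm X × Perm X, cycleProd f p.1 * cycleProd g (p.1⁻¹ * p.2) =
      permSum f (Fintype.card X) * permSum g (Fintype.card X) := by
  rw [Fintype.sum_prod_type, ← sum_cycleProd (X := X), ← sum_cycleProd (X := X),
    Finset.sum_mul_sum]
  exact Finset.sum_congr rfl fun σ _ =>
    Equiv.sum_comp (Equiv.mulLeft σ⁻¹) fun τ => cycleProd f σ * cycleProd g τ

/-- The recursion expressing that, in exponential generating functions, `pairSum` is the logarithm
of `permSum f * permSum g`. -/
theorem permSum_mul_permSum_succ (f g : ℕ → ℝ) (n : ℕ) :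
    permSum f (n + 1) * permSum g (n + 1) = ∑ j ∈ Finset.range (n + 1),
      (n.choose j : ℝ) * (pairSum f g (j + 1) * (permSum f (n - j) * permSum g (n - j))) := by
  classical
  have horbits := sum_card_of_mem (Fintype.card_fin (n + 1)) 0 fun k =>
    pairSum f g k * (permSum f (n + 1 - k) * permSum g (n + 1 - k))
  simp only [Nat.add_sub_add_right, nsmul_eq_mul] at horbits
  have hall := sum_pairs (X := Fin (n + 1)) f g
  rw [Fintype.card_fin] at hall
  rw [← horbits, ← hall, sum_pairs_eq_sum_orbit 0]
  refine Finset.sum_congr rfl fun A _ => ?_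
  have hcompl : Fintype.card {x // x ∉ A} = n + 1 - A.card := by
    rw [Fintype.card_subtype_compl, Fintype.card_coe, Fintype.card_fin]
  rw [← Fintype.card_coe A] at hcompl ⊢
  rw [← hcompl, ← sum_transitive_pairs, ← sum_pairs, Finset.sum_mul_sum]
  refine Finset.sum_congr rfl fun P _ => Finset.sum_congr rfl fun Q _ => ?_
  simp only [← map_inv, ← map_mul, cycleProd_subtypeCongrHom, Prod.inv_mk, Prod.mk_mul_mk]
  ring

end PairSums

/-! ## Counting transitive pairs of large cycle count -/

section CycleCounting

variable {X : Type*} [Fintype X] [DecidableEq X] {Y : Type*} [Fintype Y] [DecidableEq Y]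

theorem cycleCount_permCongrHom (e : X ≃ Y) (σ : Perm X) :
    cycleCount (e.permCongrHom σ) = cycleCount σ := by
  rw [cycleCount, cycleCount, parts_permCongrHom]

theorem cycleCount_pos [Nonempty X] (σ : Perm X) : 0 < cycleCount σ := by
  rw [cycleCount_eq_classCount]
  have : Nonempty (Quotient (SameCycle.setoid σ)) := nonempty_quotient_iff _ |>.mpr inferInstance
  exact Nat.card_pos

theorem joinSetoid_self_eq_top_iff [Nonempty X] {σ : Perm X} :
    joinSetoid σ σ = ⊤ ↔ cycleCount σ = 1 := by
  rw [joinSetoid, sup_idem, cycleCount_eq_classCount, classCount_eq_one_iff,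
    and_iff_right ‹Nonempty X›]

theorem parts_of_cycleCount_eq_one {σ : Perm X} (h : cycleCount σ = 1) :
    σ.partition.parts = {Fintype.card X} := by
  obtain ⟨a, ha⟩ := Multiset.card_eq_one.mp h
  have hsum := σ.partition.parts_sum
  rw [ha, Multiset.sum_singleton] at hsum
  rw [ha, hsum]

theorem cycleCount_eq_one_iff_cycleType (hX : 2 ≤ Fintype.card X) {σ : Perm X} :
    cycleCount σ = 1 ↔ σ.cycleType = {Fintype.card X} := by
  refine ⟨fun h => ?_, fun h => ?_⟩
  · rw [← filter_parts_partition_eq_cycleType, parts_of_cycleCount_eq_one h,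
      Multiset.filter_singleton, if_pos hX]
  · simp [cycleCount, parts_partition, ← sum_cycleType, h]

theorem card_cycleCount_eq_one :
    (Finset.univ.filter fun σ : Perm X => cycleCount σ = 1).card =
      if Fintype.card X = 0 then 0 else (Fintype.card X - 1).factorial := by
  split_ifs with h0
  · refine Finset.card_eq_zero.mpr (Finset.filter_eq_empty_iff.mpr fun σ _ h => ?_)
    have := cycleCount_le_card σ
    omega
  have : Nonempty X := Fintype.card_pos_iff.mp (Nat.pos_of_ne_zero h0)
  rcases Nat.lt_or_ge (Fintype.card X) 2 with hX | hX
  · have hX1 : Fintype.card X = 1 := by omega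
    rw [Finset.filter_true_of_mem, Finset.card_univ, Fintype.card_perm, hX1]
    · rfl
    · exact fun σ _ => (hX1 ▸ cycleCount_le_card σ).antisymm (cycleCount_pos σ)
  · have hcount := card_of_cycleType_singleton (α := X) hX le_rfl
    rw [Nat.choose_self, mul_one] at hcount
    simp only [cycleCount_eq_one_iff_cycleType hX, hcount]

theorem exists_permCongrHom_finRotate_eq {m : ℕ} (hm : Fintype.card X = m) {σ : Perm X}
    (h : cycleCount σ = 1) : ∃ e : Fin m ≃ X, e.permCongrHom (finRotate m) = σ := by
  have hm1 : 1 ≤ m := h ▸ hm ▸ cycleCount_le_card σ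
  let e := (Fintype.equivFinOfCardEq hm).symm
  have hconj : IsConj (e.permCongrHom (finRotate m)) σ := by
    rw [partition_eq_of_isConj, Nat.Partition.ext_iff, parts_permCongrHom,
      parts_of_cycleCount_eq_one (cycleCount_finRotate hm1), parts_of_cycleCount_eq_one h,
      Fintype.card_fin, hm]
  obtain ⟨c, rfl⟩ := isConj_iff.mp hconj
  exact ⟨e.trans c, rfl⟩

omit [Fintype X] in
theorem exists_permCongrHom_gammaPerm_eq {p : X → Prop} [DecidablePred p]
    [Fintype {x // p x}] [Fintype {x // ¬ p x}] {t s : ℕ}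
    (ht : Fintype.card {x // p x} = t) (hs : Fintype.card {x // ¬ p x} = s)
    {σ : Perm {x // p x}} {τ : Perm {x // ¬ p x}} (hσ : cycleCount σ = 1)
    (hτ : cycleCount τ = 1) :
    ∃ e : Fin t ⊕ Fin s ≃ X, e.permCongrHom (gammaPerm t s) = subtypeCongrHom p (σ, τ) := by
  obtain ⟨e₁, rfl⟩ := exists_permCongrHom_finRotate_eq ht hσ
  obtain ⟨e₂, rfl⟩ := exists_permCongrHom_finRotate_eq hs hτ
  refine ⟨(Equiv.sumCongr e₁ e₂).trans (Equiv.sumCompl p), ?_⟩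
  ext x
  by_cases hx : p x
  · simp [gammaPerm, hx, subtypeCongr.left_apply, Equiv.sumCompl_symm_apply_of_pos hx]
  · simp [gammaPerm, hx, subtypeCongr.right_apply, Equiv.sumCompl_symm_apply_of_neg hx]

theorem sum_perm_eq_sum_cycle {M : Type*} [AddCommMonoid M] (x₀ : X) (F : Perm X → M) :
    ∑ α, F α = ∑ A : Finset X with x₀ ∈ A,
      ∑ σ : Perm {x // x ∈ A} with cycleCount σ = 1, ∑ τ : Perm {x // x ∉ A},
        F (subtypeCongrHom (· ∈ A) (σ, τ)) := by
  classical
  have hdiag {Z : Type _} [Fintype Z] [DecidableEq Z] (G : Z → M) :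
      ∑ q : Z × Z, (if q.1 = q.2 then G q.1 else 0) = ∑ z, G z := by
    simp [Fintype.sum_prod_type]
  rw [← hdiag F, sum_pairs_eq_sum_orbit x₀]
  refine Finset.sum_congr rfl fun A hA => ?_
  have : Nonempty {x // x ∈ A} := ⟨⟨x₀, by simpa using hA⟩⟩
  have hinner (P : Perm {x // x ∈ A} × Perm {x // x ∈ A}) :
      (∑ Q : Perm {x // x ∉ A} × Perm {x // x ∉ A},
        if subtypeCongrHom (· ∈ A) (P.1, Q.1) = subtypeCongrHom (· ∈ A) (P.2, Q.2) then
          F (subtypeCongrHom (· ∈ A) (P.1, Q.1)) else 0) =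
      if P.1 = P.2 then ∑ τ, F (subtypeCongrHom (· ∈ A) (P.1, τ)) else 0 := by
    simp only [(subtypeCongrHom_injective (· ∈ A)).eq_iff, Prod.mk.injEq]
    by_cases hP : P.1 = P.2
    · simpa only [hP, true_and, if_true] using hdiag fun τ => F (subtypeCongrHom (· ∈ A) (P.2, τ))
    · simp [hP]
  rw [Finset.sum_congr rfl fun P _ => hinner P, Finset.sum_filter, Finset.sum_filter]
  refine (Finset.sum_congr rfl fun P _ => ?_).trans (hdiag fun σ => if cycleCount σ = 1 then
    ∑ τ, F (subtypeCongrHom (· ∈ A) (σ, τ)) else 0)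
  by_cases hP : P.1 = P.2
  · simp only [hP, if_true, joinSetoid_self_eq_top_iff]
  · simp [hP]

end CycleCounting

section ClassFunctions

theorem sum_cycleCount_eq_one {n : ℕ} (hn : 1 ≤ n) (H : Perm (Fin n) → ℝ)
    (hH : ∀ e α : Perm (Fin n), H (e.permCongrHom α) = H α) :
    ∑ α : Perm (Fin n) with cycleCount α = 1, H α =
      ((n - 1).factorial : ℝ) * H (finRotate n) := by
  have hconst : ∀ α ∈ Finset.univ.filter fun α : Perm (Fin n) => cycleCount α = 1,
      H α = H (finRotate n) := fun α hα => by
    obtain ⟨e, rfl⟩ := exists_permCongrHom_finRotate_eq (Fintype.card_fin n) (by simpa using hα)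
    exact hH e _
  rw [Finset.sum_congr rfl hconst, Finset.sum_const, card_cycleCount_eq_one, Fintype.card_fin,
    if_neg (by omega), nsmul_eq_mul]

theorem sum_cycleCount_subtypeCongrHom_eq_two {X : Type*} [Fintype X] [DecidableEq X]
    {p : X → Prop} [DecidablePred p] [Fintype {x // p x}] [Fintype {x // ¬ p x}]
    {H : Perm X → ℝ} {k : ℝ} (hH : ∀ (σ : Perm {x // p x}) (τ : Perm {x // ¬ p x}),
      cycleCount σ = 1 → cycleCount τ = 1 → H (subtypeCongrHom p (σ, τ)) = k) :
    (∑ σ : Perm {x // p x} with cycleCount σ = 1, ∑ τ : Perm {x // ¬ p x},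
      if cycleCount (subtypeCongrHom p (σ, τ)) = 2 then H (subtypeCongrHom p (σ, τ)) else 0) =
    (Finset.univ.filter fun σ : Perm {x // p x} => cycleCount σ = 1).card *
      ((Finset.univ.filter fun τ : Perm {x // ¬ p x} => cycleCount τ = 1).card * k) := by
  rw [← nsmul_eq_mul, ← nsmul_eq_mul, ← Finset.sum_const, ← Finset.sum_const]
  refine Finset.sum_congr rfl fun σ hσ => ?_
  have hσ1 : cycleCount σ = 1 := by simpa using hσ
  have hiff (τ : Perm {x // ¬ p x}) :
      cycleCount (subtypeCongrHom p (σ, τ)) = 2 ↔ cycleCount τ = 1 := by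
    rw [cycleCount, parts_subtypeCongrHom, Multiset.card_add]
    change cycleCount σ + cycleCount τ = 2 ↔ _
    omega
  simp only [hiff]
  rw [← Finset.sum_filter]
  exact Finset.sum_congr rfl fun τ hτ => hH σ τ hσ1 (by simpa using hτ)

theorem choose_mul_factorial_mul_pred_factorial {n j : ℕ} (hj : j ≤ n) (hne : n - j ≠ 0) :
    (n.choose j : ℝ) * (j.factorial * (n - j - 1).factorial) =
      n.factorial / ((n - j : ℕ) : ℝ) := by
  have hchoose : (n.choose j : ℝ) * j.factorial * (n - j).factorial = n.factorial := by
    exact_mod_cast Nat.choose_mul_factorial_mul_factorial hj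
  have hpred : ((n - j).factorial : ℝ) = ((n - j : ℕ) : ℝ) * (n - j - 1).factorial := by
    exact_mod_cast (Nat.mul_factorial_pred hne).symm
  rw [eq_div_iff (by exact_mod_cast hne), ← hchoose, hpred]
  ring

open Finset.HasAntidiagonal in
theorem sum_cycleCount_eq_two {n : ℕ} (H : Perm (Fin (n + 1)) → ℝ) (K : ℕ → ℕ → ℝ)
    (hK : ∀ t s (e : Fin t ⊕ Fin s ≃ Fin (n + 1)), H (e.permCongrHom (gammaPerm t s)) = K t s) :
    ∑ α : Perm (Fin (n + 1)) with cycleCount α = 2, H α =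
      (n.factorial : ℝ) * ∑ ts ∈ antidiagonal (n + 1) with 1 ≤ ts.1 ∧ 1 ≤ ts.2,
        K ts.1 ts.2 / ts.2 := by
  let c (m : ℕ) : ℝ := if m = 0 then 0 else ((m - 1).factorial : ℝ)
  have hc {X : Type} [Fintype X] [DecidableEq X] :
      ((Finset.univ.filter fun σ : Perm X => cycleCount σ = 1).card : ℝ) = c (Fintype.card X) := by
    rw [card_cycleCount_eq_one, apply_ite Nat.cast, Nat.cast_zero]
  have hterm (A : Finset (Fin (n + 1))) :
      (∑ σ : Perm {x // x ∈ A} with cycleCount σ = 1, ∑ τ : Perm {x // x ∉ A},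
        if cycleCount (subtypeCongrHom (· ∈ A) (σ, τ)) = 2 then
          H (subtypeCongrHom (· ∈ A) (σ, τ)) else 0) =
      c A.card * (c (n + 1 - A.card) * K A.card (n + 1 - A.card)) := by
    have hA : Fintype.card {x // x ∈ A} = A.card := Fintype.card_coe A
    have hAc : Fintype.card {x // x ∉ A} = n + 1 - A.card := by
      rw [Fintype.card_subtype_compl, hA, Fintype.card_fin]
    rw [sum_cycleCount_subtypeCongrHom_eq_two (k := K A.card (n + 1 - A.card)), hc, hc, hA, hAc]
    intro σ τ hσ hτ
    obtain ⟨e, he⟩ := exists_permCongrHom_gammaPerm_eq hA hAc hσ hτ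
    rw [← he, hK]
  rw [Finset.sum_filter, sum_perm_eq_sum_cycle 0, Finset.sum_congr rfl fun A _ => hterm A,
    sum_card_of_mem (Fintype.card_fin (n + 1)) 0 fun k =>
      c k * (c (n + 1 - k) * K k (n + 1 - k)),
    Finset.sum_filter, Finset.Nat.sum_antidiagonal_succ, if_neg (by simp), zero_add,
    Finset.Nat.sum_antidiagonal_eq_sum_range_succ_mk, Finset.mul_sum]
  refine Finset.sum_congr rfl fun j hj => ?_
  rw [Nat.add_sub_add_right, nsmul_eq_mul]
  by_cases hnj : n - j = 0
  · simp [c, hnj]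
  · have hfac := choose_mul_factorial_mul_pred_factorial
      (Nat.lt_succ_iff.mp (Finset.mem_range.mp hj)) hnj
    simp only [c, if_neg hnj, if_neg j.succ_ne_zero, Nat.add_sub_cancel]
    rw [if_pos ⟨by omega, by omega⟩, mul_div_left_comm, ← hfac]
    ring

end ClassFunctions

section TransitiveSums

variable {X : Type*} [Fintype X] [DecidableEq X] {Y : Type*} [Fintype Y] [DecidableEq Y]

open Classical in
/-- The sum of `F`, evaluated at the cycle type, over the permutations `σ` that generate with `α` a
transitive group and for which `σ` and `σ⁻¹ α` have `k` cycles together. -/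
noncomputable def transSum (F : Multiset ℕ → ℝ) (k : ℕ) (α : Perm X) : ℝ :=
  ∑ σ : Perm X with joinSetoid σ α = ⊤ ∧ cycleCount σ + cycleCount (σ⁻¹ * α) = k,
    F σ.partition.parts

theorem transSum_permCongrHom (F : Multiset ℕ → ℝ) (k : ℕ) (e : X ≃ Y) (α : Perm X) :
    transSum F k (e.permCongrHom α) = transSum F k α := by
  classical
  rw [transSum, transSum, Finset.sum_filter, Finset.sum_filter,
    ← Equiv.sum_comp e.permCongrHom.toEquiv]
  refine Finset.sum_congr rfl fun σ _ => ?_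
  have hmul : (e.permCongrHom σ)⁻¹ * e.permCongrHom α = e.permCongrHom (σ⁻¹ * α) := by
    rw [map_mul, map_inv]
  refine if_congr (and_congr (joinSetoid_permCongrHom_eq_top_iff e) ?_)
    (congrArg F (parts_permCongrHom e σ)) rfl
  change cycleCount (e.permCongrHom σ) + cycleCount ((e.permCongrHom σ)⁻¹ * _) = k ↔ _
  rw [hmul, cycleCount_permCongrHom, cycleCount_permCongrHom]

theorem joinSetoid_eq_orbitRel {X : Type*} [Finite X] (σ α : Perm X) :
    joinSetoid σ α =
      MulAction.orbitRel (Subgroup.closure ({σ, α} : Set (Perm X))) X := by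
  refine le_antisymm (joinSetoid_le_iff.mpr ⟨fun x => ?_, fun x => ?_⟩) ?_
  · exact Setoid.symm' _ ⟨⟨σ, Subgroup.subset_closure (by simp)⟩, rfl⟩
  · exact Setoid.symm' _ ⟨⟨α, Subgroup.subset_closure (by simp)⟩, rfl⟩
  · rintro _ x ⟨⟨g, hg⟩, rfl⟩
    suffices h : ∀ x, joinSetoid σ α x (g x) from Setoid.symm' _ (h x)
    induction hg using Subgroup.closure_induction with
    | mem g hg =>
      rcases hg with rfl | rfl
      · exact joinSetoid_apply_left _ _
      · exact joinSetoid_apply_right _ _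
    | one => exact (joinSetoid σ α).refl'
    | mul g h _ _ ihg ihh => exact fun x => (joinSetoid σ α).trans' (ihh x) (ihg (h x))
    | inv g _ ih => exact fun x => by simpa using (joinSetoid σ α).symm' (ih (g⁻¹ x))

theorem isPretransitive_closure_pair_iff {X : Type*} [Finite X] {σ α : Perm X} :
    MulAction.IsPretransitive (Subgroup.closure ({σ, α} : Set (Perm X))) X ↔
      joinSetoid σ α = ⊤ := by
  rw [MulAction.pretransitive_iff_subsingleton_quotient, MulAction.orbitRel.Quotient,
    Quotient.subsingleton_iff, joinSetoid_eq_orbitRel]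

theorem sum_SNC (u : ℕ → ℝ) (t s : ℕ) :
    ∑ σ ∈ SNC t s, permProd u σ =
      transSum (fun m => (m.map u).prod) (t + s) (gammaPerm t s) := by
  refine Finset.sum_congr ?_ fun σ _ => rfl
  ext σ
  simp only [SNC, Finset.mem_filter_univ, IsAnnularNonCrossing, isPretransitive_closure_pair_iff]
  rfl

theorem sum_SNC_comm (u : ℕ → ℝ) (t s : ℕ) :
    ∑ σ ∈ SNC t s, permProd u σ = ∑ σ ∈ SNC s t, permProd u σ := by
  have hγ : gammaPerm t s = (sumComm (Fin s) (Fin t)).permCongrHom (gammaPerm s t) := by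
    ext x
    rcases x with x | x <;> simp [gammaPerm]
  rw [sum_SNC, sum_SNC, hγ, transSum_permCongrHom, add_comm]

open Finset.HasAntidiagonal in
theorem sum_antidiagonal_div_of_symm (n : ℕ) {K : ℕ → ℕ → ℝ} (hK : ∀ t s, K t s = K s t) :
    ∑ ts ∈ antidiagonal n with 1 ≤ ts.1 ∧ 1 ≤ ts.2, K ts.1 ts.2 / ts.2 =
      (n : ℝ) / 2 * ∑ ts ∈ antidiagonal n with 1 ≤ ts.1 ∧ 1 ≤ ts.2,
        K ts.1 ts.2 / ((ts.1 : ℝ) * ts.2) := by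
  have hswap : ∑ ts ∈ antidiagonal n with 1 ≤ ts.1 ∧ 1 ≤ ts.2, K ts.1 ts.2 / ts.2 =
      ∑ ts ∈ antidiagonal n with 1 ≤ ts.1 ∧ 1 ≤ ts.2, K ts.1 ts.2 / ts.1 := by
    rw [Finset.sum_filter, Finset.sum_filter, ← Finset.Nat.sum_antidiagonal_swap]
    refine Finset.sum_congr rfl fun ts _ => ?_
    simp only [Prod.fst_swap, Prod.snd_swap, hK ts.2 ts.1, and_comm]
  have hadd : ∑ ts ∈ antidiagonal n with 1 ≤ ts.1 ∧ 1 ≤ ts.2,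
        (K ts.1 ts.2 / ts.2 + K ts.1 ts.2 / ts.1) =
      n * ∑ ts ∈ antidiagonal n with 1 ≤ ts.1 ∧ 1 ≤ ts.2,
        K ts.1 ts.2 / ((ts.1 : ℝ) * ts.2) := by
    rw [Finset.mul_sum]
    refine Finset.sum_congr rfl fun ts hts => ?_
    obtain ⟨hn, ht, hs⟩ := Finset.mem_filter.mp hts
    rw [← mem_antidiagonal.mp hn, Nat.cast_add]
    field_simp
  rw [Finset.sum_add_distrib, ← hswap] at hadd
  linarith

theorem even_card_add_cycleCount_add (σ α : Perm X) :
    Even (Fintype.card X + cycleCount σ + cycleCount α + cycleCount (σ⁻¹ * α)) := by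
  have hσ := even_card_add_cycleCount_iff σ
  have hα := even_card_add_cycleCount_iff α
  have hσα := even_card_add_cycleCount_iff (σ⁻¹ * α)
  rw [Perm.sign_mul, Perm.sign_inv] at hσα
  rcases Int.units_eq_one_or (sign σ) with h | h <;>
    rcases Int.units_eq_one_or (sign α) with h' | h' <;>
    simp [h, h', Nat.even_add] at hσ hα hσα ⊢ <;> tauto

theorem cycleCount_add_le_of_joinSetoid_eq_top [Nonempty X] {σ α : Perm X}
    (h : joinSetoid σ α = ⊤) :
    cycleCount σ + cycleCount α + cycleCount (σ⁻¹ * α) ≤ Fintype.card X + 2 := by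
  simpa [h, classCount_top] using cycleCount_add_cycleCount_add_cycleCount_le σ α

open Classical in
theorem sum_transitive_pairs_eq_sum_transSum {j k : ℕ} (F : Multiset ℕ → ℝ)
    (hj : ∀ σ α : Perm X, joinSetoid σ α = ⊤ →
      cycleCount σ + cycleCount (σ⁻¹ * α) = k → cycleCount α = j) :
    ∑ p : Perm X × Perm X with
        joinSetoid p.1 p.2 = ⊤ ∧ cycleCount p.1 + cycleCount (p.1⁻¹ * p.2) = k,
      F p.1.partition.parts =
    ∑ α : Perm X with cycleCount α = j, transSum F k α := by
  rw [Finset.sum_filter, Fintype.sum_prod_type_right, Finset.sum_filter]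
  refine Finset.sum_congr rfl fun α _ => ?_
  split_ifs with hα
  · rw [transSum, Finset.sum_filter]
  · exact Finset.sum_eq_zero fun σ _ => if_neg fun h => hα (hj σ α h.1 h.2)

variable (X) in
open Classical in
/-- The pairs of permutations of `X` that generate a transitive group. -/
noncomputable def transitivePairs : Finset (Perm X × Perm X) :=
  {q | joinSetoid q.1 q.2 = ⊤}

/-- The defect `|X| + 1 - |σ| - |σ⁻¹ α|` of a pair `(σ, α)`, the exponent of `-1 / d` it carries in
the expansion of the moments. For a transitive pair Euler's formula makes it `2 g + |α| - 1` with
`g` the genus, so the subtraction does not truncate. -/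
noncomputable def pairDefect (q : Perm X × Perm X) : ℕ :=
  Fintype.card X + 1 - (cycleCount q.1 + cycleCount (q.1⁻¹ * q.2))

theorem mem_transitivePairs {q : Perm X × Perm X} :
    q ∈ transitivePairs X ↔ joinSetoid q.1 q.2 = ⊤ := by
  simp [transitivePairs]

theorem pairDefect_add_eq [Nonempty X] {q : Perm X × Perm X} (hq : q ∈ transitivePairs X) :
    pairDefect q + (cycleCount q.1 + cycleCount (q.1⁻¹ * q.2)) = Fintype.card X + 1 := by
  have hle := cycleCount_add_le_of_joinSetoid_eq_top (mem_transitivePairs.mp hq)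
  have hpos := cycleCount_pos q.2
  unfold pairDefect
  omega

open Classical in
theorem filter_pairDefect_eq [Nonempty X] {g k : ℕ} (hgk : g + k = Fintype.card X + 1) :
    {q ∈ transitivePairs X | pairDefect q = g} =
      ({q | joinSetoid q.1 q.2 = ⊤ ∧ cycleCount q.1 + cycleCount (q.1⁻¹ * q.2) = k} :
        Finset (Perm X × Perm X)) := by
  ext q
  rw [Finset.mem_filter, Finset.mem_filter_univ, mem_transitivePairs]
  refine and_congr_right fun hq => ?_
  have := pairDefect_add_eq (mem_transitivePairs.mpr hq)
  omega

theorem sum_planar_pairs {n : ℕ} (hn : 1 ≤ n) (F : Multiset ℕ → ℝ) :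
    ∑ q ∈ transitivePairs (Fin n) with pairDefect q = 0, F q.1.partition.parts =
      ((n - 1).factorial : ℝ) * ∑ π ∈ NC n, F (π.parts.val.map Finset.card) := by
  have : Nonempty (Fin n) := ⟨⟨0, hn⟩⟩
  rw [filter_pairDefect_eq (k := n + 1) (by simp),
    sum_transitive_pairs_eq_sum_transSum (j := 1) F fun σ α h hk => by
      have hle := cycleCount_add_le_of_joinSetoid_eq_top h
      have hpos := cycleCount_pos α
      rw [Fintype.card_fin] at hle
      omega,
    sum_cycleCount_eq_one hn _ fun e α => transSum_permCongrHom _ _ e α,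
    sum_NC_eq_sum_isGenusZero hn, transSum]
  congr 2
  ext σ
  have htop : joinSetoid σ (finRotate n) = ⊤ := Setoid.eq_top_iff.mpr fun x y =>
    (le_sup_right : _ ≤ joinSetoid σ (finRotate n)) (sameCycle_finRotate x y)
  simp only [Finset.mem_filter_univ, htop, true_and]
  rfl

theorem sum_annular_pairs {n : ℕ} (hn : 1 ≤ n) (u : ℕ → ℝ) :
    ∑ q ∈ transitivePairs (Fin n) with pairDefect q = 1, cycleProd u q.1 =
      ((n - 1).factorial : ℝ) * annularSum u n := by
  obtain ⟨n, rfl⟩ : ∃ m, n = m + 1 := ⟨n - 1, by omega⟩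
  have hclass (t s : ℕ) (e : Fin t ⊕ Fin s ≃ Fin (n + 1)) :
      transSum (fun m => (m.map u).prod) (n + 1) (e.permCongrHom (gammaPerm t s)) =
        ∑ σ ∈ SNC t s, permProd u σ := by
    have hts : t + s = n + 1 := by simpa using Fintype.card_congr e
    rw [transSum_permCongrHom, sum_SNC, hts]
  have htwo (σ α : Perm (Fin (n + 1))) (h : joinSetoid σ α = ⊤)
      (hk : cycleCount σ + cycleCount (σ⁻¹ * α) = n + 1) : cycleCount α = 2 := by
    have hle := cycleCount_add_le_of_joinSetoid_eq_top h
    have hpos := cycleCount_pos α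
    have heven := even_card_add_cycleCount_add σ α
    rw [Fintype.card_fin] at hle heven
    rw [Nat.even_iff] at heven
    omega
  unfold cycleProd
  rw [filter_pairDefect_eq (k := n + 1) (by simp; omega),
    sum_transitive_pairs_eq_sum_transSum (fun m => (m.map u).prod) htwo,
    sum_cycleCount_eq_two _ _ hclass, sum_antidiagonal_div_of_symm (n + 1) (sum_SNC_comm u),
    Nat.add_sub_cancel, annularSum]
  simp only [Finset.sum_div]

end TransitiveSums

/-! ## Cumulants with respect to all set partitions -/

section Finpartitions

variable {T : Type*} [DecidableEq T] {s B : Finset T}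

theorem notMem_parts_sdiff (hB : B.Nonempty) (π : Finpartition (s \ B)) : B ∉ π.parts := by
  obtain ⟨x, hx⟩ := hB
  exact fun h => (Finset.mem_sdiff.mp (π.le h hx)).2 hx

theorem sup_parts_erase (π : Finpartition s) (hB : B ∈ π.parts) :
    (π.parts.erase B).sup id = s \ B := by
  ext x
  simp only [Finset.mem_sup, Finset.mem_erase, id, Finset.mem_sdiff]
  constructor
  · rintro ⟨V, ⟨hVB, hV⟩, hx⟩
    exact ⟨π.le hV hx, fun hxB => hVB (π.eq_of_mem_parts hV hB hx hxB)⟩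
  · rintro ⟨hx, hxB⟩
    obtain ⟨V, hV, hxV⟩ := π.exists_mem hx
    exact ⟨V, ⟨ne_of_mem_of_not_mem' hxV hxB, hV⟩, hxV⟩

theorem sum_finpartition_sum_parts {M : Type*} [AddCommMonoid M] (s : Finset T)
    (Φ : Finset T → Finset (Finset T) → M) :
    ∑ π : Finpartition s, ∑ B ∈ π.parts, Φ B (π.parts.erase B) =
      ∑ B ∈ s.powerset.erase ∅, ∑ π : Finpartition (s \ B), Φ B π.parts := by
  rw [Finset.sum_sigma', Finset.sum_sigma']
  have hB {P : Σ B : Finset T, Finpartition (s \ B)}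
      (h : P ∈ (s.powerset.erase ∅).sigma fun _ => Finset.univ) : P.1 ≠ ∅ ∧ P.1 ⊆ s := by
    simpa using h
  have herase {P : Σ B : Finset T, Finpartition (s \ B)} (hne : P.1 ≠ ∅) :
      (insert P.1 P.2.parts).erase P.1 = P.2.parts :=
    Finset.erase_insert (notMem_parts_sdiff (Finset.nonempty_iff_ne_empty.mpr hne) P.2)
  refine (Finset.sum_bij' (fun P hP => ⟨P.2.extend (hB hP).1 Finset.sdiff_disjoint
      (Finset.sdiff_union_of_subset (hB hP).2), P.1⟩)
    (fun P hP => ⟨P.2, P.1.ofSubset (Finset.erase_subset _ _)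
      (sup_parts_erase P.1 (Finset.mem_sigma.mp hP).2)⟩) ?_ ?_ ?_ ?_ ?_).symm
  · simp
  · rintro ⟨π, B⟩ h
    have hBπ := (Finset.mem_sigma.mp h).2
    simpa using ⟨π.ne_bot hBπ, π.le hBπ⟩
  · rintro P hP
    exact Sigma.ext rfl (heq_of_eq (Finpartition.ext (herase (hB hP).1)))
  · rintro ⟨π, B⟩ h
    exact Sigma.ext (Finpartition.ext (Finset.insert_erase (Finset.mem_sigma.mp h).2)) HEq.rfl
  · rintro P hP
    simp only [Finpartition.extend_parts, herase (hB hP).1]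

/-- The weight `(-1)^{|P|} |P|! ∏_{V ∈ P} a_{|V|}` of a collection `P` of blocks; summing it over
the set partitions gives the coefficients of the reciprocal of the exponential generating function
of `a`, because `1 / (1 + x) = ∑ (-1)^k k! x^k / k!`. -/
noncomputable def recipWeight (a : ℕ → ℝ) (P : Finset (Finset T)) : ℝ :=
  (-1) ^ P.card * (P.card.factorial : ℝ) * ∏ V ∈ P, a V.card

theorem mul_recipWeight_erase (a : ℕ → ℝ) {P : Finset (Finset T)} (hB : B ∈ P) :
    a B.card * recipWeight a (P.erase B) =
      (-1) ^ (P.card - 1) * ((P.card - 1).factorial : ℝ) * ∏ V ∈ P, a V.card := by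
  rw [recipWeight, ← Finset.mul_prod_erase _ _ hB, Finset.card_erase_of_mem hB]
  ring

theorem sum_mul_recipWeight_erase (a : ℕ → ℝ) {P : Finset (Finset T)} (hP : P.Nonempty) :
    ∑ B ∈ P, a B.card * recipWeight a (P.erase B) = -recipWeight a P := by
  obtain ⟨k, hk⟩ := Nat.exists_eq_add_one_of_ne_zero hP.card_ne_zero
  rw [Finset.sum_congr rfl fun B hB => mul_recipWeight_erase a hB, Finset.sum_const, recipWeight,
    hk, Nat.add_sub_cancel, nsmul_eq_mul, Nat.factorial_succ]
  push_cast
  ring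

theorem sum_powerset_sum_recipWeight {a : ℕ → ℝ} (ha : a 0 = 1) (hs : s.Nonempty) :
    ∑ B ∈ s.powerset, a B.card * ∑ π : Finpartition (s \ B), recipWeight a π.parts = 0 := by
  have hnonempty : ∑ B ∈ s.powerset.erase ∅,
      a B.card * ∑ π : Finpartition (s \ B), recipWeight a π.parts =
      -∑ π : Finpartition s, recipWeight a π.parts := by
    simp only [Finset.mul_sum]
    rw [← sum_finpartition_sum_parts s fun B P => a B.card * recipWeight a P,
      ← Finset.sum_neg_distrib]
    exact Finset.sum_congr rfl fun π _ =>
      sum_mul_recipWeight_erase a (π.parts_nonempty hs.ne_empty)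
  rw [← Finset.add_sum_erase _ _ (Finset.empty_mem_powerset s), hnonempty, Finset.card_empty, ha,
    one_mul, Finset.sdiff_empty, add_neg_cancel]

end Finpartitions

section ExponentialGeneratingFunctions

variable {𝕜 : Type*} [Field 𝕜]

/-- The exponential generating function of a sequence. -/
noncomputable def egf (a : ℕ → 𝕜) : PowerSeries 𝕜 := PowerSeries.mk fun n => a n / n.factorial

theorem coeff_egf (a : ℕ → 𝕜) (n : ℕ) : PowerSeries.coeff n (egf a) = a n / n.factorial :=
  PowerSeries.coeff_mk n _

theorem egf_add (a b : ℕ → 𝕜) : egf (a + b) = egf a + egf b := by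
  ext n
  rw [map_add, coeff_egf, coeff_egf, coeff_egf, Pi.add_apply, add_div]

variable [CharZero 𝕜]

theorem natCast_factorial_ne_zero (n : ℕ) : (n.factorial : 𝕜) ≠ 0 :=
  Nat.cast_ne_zero.mpr n.factorial_ne_zero

theorem egf_injective : Function.Injective (egf : (ℕ → 𝕜) → PowerSeries 𝕜) := fun a b h => by
  ext n
  have hn := congrArg (PowerSeries.coeff n) h
  rwa [coeff_egf, coeff_egf, div_left_inj' (natCast_factorial_ne_zero n)] at hn

theorem egf_surjective : Function.Surjective (egf : (ℕ → 𝕜) → PowerSeries 𝕜) := fun f =>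
  ⟨fun n => PowerSeries.coeff n f * n.factorial, PowerSeries.ext fun n => by
    rw [coeff_egf, mul_div_cancel_right₀ _ (natCast_factorial_ne_zero n)]⟩

/-- The binomial convolution of two sequences, corresponding to the product of their exponential
generating functions. -/
def binomialConv (a b : ℕ → 𝕜) (n : ℕ) : 𝕜 :=
  ∑ j ∈ Finset.range (n + 1), (n.choose j : 𝕜) * a j * b (n - j)

theorem egf_mul_egf (a b : ℕ → 𝕜) : egf a * egf b = egf (binomialConv a b) := by
  ext n
  rw [PowerSeries.coeff_mul, Finset.Nat.sum_antidiagonal_eq_sum_range_succ_mk, coeff_egf,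
    binomialConv, Finset.sum_div]
  refine Finset.sum_congr rfl fun j hj => ?_
  rw [coeff_egf, coeff_egf, Nat.cast_choose 𝕜 (Finset.mem_range_succ_iff.mp hj)]
  have := natCast_factorial_ne_zero (𝕜 := 𝕜)
  field_simp [this n, this j, this (n - j)]

theorem derivative_egf (a : ℕ → 𝕜) :
    PowerSeries.derivative 𝕜 (egf a) = egf fun n => a (n + 1) := by
  ext n
  have hn : (n + 1 : 𝕜) ≠ 0 := n.cast_add_one_ne_zero
  rw [PowerSeries.coeff_derivative, coeff_egf, coeff_egf, Nat.factorial_succ]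
  push_cast
  field_simp

end ExponentialGeneratingFunctions

section PartitionCumulants

theorem sum_recipWeight {T : Type*} [DecidableEq T] {a r : ℕ → ℝ} (ha : a 0 = 1)
    (har : egf a * egf r = 1) (s : Finset T) :
    ∑ π : Finpartition s, recipWeight a π.parts = r s.card := by
  have hconv (n : ℕ) : binomialConv a r n = if n = 0 then 1 else 0 := by
    have hn := congrArg (PowerSeries.coeff n) har
    rw [egf_mul_egf, coeff_egf, PowerSeries.coeff_one,
      div_eq_iff (natCast_factorial_ne_zero n)] at hn
    rw [hn]
    split_ifs with h <;> simp [h]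
  induction s using Finset.strongInduction with
  | H s ih =>
    rcases s.eq_empty_or_nonempty with rfl | hs
    · have hr : r 0 = 1 := by simpa [binomialConv, ha] using hconv 0
      have : Unique (Finpartition (∅ : Finset T)) :=
        inferInstanceAs (Unique (Finpartition (⊥ : Finset T)))
      rw [Fintype.sum_unique, Finpartition.parts_eq_empty_iff.mpr rfl]
      simp [recipWeight, hr]
    · have hsum := sum_powerset_sum_recipWeight ha hs
      have hr := Finset.sum_powerset_apply_card (fun k => a k * r (s.card - k)) (x := s)
      have hterm : ∀ B ∈ s.powerset.erase ∅, a B.card *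
          ∑ π : Finpartition (s \ B), recipWeight a π.parts = a B.card * r (s.card - B.card) := by
        intro B hB
        obtain ⟨hne, hBs⟩ : B ≠ ∅ ∧ B ⊆ s := by simpa using hB
        rw [ih _ (Finset.sdiff_ssubset hBs (Finset.nonempty_iff_ne_empty.mpr hne)),
          Finset.card_sdiff_of_subset hBs]
      simp only [nsmul_eq_mul, ← mul_assoc] at hr
      rw [show ∑ k ∈ Finset.range (s.card + 1), _ = binomialConv a r s.card from rfl, hconv,
        if_neg hs.card_ne_zero] at hr
      rw [← Finset.add_sum_erase _ _ (Finset.empty_mem_powerset s),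
        Finset.sum_congr rfl hterm, Finset.card_empty, ha, one_mul, Finset.sdiff_empty] at hsum
      rw [← Finset.add_sum_erase _ _ (Finset.empty_mem_powerset s), Finset.card_empty, ha, one_mul,
        Nat.sub_zero] at hr
      exact add_right_cancel (hsum.trans hr.symm)

/-- The cumulants of a sequence with respect to the lattice of all set partitions. -/
noncomputable def partitionCumulant (a : ℕ → ℝ) (n : ℕ) : ℝ :=
  ∑ π : SetPartition n,
    (-1) ^ (π.parts.card - 1) * ((π.parts.card - 1).factorial : ℝ) * partProd a π

theorem partitionCumulant_congr {a b : ℕ → ℝ} {n : ℕ} (h : ∀ k ≤ n, a k = b k) :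
    partitionCumulant a n = partitionCumulant b n := by
  unfold partitionCumulant partProd
  refine Finset.sum_congr rfl fun π _ => congrArg _ (Finset.prod_congr rfl fun V _ => h _ ?_)
  simpa using V.card_le_univ

theorem partitionCumulant_eq_sum_mem (a : ℕ → ℝ) {n : ℕ} (i : Fin n) :
    partitionCumulant a n = ∑ B : Finset (Fin n) with i ∈ B,
      a B.card * ∑ π : Finpartition (Finset.univ \ B), recipWeight a π.parts := by
  have hblock (π : SetPartition n) :
      (-1) ^ (π.parts.card - 1) * ((π.parts.card - 1).factorial : ℝ) * partProd a π =
        ∑ B ∈ π.parts, if i ∈ B then a B.card * recipWeight a (π.parts.erase B) else 0 := by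
    obtain ⟨B, hB, hi⟩ := π.exists_mem (Finset.mem_univ i)
    rw [Finset.sum_eq_single_of_mem B hB fun V hV hne =>
      if_neg fun h => hne (π.eq_of_mem_parts hV hB h hi), if_pos hi, mul_recipWeight_erase a hB,
      partProd]
  rw [partitionCumulant, Finset.sum_congr rfl fun π _ => hblock π,
    sum_finpartition_sum_parts Finset.univ fun B P =>
      if i ∈ B then a B.card * recipWeight a P else 0,
    Finset.powerset_univ, Finset.sum_filter]
  refine (Finset.sum_congr rfl fun B _ => ?_).trans
    (Finset.sum_erase _ (if_neg (Finset.notMem_empty i)))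
  split_ifs with hi
  · rw [Finset.mul_sum]
  · exact Finset.sum_const_zero

theorem partitionCumulant_succ {a r : ℕ → ℝ} (ha : a 0 = 1) (har : egf a * egf r = 1) (n : ℕ) :
    partitionCumulant a (n + 1) = binomialConv (fun j => a (j + 1)) r n := by
  have hsum := sum_card_of_mem (Fintype.card_fin (n + 1)) 0 fun k => a k * r (n + 1 - k)
  simp only [Nat.add_sub_add_right, nsmul_eq_mul, ← mul_assoc] at hsum
  rw [binomialConv, ← hsum, partitionCumulant_eq_sum_mem a 0]
  refine Finset.sum_congr rfl fun B _ => ?_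
  rw [sum_recipWeight ha har, Finset.card_sdiff_of_subset B.subset_univ, Finset.card_univ,
    Fintype.card_fin]

theorem derivative_egf_eq_mul {a : ℕ → ℝ} (ha : a 0 = 1) :
    PowerSeries.derivative ℝ (egf a) = egf (fun n => partitionCumulant a (n + 1)) * egf a := by
  have hunit : PowerSeries.constantCoeff (egf a) ≠ 0 := by
    simp [← PowerSeries.coeff_zero_eq_constantCoeff_apply, coeff_egf, ha]
  obtain ⟨r, hr⟩ := egf_surjective (egf a)⁻¹
  have har : egf a * egf r = 1 := hr ▸ PowerSeries.mul_inv_cancel _ hunit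
  have hcumulant : egf (fun n => partitionCumulant a (n + 1)) =
      PowerSeries.derivative ℝ (egf a) * egf r := by
    rw [derivative_egf, egf_mul_egf]
    exact congrArg egf (funext fun n => partitionCumulant_succ ha har n)
  rw [hcumulant, mul_assoc, mul_comm (egf r), har, mul_one]

theorem succ_eq_binomialConv_partitionCumulant {a : ℕ → ℝ} (ha : a 0 = 1) (n : ℕ) :
    a (n + 1) = binomialConv (fun j => partitionCumulant a (j + 1)) a n := by
  have h := derivative_egf_eq_mul ha
  rw [derivative_egf, egf_mul_egf] at h
  exact congrFun (egf_injective h) n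

theorem partitionCumulant_binomialConv {a b : ℕ → ℝ} (ha : a 0 = 1) (hb : b 0 = 1) (n : ℕ) :
    partitionCumulant (binomialConv a b) (n + 1) =
      partitionCumulant a (n + 1) + partitionCumulant b (n + 1) := by
  have hc : binomialConv a b 0 = 1 := by simp [binomialConv, ha, hb]
  have hne : egf (binomialConv a b) ≠ 0 := fun h => by
    have hcoeff := congrArg (PowerSeries.coeff 0) h
    simp [coeff_egf, hc] at hcoeff
  have hderiv := derivative_egf_eq_mul hc
  rw [← egf_mul_egf, Derivation.leibniz, derivative_egf_eq_mul ha, derivative_egf_eq_mul hb,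
    smul_eq_mul, smul_eq_mul] at hderiv
  refine congrFun (egf_injective (mul_right_cancel₀ hne (?_ :
    egf (fun n => partitionCumulant (binomialConv a b) (n + 1)) * _ =
      egf ((fun n => partitionCumulant a (n + 1)) + fun n => partitionCumulant b (n + 1)) * _))) n
  rw [egf_add, ← egf_mul_egf, ← hderiv]
  ring

end PartitionCumulants

/-! ## Moments in terms of finite free cumulants -/

section SingletonWeights

variable {X : Type*} [Fintype X] [DecidableEq X]

theorem cycleProd_indicator_one (σ : Perm X) :
    cycleProd (fun k => if k = 1 then 1 else 0) σ = if σ = 1 then 1 else 0 := by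
  split_ifs with h
  · subst h
    simp [cycleProd, parts_partition]
  · obtain ⟨k, hk⟩ := Multiset.exists_mem_of_ne_zero (mt cycleType_eq_zero.mp h)
    have hk2 := two_le_of_mem_cycleType hk
    refine Multiset.prod_eq_zero (Multiset.mem_map.mpr ⟨k, ?_, if_neg (by omega)⟩)
    rw [parts_partition]
    exact Multiset.mem_add.mpr (Or.inl hk)

theorem cycleProd_of_cycleCount_eq_one (f : ℕ → ℝ) {σ : Perm X} (h : cycleCount σ = 1) :
    cycleProd f σ = f (Fintype.card X) := by
  simp [cycleProd, parts_of_cycleCount_eq_one h]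

theorem cycleProd_const_mul (x : ℝ) (u : ℕ → ℝ) (σ : Perm X) :
    cycleProd (fun k => x * u k) σ = x ^ cycleCount σ * cycleProd u σ := by
  rw [cycleProd, Multiset.prod_map_mul, Multiset.map_const', Multiset.prod_replicate]
  rfl

theorem cycleProd_const (x : ℝ) (σ : Perm X) : cycleProd (fun _ => x) σ = x ^ cycleCount σ := by
  rw [cycleProd, Multiset.map_const', Multiset.prod_replicate]
  rfl

theorem permSum_indicator_one (n : ℕ) : permSum (fun k => if k = 1 then 1 else 0) n = 1 := by
  simp only [permSum, cycleProd_indicator_one]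
  simp

theorem pairSum_indicator_one (f : ℕ → ℝ) (n : ℕ) :
    pairSum f (fun k => if k = 1 then 1 else 0) (n + 1) = n.factorial * f (n + 1) := by
  classical
  have inner_sum (σ : Perm (Fin (n + 1))) :
      (∑ α : Perm (Fin (n + 1)), if joinSetoid σ α = ⊤ then
        cycleProd f σ * cycleProd (fun k => if k = 1 then 1 else 0) (σ⁻¹ * α) else 0) =
      if cycleCount σ = 1 then f (n + 1) else 0 := by
    rw [Finset.sum_eq_single σ]
    · simp only [joinSetoid_self_eq_top_iff, inv_mul_cancel, cycleProd_indicator_one, if_true,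
        mul_one]
      split_ifs with h
      · rw [cycleProd_of_cycleCount_eq_one f h, Fintype.card_fin]
      · rfl
    · intro α _ hne
      rw [cycleProd_indicator_one, if_neg fun h => hne (inv_mul_eq_one.mp h).symm, mul_zero,
        ite_self]
    · simp
  rw [pairSum, Finset.sum_filter, Fintype.sum_prod_type]
  simp only [inner_sum]
  rw [← Finset.sum_filter, Finset.sum_const, nsmul_eq_mul]
  simp [card_cycleCount_eq_one]

end SingletonWeights

section PermSum

theorem permSum_zero (f : ℕ → ℝ) : permSum f 0 = 1 := by
  rw [permSum, Fintype.sum_unique]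
  simp [cycleProd, parts_partition]

theorem permSum_succ (f : ℕ → ℝ) (n : ℕ) :
    permSum f (n + 1) = binomialConv (fun j => j.factorial * f (j + 1)) (permSum f) n := by
  have h := permSum_mul_permSum_succ f (fun k => if k = 1 then 1 else 0) n
  simpa only [permSum_indicator_one, mul_one, pairSum_indicator_one, binomialConv, mul_assoc]
    using h

theorem permSum_const_succ (x : ℝ) (n : ℕ) :
    permSum (fun _ => x) (n + 1) = (x + n) * permSum (fun _ => x) n := by
  have expand (n : ℕ) : permSum (fun _ => x) (n + 1) =
      ∑ j ∈ Finset.range (n + 1), n.descFactorial j * (x * permSum (fun _ => x) (n - j)) := by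
    rw [permSum_succ]
    refine Finset.sum_congr rfl fun j _ => ?_
    rw [Nat.descFactorial_eq_factorial_mul_choose]
    push_cast
    ring
  cases n with
  | zero => simp [expand]
  | succ n =>
    have shift : ∑ j ∈ Finset.range (n + 1), (n + 1).descFactorial (j + 1) *
        (x * permSum (fun _ => x) (n + 1 - (j + 1))) = (n + 1) * permSum (fun _ => x) (n + 1) := by
      simp only [expand n, Finset.mul_sum, Nat.succ_descFactorial_succ, Nat.add_sub_add_right]
      push_cast
      exact Finset.sum_congr rfl fun j _ => by ring
    rw [expand, Finset.sum_range_succ', shift]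
    simp
    ring

theorem permSum_const (x : ℝ) (n : ℕ) :
    permSum (fun _ => x) n = (ascPochhammer ℝ n).eval x := by
  induction n with
  | zero => simp [permSum_zero]
  | succ n ih => rw [permSum_const_succ, ih, ascPochhammer_succ_eval, mul_comm]

theorem permSum_neg_natCast (d k : ℕ) :
    permSum (fun _ => -(d : ℝ)) k = (-1) ^ k * d.descFactorial k := by
  rw [permSum_const, ascPochhammer_eval_neg_eq_descPochhammer, descPochhammer_eval_eq_descFactorial]

theorem permSum_partitionCumulant {a : ℕ → ℝ} (ha : a 0 = 1) (x : ℝ) (k : ℕ) :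
    permSum (fun n => x * (x ^ (n - 1) / (n - 1).factorial * partitionCumulant a n)) k =
      x ^ k * a k := by
  induction k using Nat.strong_induction_on with
  | _ k ih =>
    cases k with
    | zero => simp [permSum_zero, ha]
    | succ n =>
      rw [permSum_succ, succ_eq_binomialConv_partitionCumulant ha, binomialConv, binomialConv,
        Finset.mul_sum]
      refine Finset.sum_congr rfl fun j hj => ?_
      have hjn : j ≤ n := Finset.mem_range_succ_iff.mp hj
      have hfac : (j.factorial : ℝ) ≠ 0 := natCast_factorial_ne_zero j
      rw [ih (n - j) (by omega), Nat.add_sub_cancel, ← Nat.add_sub_cancel' hjn,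
        Nat.add_sub_cancel_left, pow_succ, pow_add]
      field_simp

end PermSum

theorem eq_of_binomialConv_eq {𝕜 : Type*} [Field 𝕜] {u v c : ℕ → 𝕜} (hc : c 0 ≠ 0) {n : ℕ}
    (h : ∀ k ≤ n, binomialConv u c k = binomialConv v c k) : u n = v n := by
  induction n using Nat.strong_induction_on with
  | _ n ih =>
    have hn := h n le_rfl
    have lower : ∀ j ∈ Finset.range n,
        (n.choose j : 𝕜) * u j * c (n - j) = n.choose j * v j * c (n - j) := fun j hj => by
      have hjn := Finset.mem_range.mp hj
      rw [ih j hjn fun k hk => h k (by omega)]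
    simp only [binomialConv, Finset.sum_range_succ, Finset.sum_congr rfl lower] at hn
    simpa [hc] using hn

theorem multiset_mul_esymm_succ {R : Type*} [CommRing R] (M : Multiset R) (n : ℕ) :
    (n + 1) * M.esymm (n + 1) = ∑ j ∈ Finset.range (n + 1),
      (-1) ^ j * (M.map fun x => x ^ (j + 1)).sum * M.esymm (n - j) := by
  obtain ⟨l, rfl⟩ : ∃ l : List R, (l : Multiset R) = M := Quot.exists_rep M
  have hl : Finset.univ.val.map l.get = (l : Multiset R) := by
    rw [Fin.univ_val_map, List.ofFn_get]
  have hpsum (k : ℕ) : MvPolynomial.aeval l.get (MvPolynomial.psum (Fin l.length) R k) =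
      ((l : Multiset R).map fun x => x ^ k).sum := by
    rw [← hl, Multiset.map_map, MvPolynomial.psum]
    simp only [map_sum, map_pow, MvPolynomial.aeval_X]
    rfl
  have newton := congrArg (MvPolynomial.aeval l.get)
    (MvPolynomial.mul_esymm_eq_sum (Fin l.length) R (n + 1))
  simp only [map_mul, map_sum, map_pow, map_neg, map_one, map_natCast,
    MvPolynomial.aeval_esymm_eq_multiset_esymm, hl, hpsum] at newton
  rw [Finset.sum_filter, Finset.Nat.sum_antidiagonal_eq_sum_range_succ_mk,
    Finset.sum_range_succ, if_neg (by simp), add_zero, ← Finset.sum_range_reflect,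
    Finset.mul_sum, Nat.cast_succ] at newton
  refine newton.trans (Finset.sum_congr rfl fun j hj => ?_)
  have hjn : j ≤ n := Finset.mem_range_succ_iff.mp hj
  have hsub : n + 1 - (n + 1 - 1 - j) = j + 1 := by omega
  have hsign : (-1 : R) ^ (n + 1 + 1) * (-1) ^ (n - j) = (-1) ^ j := by
    rw [← pow_add, show n + 1 + 1 + (n - j) = j + 2 * (n - j + 1) by omega, pow_add, pow_mul]
    simp
  rw [if_pos (by simp), hsub, Nat.add_sub_cancel, ← hsign]
  ring

section RealRooted

variable {d : ℕ} {p : ℝ[X]}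

theorem coefA_zero (hp : p ∈ realRooted d) : coefA d 0 p = 1 := by
  simpa [coefA, hp.2.1] using hp.1.coeff_natDegree

theorem choose_mul_coefA {k : ℕ} (hk : k ≤ d) (p : ℝ[X]) :
    (-1) ^ k * d.choose k * coefA d k p = p.coeff (d - k) := by
  have hchoose : (d.choose k : ℝ) ≠ 0 := by exact_mod_cast (Nat.choose_pos hk).ne'
  have hsign : (-1 : ℝ) ^ k * (-1) ^ k = 1 := by rw [← mul_pow]; simp
  rw [coefA]
  field_simp
  linear_combination p.coeff (d - k) * hsign

theorem finiteFreeCumulant_eq (d n : ℕ) (p : ℝ[X]) :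
    finiteFreeCumulant d n p =
      (-(d : ℝ)) ^ (n - 1) / (n - 1).factorial * partitionCumulant (fun k => coefA d k p) n :=
  rfl

theorem coeff_eq_esymm_roots {k : ℕ} (hp : p ∈ realRooted d) (hk : k ≤ d) :
    p.coeff (d - k) = (-1) ^ k * p.roots.esymm k := by
  obtain ⟨hmonic, hdeg, hsplits⟩ := hp
  rw [coeff_eq_esymm_roots_of_splits hsplits (by omega), hmonic.leadingCoeff, one_mul, hdeg,
    Nat.sub_sub_self hk]

theorem succ_mul_coeff_eq_sum_rootMoment {n : ℕ} (hp : p ∈ realRooted d) (hn : n + 1 ≤ d) :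
    (n + 1) * p.coeff (d - (n + 1)) =
      ∑ j ∈ Finset.range (n + 1), -(d : ℝ) * rootMoment d p (j + 1) * p.coeff (d - (n - j)) := by
  have hd : (d : ℝ) ≠ 0 := by exact_mod_cast (by omega : d ≠ 0)
  rw [coeff_eq_esymm_roots hp hn, mul_left_comm, multiset_mul_esymm_succ, Finset.mul_sum]
  refine Finset.sum_congr rfl fun j hj => ?_
  have hjn : j ≤ n := Finset.mem_range_succ_iff.mp hj
  have hsign : (-1 : ℝ) ^ (n + 1) * (-1) ^ j = -(-1) ^ (n - j) := by
    rw [← pow_add, show n + 1 + j = n - j + 1 + 2 * j by omega, pow_add, pow_succ, pow_mul]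
    simp
  rw [coeff_eq_esymm_roots hp (by omega), rootMoment]
  field_simp
  linear_combination (p.roots.map fun x => x ^ (j + 1)).sum * p.roots.esymm (n - j) * hsign

theorem permSum_finiteFreeCumulant_mul_permSum {k : ℕ} (hp : p ∈ realRooted d) (hk : k ≤ d) :
    permSum (fun j => -(d : ℝ) * finiteFreeCumulant d j p) k * permSum (fun _ => -(d : ℝ)) k =
      (-(d : ℝ)) ^ k * k.factorial * p.coeff (d - k) := by
  simp only [finiteFreeCumulant_eq]
  rw [permSum_partitionCumulant (coefA_zero hp), permSum_neg_natCast, ← choose_mul_coefA hk,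
    Nat.descFactorial_eq_factorial_mul_choose]
  push_cast
  ring

/- With `c n = (-d)^n n! [x^(d-n)] p`, Newton's identities and the splitting of pairs of
permutations along the orbit of a point both express `c (n + 1)` as a binomial convolution with
`c`. -/
theorem pairSum_finiteFreeCumulant {n : ℕ} (hp : p ∈ realRooted d) (hn : n + 1 ≤ d) :
    pairSum (fun k => -(d : ℝ) * finiteFreeCumulant d k p) (fun _ => -(d : ℝ)) (n + 1) =
      (-(d : ℝ)) ^ (n + 2) * n.factorial * rootMoment d p (n + 1) := by
  let c : ℕ → ℝ := fun k => permSum (fun j => -(d : ℝ) * finiteFreeCumulant d j p) k *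
    permSum (fun _ => -(d : ℝ)) k
  let m : ℕ → ℝ := fun k => (-(d : ℝ)) ^ (k + 2) * k.factorial * rootMoment d p (k + 1)
  let s : ℕ → ℝ := fun k =>
    pairSum (fun j => -(d : ℝ) * finiteFreeCumulant d j p) (fun _ => -(d : ℝ)) (k + 1)
  refine eq_of_binomialConv_eq (u := s) (v := m) (c := c)
    (by simp [c, permSum_zero]) fun k hk => ?_
  have orbit_split : c (k + 1) = _ := permSum_mul_permSum_succ _ _ k
  simp only [← mul_assoc] at orbit_split
  simp only [binomialConv, s, m, c, ← mul_assoc]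
  rw [← orbit_split]
  simp only [c]
  rw [permSum_finiteFreeCumulant_mul_permSum hp (by omega), Nat.factorial_succ,
    Nat.cast_mul, Nat.cast_succ, mul_comm ((k : ℝ) + 1), ← mul_assoc, mul_assoc,
    succ_mul_coeff_eq_sum_rootMoment hp (by omega), Finset.mul_sum]
  refine Finset.sum_congr rfl fun j hj => ?_
  have hjk : j ≤ k := Finset.mem_range_succ_iff.mp hj
  have hfac : (k.factorial : ℝ) = k.choose j * j.factorial * (k - j).factorial := by
    exact_mod_cast (Nat.choose_mul_factorial_mul_factorial hjk).symm
  have hpow : (-(d : ℝ)) ^ (k + 1) = (-(d : ℝ)) ^ (j + 1) * (-(d : ℝ)) ^ (k - j) := by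
    rw [← pow_add]; congr 1; omega
  rw [mul_assoc _ (permSum _ _), permSum_finiteFreeCumulant_mul_permSum hp (by omega), hfac, hpow]
  ring

theorem rootMoment_eq_sum {n : ℕ} (hp : p ∈ realRooted d) (hn1 : 1 ≤ n) (hn : n ≤ d) :
    rootMoment d p n = 1 / ((n - 1).factorial : ℝ) *
      ∑ q ∈ transitivePairs (Fin n),
        (-1 / (d : ℝ)) ^ pairDefect q * cycleProd (fun k => finiteFreeCumulant d k p) q.1 := by
  obtain ⟨n, rfl⟩ := Nat.exists_eq_add_of_le' hn1
  have hd : (d : ℝ) ≠ 0 := by exact_mod_cast (by omega : d ≠ 0)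
  have hnegd : -(d : ℝ) ≠ 0 := neg_ne_zero.mpr hd
  have hfac : (n.factorial : ℝ) ≠ 0 := natCast_factorial_ne_zero n
  have moment_eq : rootMoment d p (n + 1) = 1 / (n.factorial : ℝ) * (((-(d : ℝ)) ^ (n + 2))⁻¹ *
      pairSum (fun k => -(d : ℝ) * finiteFreeCumulant d k p) (fun _ => -(d : ℝ)) (n + 1)) := by
    rw [pairSum_finiteFreeCumulant hp hn]
    field_simp
  rw [moment_eq, Nat.add_sub_cancel, pairSum, Finset.mul_sum]
  refine congrArg _ (Finset.sum_congr rfl fun q hq => ?_)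
  have hdefect := pairDefect_add_eq hq
  rw [Fintype.card_fin] at hdefect
  have hpow : (-(d : ℝ)) ^ (n + 2) = (-(d : ℝ)) ^ pairDefect q *
      (-(d : ℝ)) ^ cycleCount q.1 * (-(d : ℝ)) ^ cycleCount (q.1⁻¹ * q.2) := by
    rw [← pow_add, ← pow_add]; congr 1; omega
  have hinv : -1 / (d : ℝ) = (-(d : ℝ))⁻¹ := by field_simp
  rw [cycleProd_const_mul, cycleProd_const, hpow, hinv, inv_pow]
  field_simp

end RealRooted

/-! ## Real-rootedness of the finite free convolution -/

section PolarDerivatives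

variable {R : Type*} [CommRing R]

/-- The polar derivative, with respect to the point `x`, of a polynomial of degree at most `d`. -/
noncomputable def polarDerivative (d : ℕ) (x : R) (P : R[X]) : R[X] :=
  C (d : R) * P - derivative P * (X - C x)

theorem iterate_derivative_mul_X_sub_C (P : R[X]) (x : R) (k : ℕ) :
    derivative^[k] (P * (X - C x)) =
      derivative^[k] P * (X - C x) + k • derivative^[k - 1] P := by
  rw [mul_sub, iterate_derivative_sub, iterate_derivative_mul_X, mul_comm P (C x),
    iterate_derivative_C_mul]
  ring

theorem eval_iterate_derivative_polarDerivative (d : ℕ) (x : R) (P : R[X]) (k : ℕ) :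
    (derivative^[k] (polarDerivative d x P)).eval x = (d - k) * (derivative^[k] P).eval x := by
  rw [polarDerivative, iterate_derivative_sub, iterate_derivative_C_mul,
    iterate_derivative_mul_X_sub_C]
  cases k with
  | zero => simp
  | succ k =>
    rw [Nat.add_sub_cancel, ← Function.iterate_succ_apply derivative k P]
    simp
    ring

theorem coeff_polarDerivative (d : ℕ) (x : R) (P : R[X]) (m : ℕ) :
    (polarDerivative d x P).coeff m =
      (d - m) * P.coeff m + x * (m + 1) * P.coeff (m + 1) := by
  rw [polarDerivative, mul_sub, mul_comm _ (C x), coeff_sub, coeff_sub, coeff_C_mul,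
    coeff_C_mul, coeff_derivative]
  cases m with
  | zero => simp
  | succ m =>
    rw [coeff_mul_X, coeff_derivative]
    push_cast
    ring

theorem natDegree_polarDerivative_le {d : ℕ} (x : R) {P : R[X]} (hP : P.natDegree ≤ d + 1) :
    (polarDerivative (d + 1) x P).natDegree ≤ d := by
  rw [natDegree_le_iff_coeff_eq_zero]
  intro m hm
  rw [coeff_polarDerivative, coeff_eq_zero_of_natDegree_lt (by omega : P.natDegree < m + 1)]
  rcases Nat.lt_or_ge (d + 1) m with h | h
  · simp [coeff_eq_zero_of_natDegree_lt (by omega : P.natDegree < m)]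
  · simp [show m = d + 1 by omega]

/-- The apolar pairing of two polynomials of degree at most `d`, differentiated at `x` and `y`. It
depends on `x` and `y` only through `x + y`. -/
noncomputable def apolarPairing (d : ℕ) (P Q : R[X]) (x y : R) : R :=
  ∑ k ∈ Finset.range (d + 1), (derivative^[k] P).eval x * (derivative^[d - k] Q).eval y

theorem apolarPairing_mul_X_sub_C (d : ℕ) (P Q : R[X]) (x l : R) :
    apolarPairing (d + 1) P (Q * (X - C l)) x l =
      apolarPairing d (polarDerivative (d + 1) x P) Q x l := by
  rw [apolarPairing, Finset.sum_range_succ, Nat.sub_self, Function.iterate_zero, id_eq, eval_mul]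
  simp only [eval_sub, eval_X, eval_C, sub_self, mul_zero, add_zero]
  refine Finset.sum_congr rfl fun k hk => ?_
  have hkd : k ≤ d := Finset.mem_range_succ_iff.mp hk
  rw [eval_iterate_derivative_polarDerivative, iterate_derivative_mul_X_sub_C,
    show d + 1 - k - 1 = d - k by omega]
  simp only [eval_add, eval_mul, eval_sub, eval_X, eval_C, sub_self, mul_zero, zero_add,
    nsmul_eq_mul, eval_natCast]
  push_cast [show k ≤ d + 1 by omega]
  ring

theorem apolarPairing_add_sub [IsDomain R] [CharZero R] {d : ℕ} {P Q : R[X]}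
    (hP : P.natDegree ≤ d) (hQ : Q.natDegree ≤ d) (x y t : R) :
    apolarPairing d P Q (x + t) (y - t) = apolarPairing d P Q x y := by
  let g : ℕ → R[X] := fun k =>
    (derivative^[k] P).comp (C x + X) * (derivative^[d + 1 - k] Q).comp (C y - X)
  let F : R[X] := ∑ k ∈ Finset.range (d + 1),
    (derivative^[k] P).comp (C x + X) * (derivative^[d - k] Q).comp (C y - X)
  have eval_F (t : R) : F.eval t = apolarPairing d P Q (x + t) (y - t) := by
    simp [F, apolarPairing, eval_finsetSum]
  have telescope : derivative F = ∑ k ∈ Finset.range (d + 1), (g (k + 1) - g k) := by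
    rw [derivative_sum]
    refine Finset.sum_congr rfl fun k hk => ?_
    have hkd : k ≤ d := Finset.mem_range_succ_iff.mp hk
    simp only [g]
    rw [derivative_mul, derivative_comp, derivative_comp, Nat.add_sub_add_right,
      Nat.sub_add_comm hkd, Function.iterate_succ_apply', Function.iterate_succ_apply']
    simp
    ring
  have derivative_F : derivative F = 0 := by
    rw [telescope, Finset.sum_range_sub]
    simp [g, iterate_derivative_eq_zero (by omega : P.natDegree < d + 1),
      iterate_derivative_eq_zero (by omega : Q.natDegree < d + 1)]
  have eval_eq : F.eval t = F.eval 0 := by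
    rw [eq_C_of_derivative_eq_zero derivative_F, eval_C, eval_C]
  simpa [eval_F] using eval_eq

end PolarDerivatives

section Grace

theorem norm_inv_add_le_iff {h : ℝ} (hh : 0 < h) {v : ℂ} (hv : v ≠ 0) :
    ‖v⁻¹ + Complex.I / (2 * h)‖ ≤ 1 / (2 * h) ↔ h ≤ v.im := by
  have hhC : (h : ℂ) ≠ 0 := by exact_mod_cast hh.ne'
  have hquot : v⁻¹ + Complex.I / (2 * h) = (2 * h + Complex.I * v) / (2 * h * v) := by
    field_simp
  have hden : ‖(2 * h * v : ℂ)‖ = 2 * h * ‖v‖ := by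
    rw [norm_mul, norm_mul, Complex.norm_real, Real.norm_of_nonneg hh.le]
    simp
  rw [hquot, norm_div, hden, div_le_div_iff₀ (by positivity) (by positivity), one_mul,
    mul_comm, mul_le_mul_iff_right₀ (by positivity : 0 < 2 * h),
    ← sq_le_sq₀ (norm_nonneg _) (norm_nonneg _), Complex.sq_norm, Complex.sq_norm,
    Complex.normSq_apply, Complex.normSq_apply]
  simp only [Complex.add_re, Complex.mul_re, Complex.re_ofNat, Complex.ofReal_re, Complex.im_ofNat,
    Complex.ofReal_im, mul_zero, sub_zero, Complex.I_re, zero_mul, Complex.I_im, one_mul, zero_sub,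
    Complex.add_im, Complex.mul_im, add_zero, zero_add]
  constructor <;> intro hle <;> nlinarith

/- The inversion `v ↦ v⁻¹` maps the half-plane `h ≤ Im v` to a disc, which is convex. -/
theorem le_im_of_sum_inv_eq {h : ℝ} (hh : 0 < h) {M : Multiset ℂ} (hM : M ≠ 0)
    (hMh : ∀ z ∈ M, h ≤ z.im) {v : ℂ} (hv : v ≠ 0)
    (hsum : (M.map fun z => z⁻¹).sum = M.card * v⁻¹) : h ≤ v.im := by
  have hcard : (0 : ℝ) < M.card := by exact_mod_cast Multiset.card_pos.mpr hM
  have hshift : (M.map fun z => z⁻¹ + Complex.I / (2 * h)).sum =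
      M.card * (v⁻¹ + Complex.I / (2 * h)) := by
    rw [Multiset.sum_map_add, hsum, Multiset.map_const', Multiset.sum_replicate, nsmul_eq_mul,
      mul_add]
  have hdisc : ∀ r ∈ M.map fun z => ‖z⁻¹ + Complex.I / (2 * h)‖, r ≤ 1 / (2 * h) := by
    intro r hr
    obtain ⟨z, hz, rfl⟩ := Multiset.mem_map.mp hr
    have hz0 : z ≠ 0 := fun h0 => by
      have := hMh z hz
      simp only [h0, Complex.zero_im] at this
      linarith
    exact (norm_inv_add_le_iff hh hz0).mpr (hMh z hz)
  have hnorm : (M.card : ℝ) * ‖v⁻¹ + Complex.I / (2 * h)‖ ≤ M.card * (1 / (2 * h)) := by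
    rw [← Complex.norm_natCast, ← norm_mul, ← hshift, Complex.norm_natCast]
    refine (norm_multiset_sum_le _).trans ?_
    rw [Multiset.map_map]
    simpa using Multiset.sum_le_card_nsmul _ _ hdisc
  exact (norm_inv_add_le_iff hh hv).mp (le_of_mul_le_mul_left hnorm hcard)

/-- Polynomials of degree `d` with all roots in the closed lower half-plane. -/
structure LowerRooted (d : ℕ) (P : ℂ[X]) : Prop where
  ne_zero : P ≠ 0
  natDegree_eq : P.natDegree = d
  im_nonpos : ∀ w, P.eval w = 0 → w.im ≤ 0

theorem LowerRooted.card_roots {d : ℕ} {P : ℂ[X]} (hP : LowerRooted d P) : P.roots.card = d := by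
  rw [← hP.natDegree_eq, splits_iff_card_roots.mp (IsAlgClosed.splits P)]

theorem LowerRooted.im_sum_roots_nonpos {d : ℕ} {P : ℂ[X]} (hP : LowerRooted d P) :
    P.roots.sum.im ≤ 0 := by
  have him : P.roots.sum.im = (P.roots.map Complex.im).sum :=
    map_multiset_sum Complex.imAddGroupHom P.roots
  rw [him]
  refine (Multiset.sum_le_card_nsmul _ 0 fun r hr => ?_).trans_eq (smul_zero _)
  obtain ⟨w, hw, rfl⟩ := Multiset.mem_map.mp hr
  exact hP.im_nonpos w (isRoot_of_mem_roots hw)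

theorem coeff_polarDerivative_ne_zero {d : ℕ} {P : ℂ[X]} (hP : LowerRooted (d + 1) P) {x : ℂ}
    (hx : 0 < x.im) : (polarDerivative (d + 1) x P).coeff d ≠ 0 := by
  have hnext := (IsAlgClosed.splits P).nextCoeff_eq_neg_sum_roots_mul_leadingCoeff
  rw [nextCoeff_of_natDegree_pos (by rw [hP.natDegree_eq]; omega), hP.natDegree_eq,
    Nat.add_sub_cancel] at hnext
  have hlead : P.coeff (d + 1) = P.leadingCoeff := by rw [leadingCoeff, hP.natDegree_eq]
  have hcoeff : (polarDerivative (d + 1) x P).coeff d =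
      P.leadingCoeff * ((d + 1) * x - P.roots.sum) := by
    rw [coeff_polarDerivative, hnext, hlead]
    push_cast
    ring
  rw [hcoeff]
  refine mul_ne_zero (leadingCoeff_ne_zero.mpr hP.ne_zero) fun h0 => ?_
  have him := congrArg Complex.im h0
  simp only [Complex.sub_im, Complex.mul_im, Complex.add_re, Complex.natCast_re, Complex.one_re,
    Complex.add_im, Complex.natCast_im, Complex.one_im, add_zero, zero_mul, Complex.zero_im] at him
  have hpos : 0 < ((d : ℝ) + 1) * x.im := by positivity
  linarith [hP.im_sum_roots_nonpos]

/-- Laguerre's theorem for the lower half-plane. -/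
theorem lowerRooted_polarDerivative {d : ℕ} {P : ℂ[X]} (hP : LowerRooted (d + 1) P) {x : ℂ}
    (hx : 0 < x.im) : LowerRooted d (polarDerivative (d + 1) x P) := by
  have hlead := coeff_polarDerivative_ne_zero hP hx
  refine ⟨fun h => hlead (by simp [h]), natDegree_eq_of_le_of_coeff_ne_zero
    (natDegree_polarDerivative_le x hP.natDegree_eq.le) hlead, fun w hw => ?_⟩
  by_contra! hwim
  have hPw : P.eval w ≠ 0 := fun h => hwim.not_ge (hP.im_nonpos w h)
  rw [polarDerivative, eval_sub, eval_mul, eval_mul, eval_C, eval_sub, eval_X, eval_C,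
    (IsAlgClosed.splits P).eval_derivative_eq_eval_mul_sum hPw] at hw
  have hmul : (P.roots.map fun z => 1 / (w - z)).sum * (w - x) = (d + 1 : ℕ) :=
    mul_left_cancel₀ hPw (by linear_combination -hw)
  have hwx : w - x ≠ 0 := right_ne_zero_of_mul (hmul.trans_ne (Nat.cast_ne_zero.mpr d.succ_ne_zero))
  have hroots : P.roots.map (fun z => w - z) ≠ 0 := by
    rw [← Multiset.card_pos, Multiset.card_map, hP.card_roots]
    exact d.succ_pos
  have hle := le_im_of_sum_inv_eq hwim hroots (v := w - x) (fun v hv => ?_) hwx ?_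
  · rw [Complex.sub_im] at hle
    linarith
  · obtain ⟨z, hz, rfl⟩ := Multiset.mem_map.mp hv
    have := hP.im_nonpos z (isRoot_of_mem_roots hz)
    rw [Complex.sub_im]
    linarith
  · rw [Multiset.map_map, Multiset.card_map, hP.card_roots, ← hmul, mul_inv_cancel_right₀ hwx]
    simp

theorem LowerRooted.exists_eq_mul_X_sub_C {d : ℕ} {Q : ℂ[X]} (hQ : LowerRooted (d + 1) Q) :
    ∃ (l : ℂ) (Q₁ : ℂ[X]), Q = Q₁ * (X - C l) ∧ l.im ≤ 0 ∧ LowerRooted d Q₁ := by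
  obtain ⟨l, hl⟩ := IsAlgClosed.exists_root Q (by
    rw [degree_eq_natDegree hQ.ne_zero, hQ.natDegree_eq]
    exact_mod_cast d.succ_ne_zero)
  obtain ⟨Q₁, rfl⟩ := dvd_iff_isRoot.mpr hl
  have hQ₁ : Q₁ ≠ 0 := right_ne_zero_of_mul hQ.ne_zero
  have hdeg := hQ.natDegree_eq
  rw [natDegree_mul (X_sub_C_ne_zero l) hQ₁, natDegree_X_sub_C] at hdeg
  exact ⟨l, Q₁, mul_comm _ _, hQ.im_nonpos l hl, hQ₁, by omega,
    fun w hw => hQ.im_nonpos w (by simp [hw])⟩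

/-- Grace's theorem for the lower half-plane. -/
theorem apolarPairing_ne_zero {d : ℕ} {P Q : ℂ[X]} (hP : LowerRooted d P) (hQ : LowerRooted d Q)
    {x y : ℂ} (hxy : 0 < (x + y).im) : apolarPairing d P Q x y ≠ 0 := by
  induction d generalizing P Q x y with
  | zero =>
    obtain ⟨a, rfl⟩ := natDegree_eq_zero.mp hP.natDegree_eq
    obtain ⟨b, rfl⟩ := natDegree_eq_zero.mp hQ.natDegree_eq
    simpa [apolarPairing] using And.intro (by simpa using hP.ne_zero) (by simpa using hQ.ne_zero)
  | succ d ih =>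
    obtain ⟨l, Q₁, rfl, hl, hQ₁⟩ := hQ.exists_eq_mul_X_sub_C
    have hz : 0 < (x + (y - l)).im := by
      simp only [Complex.add_im, Complex.sub_im] at hxy ⊢
      linarith
    rw [← apolarPairing_add_sub hP.natDegree_eq.le hQ.natDegree_eq.le x y (y - l), sub_sub_cancel,
      apolarPairing_mul_X_sub_C]
    exact ih (lowerRooted_polarDerivative hP hz) hQ₁ (by simpa [← add_sub_assoc] using hxy)

end Grace

section FiniteFreeAdd

variable {d : ℕ} {p q : ℝ[X]}

theorem lowerRooted_map (hp : p ∈ realRooted d) : LowerRooted d (p.map (algebraMap ℝ ℂ)) := by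
  obtain ⟨hmonic, hdeg, hsplits⟩ := hp
  refine ⟨(hmonic.map _).ne_zero, by rw [hmonic.natDegree_map, hdeg], fun w hw => ?_⟩
  obtain ⟨r, rfl⟩ := hsplits.mem_range_of_isRoot hmonic.ne_zero (i := algebraMap ℝ ℂ) hw
  simp

theorem coeff_finiteFreeAdd {n : ℕ} (hn : n ≤ d) (p q : ℝ[X]) :
    (finiteFreeAdd d p q).coeff (d - n) = (-1) ^ n * d.choose n *
      ∑ i ∈ Finset.range (n + 1), n.choose i * coefA d i p * coefA d (n - i) q := by
  rw [finiteFreeAdd, finsetSum_coeff, Finset.sum_eq_single n]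
  · rw [coeff_C_mul, coeff_X_pow, if_pos rfl, mul_one]
  · intro k hk hne
    have hkd : k ≤ d := Finset.mem_range_succ_iff.mp hk
    rw [coeff_C_mul, coeff_X_pow, if_neg (by omega), mul_zero]
  · simp [hn]

theorem natDegree_finiteFreeAdd_le (d : ℕ) (p q : ℝ[X]) : (finiteFreeAdd d p q).natDegree ≤ d :=
  natDegree_sum_le_of_forall_le _ _ fun _ _ =>
    (natDegree_C_mul_X_pow_le _ _).trans (Nat.sub_le _ _)

theorem factorial_mul_coeff {k : ℕ} (hk : k ≤ d) (p : ℝ[X]) :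
    (d - k).factorial * p.coeff (d - k) =
      (-1) ^ k * (d.factorial / k.factorial) * coefA d k p := by
  have hfac : ((d - k).factorial : ℝ) ≠ 0 := natCast_factorial_ne_zero _
  rw [← choose_mul_coefA hk, Nat.cast_choose ℝ hk]
  field_simp

theorem factorial_mul_coeff_finiteFreeAdd {n : ℕ} (hn : n ≤ d) (p q : ℝ[X]) :
    d.factorial * ((d - n).factorial * (finiteFreeAdd d p q).coeff (d - n)) =
      ∑ k ∈ Finset.range (n + 1), ((d - (n - k)).factorial * p.coeff (d - (n - k))) *
        ((d - k).factorial * q.coeff (d - k)) := by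
  have hfac : ((d - n).factorial : ℝ) ≠ 0 := natCast_factorial_ne_zero _
  rw [coeff_finiteFreeAdd hn, ← Finset.sum_flip, Finset.mul_sum, Finset.mul_sum, Finset.mul_sum]
  refine Finset.sum_congr rfl fun k hk => ?_
  have hkn : k ≤ n := Finset.mem_range_succ_iff.mp hk
  have hsign : (-1 : ℝ) ^ n = (-1) ^ (n - k) * (-1) ^ k := by rw [← pow_add, Nat.sub_add_cancel hkn]
  rw [factorial_mul_coeff (by omega), factorial_mul_coeff (by omega), Nat.cast_choose ℝ hn,
    Nat.cast_choose ℝ (Nat.sub_le n k), Nat.sub_sub_self hkn, hsign]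
  field_simp

theorem factorial_mul_finiteFreeAdd (hp : p.natDegree ≤ d) (q : ℝ[X]) :
    C (d.factorial : ℝ) * finiteFreeAdd d p q =
      ∑ k ∈ Finset.range (d + 1), C ((derivative^[d - k] q).eval 0) * derivative^[k] p := by
  ext m
  rw [coeff_C_mul, finsetSum_coeff]
  rcases Nat.lt_or_ge d m with hm | hm
  · rw [coeff_eq_zero_of_natDegree_lt ((natDegree_finiteFreeAdd_le d p q).trans_lt hm), mul_zero]
    refine (Finset.sum_eq_zero fun k _ => ?_).symm
    rw [coeff_C_mul, coeff_iterate_derivative,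
      coeff_eq_zero_of_natDegree_lt (by omega : p.natDegree < m + k), smul_zero, mul_zero]
  · obtain ⟨n, hn, rfl⟩ : ∃ n ≤ d, m = d - n := ⟨d - m, by omega, by omega⟩
    have hfac : ((d - n).factorial : ℝ) ≠ 0 := natCast_factorial_ne_zero _
    have hsub : Finset.range (n + 1) ⊆ Finset.range (d + 1) :=
      Finset.range_subset_range.mpr (by omega)
    refine mul_left_cancel₀ hfac ?_
    rw [mul_left_comm, factorial_mul_coeff_finiteFreeAdd hn, Finset.mul_sum,
      ← Finset.sum_subset hsub fun k _ hk => ?_]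
    · refine Finset.sum_congr rfl fun k hk => ?_
      have hkn : k ≤ n := Finset.mem_range_succ_iff.mp hk
      have hdesc : ((d - n).factorial : ℝ) * (d - n + k).descFactorial k =
          (d - n + k).factorial := by
        have := Nat.factorial_mul_descFactorial (Nat.le_add_left k (d - n))
        rw [Nat.add_sub_cancel] at this
        exact_mod_cast this
      rw [coeff_C_mul, coeff_iterate_derivative, ← coeff_zero_eq_eval_zero,
        coeff_iterate_derivative, zero_add, Nat.descFactorial_self, nsmul_eq_mul, nsmul_eq_mul,
        show d - (n - k) = d - n + k by omega, ← hdesc]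
      ring
    · have hnk : n < k := by simpa using hk
      rw [coeff_C_mul, coeff_iterate_derivative,
        coeff_eq_zero_of_natDegree_lt (by omega : p.natDegree < d - n + k)]
      simp

theorem factorial_mul_eval_finiteFreeAdd (hp : p.natDegree ≤ d) (q : ℝ[X]) (z : ℂ) :
    d.factorial * ((finiteFreeAdd d p q).map (algebraMap ℝ ℂ)).eval z =
      apolarPairing d (p.map (algebraMap ℝ ℂ)) (q.map (algebraMap ℝ ℂ)) z 0 := by
  have h := congrArg (fun r : ℝ[X] => (r.map (algebraMap ℝ ℂ)).eval z)
    (factorial_mul_finiteFreeAdd hp q)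
  simp only [Polynomial.map_mul, map_C, eval_mul, eval_C, Polynomial.map_sum, eval_finsetSum,
    map_natCast, Polynomial.map_natCast, eval_natCast] at h
  rw [h, apolarPairing]
  refine Finset.sum_congr rfl fun k _ => ?_
  rw [mul_comm, iterate_derivative_map, iterate_derivative_map, ← coeff_zero_eq_eval_zero,
    ← coeff_zero_eq_eval_zero, coeff_map]

theorem finiteFreeAdd_mem_realRooted (hp : p ∈ realRooted d) (hq : q ∈ realRooted d) :
    finiteFreeAdd d p q ∈ realRooted d := by
  set r := finiteFreeAdd d p q with hr
  have hlead : r.coeff d = 1 := by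
    simpa [coefA_zero hp, coefA_zero hq] using coeff_finiteFreeAdd (Nat.zero_le d) p q
  have hdeg : r.natDegree = d :=
    natDegree_eq_of_le_of_coeff_ne_zero (natDegree_finiteFreeAdd_le d p q) (by simp [hlead])
  have hmonic : r.Monic := by rw [Monic, leadingCoeff, hdeg, hlead]
  have upper_ne_zero : ∀ z : ℂ, 0 < z.im → aeval z r ≠ 0 := by
    intro z hz h0
    have h := factorial_mul_eval_finiteFreeAdd hp.2.1.le q z
    rw [← hr, eval_map_algebraMap, h0, mul_zero] at h
    exact apolarPairing_ne_zero (lowerRooted_map hp) (lowerRooted_map hq) (by simpa using hz) h.symm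
  refine ⟨hmonic, hdeg, Splits.of_splits_map (algebraMap ℝ ℂ) (IsAlgClosed.splits _) fun z hz => ?_⟩
  have hroot : aeval z r = 0 := by
    simpa [eval_map_algebraMap] using (isRoot_of_mem_roots hz : _ = _)
  have him : z.im = 0 := by
    rcases lt_trichotomy z.im 0 with h | h | h
    · refine absurd ?_ (upper_ne_zero (starRingEnd ℂ z) (by simpa using h))
      rw [aeval_conj, hroot, map_zero]
    · exact h
    · exact absurd hroot (upper_ne_zero z h)
  exact ⟨z.re, Complex.ext (by simp) (by simp [him])⟩

end FiniteFreeAdd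

/-! ## First-order expansions -/

section HasExpansion

/-- `f d = a + b / d + o(1 / d)` as `d → ∞`. -/
def HasExpansion (f : ℕ → ℝ) (a b : ℝ) : Prop :=
  Tendsto (fun d : ℕ => (d : ℝ) * (f d - a)) atTop (𝓝 b)

namespace HasExpansion

variable {f g : ℕ → ℝ} {a b a' b' : ℝ}

theorem tendsto (h : HasExpansion f a b) : Tendsto f atTop (𝓝 a) := by
  have hlim : Tendsto (fun d : ℕ => (d : ℝ)⁻¹ * ((d : ℝ) * (f d - a)) + a) atTop
      (𝓝 (0 * b + a)) :=
    ((tendsto_inv_atTop_nhds_zero_nat (𝕜 := ℝ)).mul h).add_const a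
  rw [zero_mul, zero_add] at hlim
  refine hlim.congr' ?_
  filter_upwards [eventually_ne_atTop 0] with d hd
  field_simp
  ring

theorem const (a : ℝ) : HasExpansion (fun _ => a) a 0 := by
  simp [HasExpansion]

theorem congr' (h : HasExpansion f a b) (hfg : f =ᶠ[atTop] g) : HasExpansion g a b := by
  refine Tendsto.congr' ?_ h
  filter_upwards [hfg] with d hd
  rw [hd]

theorem add (hf : HasExpansion f a b) (hg : HasExpansion g a' b') :
    HasExpansion (fun d => f d + g d) (a + a') (b + b') :=
  (Tendsto.add hf hg).congr fun d => by ring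

theorem mul (hf : HasExpansion f a b) (hg : HasExpansion g a' b') :
    HasExpansion (fun d => f d * g d) (a * a') (b * a' + a * b') :=
  ((Tendsto.mul hf hg.tendsto).add (Tendsto.const_mul a hg)).congr fun d => by ring

theorem const_mul (c : ℝ) (hf : HasExpansion f a b) :
    HasExpansion (fun d => c * f d) (c * a) (c * b) :=
  (Tendsto.const_mul c hf).congr fun d => by ring

theorem inv (hf : HasExpansion f a b) (ha : a ≠ 0) :
    HasExpansion (fun d => (f d)⁻¹) a⁻¹ (b * (-(a⁻¹ * a⁻¹))) := by
  have hlim : Tendsto (fun d : ℕ => ((d : ℝ) * (f d - a)) * (-((f d)⁻¹ * a⁻¹))) atTop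
      (𝓝 (b * (-(a⁻¹ * a⁻¹)))) :=
    Tendsto.mul hf ((hf.tendsto.inv₀ ha).mul_const a⁻¹).neg
  refine hlim.congr' ?_
  filter_upwards [hf.tendsto.eventually_ne ha] with d hd
  field_simp
  ring

theorem sum {ι : Type*} {s : Finset ι} {f : ι → ℕ → ℝ} {a b : ι → ℝ}
    (h : ∀ i ∈ s, HasExpansion (f i) (a i) (b i)) :
    HasExpansion (fun d => ∑ i ∈ s, f i d) (∑ i ∈ s, a i) (∑ i ∈ s, b i) := by
  refine (tendsto_finsetSum s h).congr fun d => ?_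
  rw [← Finset.mul_sum, Finset.sum_sub_distrib]

theorem prod {ι : Type*} [DecidableEq ι] {s : Finset ι} {f : ι → ℕ → ℝ} {a b : ι → ℝ}
    (h : ∀ i ∈ s, HasExpansion (f i) (a i) (b i)) :
    HasExpansion (fun d => ∏ i ∈ s, f i d) (∏ i ∈ s, a i)
      (∑ i ∈ s, b i * ∏ j ∈ s.erase i, a j) := by
  induction s using Finset.induction_on with
  | empty => simpa using const 1
  | insert i s hi ih =>
    have hmul := (h i (Finset.mem_insert_self i s)).mul
      (ih fun j hj => h j (Finset.mem_insert_of_mem hj))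
    simp only [Finset.prod_insert hi, Finset.sum_insert hi, Finset.erase_insert hi]
    convert hmul using 2
    rw [Finset.mul_sum]
    refine Finset.sum_congr rfl fun j hj => ?_
    have hij : i ≠ j := fun e => hi (e ▸ hj)
    rw [Finset.erase_insert_of_ne hij, Finset.prod_insert (fun h => hi (Finset.mem_of_mem_erase h))]
    ring

theorem exists_multiset_prod {s : Multiset ℕ} {κ : ℕ → ℕ → ℝ}
    (h : ∀ k ∈ s, ∃ a b, HasExpansion (fun d => κ d k) a b) :
    ∃ a b, HasExpansion (fun d => (s.map (κ d)).prod) a b := by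
  induction s using Multiset.induction_on with
  | empty => exact ⟨1, 0, by simpa using const 1⟩
  | cons k s ih =>
    obtain ⟨a, b, hk⟩ := h k (Multiset.mem_cons_self k s)
    obtain ⟨a', b', hs⟩ := ih fun j hj => h j (Multiset.mem_cons_of_mem hj)
    exact ⟨_, _, by simpa using hk.mul hs⟩

theorem exists_sum {ι : Type*} {s : Finset ι} {f : ι → ℕ → ℝ}
    (h : ∀ i ∈ s, ∃ a b, HasExpansion (f i) a b) :
    ∃ a b, HasExpansion (fun d => ∑ i ∈ s, f i d) a b := by
  choose! a b hab using h
  exact ⟨_, _, sum hab⟩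

theorem neg_one_div_pow_mul {k : ℕ} (hk : k ≠ 0) (hf : Tendsto f atTop (𝓝 a)) :
    HasExpansion (fun d => (-1 / (d : ℝ)) ^ k * f d) 0 (if k = 1 then -a else 0) := by
  obtain ⟨k, rfl⟩ := Nat.exists_eq_succ_of_ne_zero hk
  have hlim : Tendsto (fun d : ℕ => -((-1 / (d : ℝ)) ^ k * f d)) atTop (𝓝 (-(0 ^ k * a))) :=
    (((tendsto_const_div_atTop_nhds_zero_nat (-1)).pow k).mul hf).neg
  have hval : (if k.succ = 1 then -a else 0) = -(0 ^ k * a) := by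
    cases k <;> simp
  rw [hval]
  refine hlim.congr' ?_
  filter_upwards [eventually_ne_atTop 0] with d hd
  rw [pow_succ]
  field_simp
  ring

theorem exists_neg_one_div_pow (k : ℕ) :
    ∃ b, HasExpansion (fun d : ℕ => (-1 / (d : ℝ)) ^ k) (0 ^ k) b := by
  rcases eq_or_ne k 0 with rfl | hk
  · exact ⟨0, by simpa using const 1⟩
  · exact ⟨_, by simpa [hk] using neg_one_div_pow_mul hk (tendsto_const_nhds (x := (1 : ℝ)))⟩

end HasExpansion

end HasExpansion

/-! ## Expansion of moments and cumulants -/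

section Expansion

theorem tendsto_cycleProd {X : Type*} [Fintype X] [DecidableEq X] {κ : ℕ → ℕ → ℝ} {r : ℕ → ℝ}
    (h : ∀ k, 1 ≤ k → Tendsto (fun d => κ d k) atTop (𝓝 (r k))) (σ : Perm X) :
    Tendsto (fun d => cycleProd (κ d) σ) atTop (𝓝 (cycleProd r σ)) :=
  tendsto_multiset_prod _ fun _ hk => h _ (σ.partition.parts_pos hk)

theorem hasExpansion_partProd {κ : ℕ → ℕ → ℝ} {r s : ℕ → ℝ}
    (h : ∀ k, 1 ≤ k → HasExpansion (fun d => κ d k) (r k) (s k)) {n : ℕ} (π : SetPartition n) :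
    HasExpansion (fun d => partProd (κ d) π) (partProd r π) (partDeriv r s π) :=
  HasExpansion.prod fun _ hV => h _ (Finset.card_pos.mpr (π.nonempty_of_mem_parts hV))

theorem sum_planar_pairs_cycleProd {n : ℕ} (hn : 1 ≤ n) (u : ℕ → ℝ) :
    ∑ q ∈ transitivePairs (Fin n) with pairDefect q = 0, cycleProd u q.1 =
      ((n - 1).factorial : ℝ) * ∑ π ∈ NC n, partProd u π := by
  have hsum := sum_planar_pairs hn fun m => (m.map u).prod
  simp only [Multiset.map_map] at hsum
  exact hsum

/-- Defect `0` contributes the planar terms, defect `1` the annular ones, and larger defects are of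
order `o(1 / d)`. -/
theorem hasExpansion_sum_transitivePairs {κ : ℕ → ℕ → ℝ} {r s : ℕ → ℝ}
    (h : ∀ k, 1 ≤ k → HasExpansion (fun d => κ d k) (r k) (s k)) {n : ℕ} (hn : 1 ≤ n) :
    HasExpansion (fun d => ∑ q ∈ transitivePairs (Fin n),
        (-1 / (d : ℝ)) ^ pairDefect q * cycleProd (κ d) q.1)
      ((n - 1).factorial * ∑ π ∈ NC n, partProd r π)
      ((n - 1).factorial * (∑ π ∈ NC n, partDeriv r s π - annularSum r n)) := by
  have planar : HasExpansion (fun d => ∑ q ∈ transitivePairs (Fin n) with pairDefect q = 0,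
        (-1 / (d : ℝ)) ^ pairDefect q * cycleProd (κ d) q.1)
      ((n - 1).factorial * ∑ π ∈ NC n, partProd r π)
      ((n - 1).factorial * ∑ π ∈ NC n, partDeriv r s π) := by
    refine ((HasExpansion.sum fun π _ => hasExpansion_partProd h π).const_mul _).congr'
      (.of_forall fun d => ?_)
    beta_reduce
    rw [← sum_planar_pairs_cycleProd hn]
    refine Finset.sum_congr rfl fun q hq => ?_
    rw [(Finset.mem_filter.mp hq).2, pow_zero, one_mul]
  have nonplanar : HasExpansion (fun d => ∑ q ∈ transitivePairs (Fin n) with pairDefect q ≠ 0,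
        (-1 / (d : ℝ)) ^ pairDefect q * cycleProd (κ d) q.1)
      0 (-((n - 1).factorial * annularSum r n)) := by
    have hsum := HasExpansion.sum (s := {q ∈ transitivePairs (Fin n) | pairDefect q ≠ 0})
      fun q hq => HasExpansion.neg_one_div_pow_mul (Finset.mem_filter.mp hq).2
        (tendsto_cycleProd (fun k hk => (h k hk).tendsto) q.1)
    convert hsum using 1
    · rw [Finset.sum_const_zero]
    · rw [← sum_annular_pairs hn, ← Finset.sum_neg_distrib, ← Finset.sum_filter,
        Finset.filter_filter]
      congr 2 with q
      omega
  simpa only [Finset.sum_filter_add_sum_filter_not, add_zero, ← sub_eq_add_neg, ← mul_sub]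
    using planar.add nonplanar

theorem hasExpansion_rootMoment {p : ℕ → ℝ[X]} (hp : ∀ d, 1 ≤ d → p d ∈ realRooted d) {r s : ℕ → ℝ}
    (h : ∀ k, 1 ≤ k → HasExpansion (fun d => finiteFreeCumulant d k (p d)) (r k) (s k))
    {n : ℕ} (hn : 1 ≤ n) :
    HasExpansion (fun d => rootMoment d (p d) n) (∑ π ∈ NC n, partProd r π)
      (∑ π ∈ NC n, partDeriv r s π - annularSum r n) := by
  have hfac : ((n - 1).factorial : ℝ) ≠ 0 := natCast_factorial_ne_zero _
  have hsum := (hasExpansion_sum_transitivePairs h hn).const_mul (1 / ((n - 1).factorial : ℝ))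
  simp only [one_div, inv_mul_cancel_left₀ hfac] at hsum
  refine hsum.congr' ?_
  filter_upwards [eventually_ge_atTop n] with d hd
  rw [rootMoment_eq_sum (hp d (hn.trans hd)) hn hd, one_div]

theorem lt_of_mem_partition_parts {n k : ℕ} {σ : Perm (Fin n)} (h : cycleCount σ ≠ 1)
    (hk : k ∈ σ.partition.parts) : k < n := by
  obtain ⟨s, hs⟩ := Multiset.exists_cons_of_mem hk
  have hsum : k + s.sum = n := by
    rw [← Multiset.sum_cons, ← hs, σ.partition.parts_sum, Fintype.card_fin]
  have hs0 : s ≠ 0 := by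
    rintro rfl
    exact h (by rw [cycleCount, hs]; rfl)
  obtain ⟨j, hj⟩ := Multiset.exists_mem_of_ne_zero hs0
  have hjpos : 0 < j := σ.partition.parts_pos (hs ▸ Multiset.mem_cons_of_mem hj)
  have hjle := Multiset.le_sum_of_mem hj
  omega

theorem sum_transitivePairs_eq_add {n : ℕ} (x : ℝ) (u : ℕ → ℝ) :
    ∑ q ∈ transitivePairs (Fin n), x ^ pairDefect q * cycleProd u q.1 =
      (∑ q ∈ transitivePairs (Fin n) with cycleCount q.1 = 1, x ^ pairDefect q) * u n +
      ∑ q ∈ transitivePairs (Fin n) with cycleCount q.1 ≠ 1,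
        x ^ pairDefect q * cycleProd u q.1 := by
  rw [Finset.sum_mul, ← Finset.sum_filter_add_sum_filter_not _ fun q => cycleCount q.1 = 1]
  refine congrArg (· + _) (Finset.sum_congr rfl fun q hq => ?_)
  rw [cycleProd_of_cycleCount_eq_one _ (Finset.mem_filter.mp hq).2, Fintype.card_fin]

theorem sum_zero_pow_pairDefect_ne_zero {n : ℕ} (hn : 1 ≤ n) :
    ∑ q ∈ transitivePairs (Fin n) with cycleCount q.1 = 1, (0 : ℝ) ^ pairDefect q ≠ 0 := by
  have : Nonempty (Fin n) := ⟨⟨0, hn⟩⟩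
  have hcount : cycleCount (finRotate n) = 1 := cycleCount_finRotate hn
  refine (Finset.sum_pos' (fun q _ => by positivity) ⟨(finRotate n, finRotate n), ?_, ?_⟩).ne'
  · simpa [mem_transitivePairs, hcount] using joinSetoid_self_eq_top_iff.mpr hcount
  · simp [pairDefect, hcount, cycleCount_one, add_comm 1 n]

theorem exists_hasExpansion_finiteFreeCumulant {p : ℕ → ℝ[X]}
    (hp : ∀ d, 1 ≤ d → p d ∈ realRooted d) {m m' : ℕ → ℝ}
    (h : ∀ n, 1 ≤ n → HasExpansion (fun d => rootMoment d (p d) n) (m n) (m' n))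
    {n : ℕ} (hn : 1 ≤ n) :
    ∃ a b, HasExpansion (fun d => finiteFreeCumulant d n (p d)) a b := by
  induction n using Nat.strong_induction_on with
  | _ n ih =>
  obtain ⟨a, b, lower⟩ := HasExpansion.exists_sum
      (s := {q ∈ transitivePairs (Fin n) | cycleCount q.1 ≠ 1})
      (f := fun q d => (-1 / (d : ℝ)) ^ pairDefect q *
        cycleProd (fun k => finiteFreeCumulant d k (p d)) q.1) fun q hq => by
    obtain ⟨b, hpow⟩ := HasExpansion.exists_neg_one_div_pow (pairDefect q)
    obtain ⟨a', b', hprod⟩ := HasExpansion.exists_multiset_prod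
      (κ := fun d k => finiteFreeCumulant d k (p d)) fun k hk =>
        ih k (lt_of_mem_partition_parts (Finset.mem_filter.mp hq).2 hk)
          (q.1.partition.parts_pos hk)
    exact ⟨_, _, hpow.mul hprod⟩
  choose b hb using HasExpansion.exists_neg_one_div_pow
  have leading := HasExpansion.sum (s := {q ∈ transitivePairs (Fin n) | cycleCount q.1 = 1})
    fun q _ => hb (pairDefect q)
  have hne := sum_zero_pow_pairDefect_ne_zero hn
  refine ⟨_, _, ((((h n hn).const_mul ((n - 1).factorial : ℝ)).add
    (lower.const_mul (-1))).mul (leading.inv hne)).congr' ?_⟩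
  filter_upwards [leading.tendsto.eventually_ne hne, eventually_ge_atTop n] with d hd hnd
  have hfac : ((n - 1).factorial : ℝ) ≠ 0 := natCast_factorial_ne_zero _
  rw [rootMoment_eq_sum (hp d (hn.trans hnd)) hn hnd, sum_transitivePairs_eq_add,
    one_div, mul_inv_cancel_left₀ hfac, neg_one_mul, add_neg_cancel_right,
    mul_right_comm, mul_inv_cancel₀ hd, one_mul]

end Expansion

section Additivity

variable {d n : ℕ} {p q : ℝ[X]}

theorem coefA_finiteFreeAdd (hn : n ≤ d) (p q : ℝ[X]) :
    coefA d n (finiteFreeAdd d p q) =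
      binomialConv (fun k => coefA d k p) (fun k => coefA d k q) n := by
  have hc : (d.choose n : ℝ) ≠ 0 := by exact_mod_cast (Nat.choose_pos hn).ne'
  have hsign : (-1 : ℝ) ^ n * (-1) ^ n = 1 := by rw [← mul_pow]; simp
  rw [coefA, coeff_finiteFreeAdd hn, div_eq_iff hc, ← mul_assoc, ← mul_assoc, hsign]
  simp only [binomialConv]
  ring

theorem finiteFreeCumulant_finiteFreeAdd (hp : p ∈ realRooted d) (hq : q ∈ realRooted d)
    (hn1 : 1 ≤ n) (hn : n ≤ d) :
    finiteFreeCumulant d n (finiteFreeAdd d p q) =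
      finiteFreeCumulant d n p + finiteFreeCumulant d n q := by
  obtain ⟨n, rfl⟩ : ∃ m, n = m + 1 := ⟨n - 1, by omega⟩
  rw [finiteFreeCumulant_eq, finiteFreeCumulant_eq, finiteFreeCumulant_eq, ← mul_add,
    ← partitionCumulant_binomialConv (coefA_zero hp) (coefA_zero hq)]
  congr 1
  exact partitionCumulant_congr fun k hk => coefA_finiteFreeAdd (hk.trans hn) p q

end Additivity

/-! ## Limits of moments -/

section MomentLimit

variable {μ : ℕ → ProbabilityMeasure ℝ} {ρ : ProbabilityMeasure ℝ} {m : ℕ → ℝ}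

theorem isTightMeasureSet_of_lintegral_enorm_le {E : Type*} [NormedAddCommGroup E]
    [ProperSpace E] [MeasurableSpace E] [BorelSpace E] {S : Set (Measure E)} {C : ENNReal}
    (hC : C ≠ ⊤) (h : ∀ μ ∈ S, ∫⁻ x, ‖x‖ₑ ∂μ ≤ C) : IsTightMeasureSet S := by
  refine isTightMeasureSet_of_tendsto_measure_norm_gt ?_
  have hlim : Tendsto (fun r : ℝ => C / ENNReal.ofReal r) atTop (𝓝 0) := by
    simpa using ENNReal.Tendsto.const_div ENNReal.tendsto_ofReal_atTop (Or.inr hC)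
  refine tendsto_of_tendsto_of_tendsto_of_le_of_le' tendsto_const_nhds hlim
    (.of_forall fun _ => bot_le) ?_
  filter_upwards [eventually_gt_atTop 0] with r hr
  refine iSup₂_le fun μ hμ => ?_
  calc μ {x | r < ‖x‖} ≤ μ {x | ENNReal.ofReal r ≤ ‖x‖ₑ} :=
        measure_mono fun x hx => by
          rw [Set.mem_ofPred_eq, ← ofReal_norm]
          exact ENNReal.ofReal_le_ofReal (le_of_lt hx)
    _ ≤ (∫⁻ x, ‖x‖ₑ ∂μ) / ENNReal.ofReal r :=
        meas_ge_le_lintegral_div continuous_enorm.aemeasurable (ENNReal.ofReal_pos.mpr hr).ne'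
          ENNReal.ofReal_ne_top
    _ ≤ C / ENNReal.ofReal r := ENNReal.div_le_div_right (h μ hμ) _

theorem integrable_and_integral_le_of_tendsto {Ω : Type*} [MeasurableSpace Ω] [TopologicalSpace Ω]
    [OpensMeasurableSpace Ω] [HasOuterApproxClosed Ω] {μ : ℕ → ProbabilityMeasure Ω}
    {ρ : ProbabilityMeasure Ω} (h : Tendsto μ atTop (𝓝 ρ)) {f : Ω → ℝ} (hf : Continuous f)
    (hf0 : 0 ≤ f) (hintegrable : ∀ d, Integrable f (μ d : Measure Ω)) {L : ℝ}
    (hL : Tendsto (fun d => ∫ x, f x ∂(μ d : Measure Ω)) atTop (𝓝 L)) :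
    Integrable f (ρ : Measure Ω) ∧ ∫ x, f x ∂(ρ : Measure Ω) ≤ L := by
  have hlint : ∫⁻ x, ENNReal.ofReal (f x) ∂(ρ : Measure Ω) ≤ ENNReal.ofReal L := by
    refine (lintegral_le_liminf_lintegral_of_forall_isOpen_measure_le_liminf_measure hf hf0
      fun G hG => ProbabilityMeasure.le_liminf_measure_open_of_tendsto h hG).trans_eq ?_
    simp only [← ofReal_integral_eq_lintegral_ofReal (hintegrable _) (.of_forall hf0)]
    exact ((ENNReal.continuous_ofReal.tendsto L).comp hL).liminf_eq
  refine ⟨⟨hf.aestronglyMeasurable, ?_⟩, ?_⟩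
  · rw [hasFiniteIntegral_iff_ofReal (.of_forall hf0)]
    exact hlint.trans_lt ENNReal.ofReal_lt_top
  · rw [integral_eq_lintegral_of_nonneg_ae (.of_forall hf0) hf.aestronglyMeasurable]
    exact ENNReal.toReal_le_of_le_ofReal
      (ge_of_tendsto' hL fun d => integral_nonneg hf0) hlint

theorem abs_pow_le_one_add (x : ℝ) (n : ℕ) : |x ^ n| ≤ 1 + x ^ (2 * n) := by
  rw [mul_comm, pow_mul, ← sq_abs (x ^ n)]
  nlinarith [sq_nonneg (|x ^ n| - 1)]

theorem hasFiniteMoments_of_tendsto (h : Tendsto μ atTop (𝓝 ρ))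
    (hf : ∀ d, HasFiniteMoments (μ d : Measure ℝ))
    (hm : ∀ n, Tendsto (fun d => moment (μ d : Measure ℝ) n) atTop (𝓝 (m n))) :
    HasFiniteMoments (ρ : Measure ℝ) := fun n =>
  ((integrable_const 1).add (integrable_and_integral_le_of_tendsto h (continuous_pow (2 * n))
    (fun _ => (even_two_mul n).pow_nonneg _) (fun d => hf d (2 * n)) (hm (2 * n))).1).mono'
      (continuous_pow n).aestronglyMeasurable (.of_forall fun x => abs_pow_le_one_add x n)

theorem integrable_one_add_mul_pow_sq {μ : Measure ℝ} [IsFiniteMeasure μ]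
    (h : HasFiniteMoments μ) (n : ℕ) (c : ℝ) : Integrable (fun x => (1 + c * x ^ n) ^ 2) μ :=
  (((integrable_const 1).add ((h n).const_mul (2 * c))).add ((h (2 * n)).const_mul (c ^ 2))).congr
    (.of_forall fun x => by simp only [Pi.add_apply]; ring)

theorem integral_one_add_mul_pow_sq {μ : Measure ℝ} [IsProbabilityMeasure μ]
    (h : HasFiniteMoments μ) (n : ℕ) (c : ℝ) :
    ∫ x, (1 + c * x ^ n) ^ 2 ∂μ = 1 + 2 * c * moment μ n + c ^ 2 * moment μ (2 * n) := by
  have hlin : Integrable (fun x => 1 + 2 * c * x ^ n) μ :=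
    (integrable_const 1).add ((h n).const_mul (2 * c))
  calc ∫ x, (1 + c * x ^ n) ^ 2 ∂μ = ∫ x, (1 + 2 * c * x ^ n + c ^ 2 * x ^ (2 * n)) ∂μ := by
        congr with x
        ring
    _ = 1 + 2 * c * moment μ n + c ^ 2 * moment μ (2 * n) := by
        rw [integral_add hlin ((h _).const_mul _), integral_add (integrable_const 1)
          ((h n).const_mul _), integral_const_mul, integral_const_mul]
        simp [moment]

/- Integrals of nonnegative continuous functions are lower semicontinuous. Applied to
`(1 + c x ^ n) ^ 2` for every real `c`, this bounds a quadratic in `c` with no constant term from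
below by `0`, so that its linear coefficient vanishes. -/
theorem moment_eq_of_tendsto (h : Tendsto μ atTop (𝓝 ρ))
    (hf : ∀ d, HasFiniteMoments (μ d : Measure ℝ))
    (hm : ∀ n, Tendsto (fun d => moment (μ d : Measure ℝ) n) atTop (𝓝 (m n))) (n : ℕ) :
    moment (ρ : Measure ℝ) n = m n := by
  have hρ := hasFiniteMoments_of_tendsto h hf hm
  have hquad (c : ℝ) : 0 ≤ (m (2 * n) - moment (ρ : Measure ℝ) (2 * n)) * (c * c) +
      2 * (m n - moment (ρ : Measure ℝ) n) * c + 0 := by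
    have hle := (integrable_and_integral_le_of_tendsto h
      (f := fun x => (1 + c * x ^ n) ^ 2) (by fun_prop) (fun x => sq_nonneg _)
      (fun d => integrable_one_add_mul_pow_sq (hf d) n c)
      (L := 1 + 2 * c * m n + c ^ 2 * m (2 * n)) (by
        simp only [integral_one_add_mul_pow_sq (hf _)]
        exact (((hm n).const_mul _).const_add _).add ((hm (2 * n)).const_mul _))).2
    rw [integral_one_add_mul_pow_sq hρ] at hle
    linarith
  have hdiscrim := discrim_le_zero hquad
  rw [discrim] at hdiscrim
  nlinarith

theorem isTightMeasureSet_of_moment_two_le {S : Set (ProbabilityMeasure ℝ)} {c : ℝ}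
    (hf : ∀ μ ∈ S, HasFiniteMoments (μ : Measure ℝ)) (hc : ∀ μ ∈ S, moment (μ : Measure ℝ) 2 ≤ c) :
    IsTightMeasureSet {((μ : ProbabilityMeasure ℝ) : Measure ℝ) | μ ∈ S} := by
  refine isTightMeasureSet_of_lintegral_enorm_le (C := ENNReal.ofReal (1 + c))
    ENNReal.ofReal_ne_top ?_
  rintro _ ⟨μ, hμ, rfl⟩
  have hintegrable : Integrable (fun x : ℝ => 1 + x ^ 2) (μ : Measure ℝ) :=
    (integrable_const 1).add (hf μ hμ 2)
  calc ∫⁻ x, ‖x‖ₑ ∂(μ : Measure ℝ)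
      ≤ ∫⁻ x, ENNReal.ofReal (1 + x ^ 2) ∂(μ : Measure ℝ) := lintegral_mono fun x => by
        rw [Real.enorm_eq_ofReal_abs]
        exact ENNReal.ofReal_le_ofReal (by simpa using abs_pow_le_one_add x 1)
    _ = ENNReal.ofReal (1 + moment (μ : Measure ℝ) 2) := by
        rw [← ofReal_integral_eq_lintegral_ofReal hintegrable (.of_forall fun x => by positivity),
          integral_add (integrable_const 1) (hf μ hμ 2)]
        simp [moment]
    _ ≤ ENNReal.ofReal (1 + c) := ENNReal.ofReal_le_ofReal (by gcongr; exact hc μ hμ)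

theorem exists_moment_eq_of_tendsto (hf : ∀ d, HasFiniteMoments (μ d : Measure ℝ))
    (hm : ∀ n, Tendsto (fun d => moment (μ d : Measure ℝ) n) atTop (𝓝 (m n))) :
    ∃ ρ : Measure ℝ, IsProbabilityMeasure ρ ∧ HasFiniteMoments ρ ∧ ∀ n, moment ρ n = m n := by
  obtain ⟨c, hc⟩ := (hm 2).bddAbove_range
  have htight := isTightMeasureSet_of_moment_two_le (S := Set.range μ)
    (Set.forall_mem_range.mpr hf) (Set.forall_mem_range.mpr fun d => hc ⟨d, rfl⟩)
  obtain ⟨ρ, -, φ, hφ, hρ⟩ := (isCompact_closure_of_isTightMeasureSet htight).tendsto_subseq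
    fun d => subset_closure (Set.mem_range_self d)
  have hmφ (n : ℕ) := (hm n).comp hφ.tendsto_atTop
  exact ⟨ρ, inferInstance, hasFiniteMoments_of_tendsto hρ (fun d => hf (φ d)) hmφ,
    moment_eq_of_tendsto hρ (fun d => hf (φ d)) hmφ⟩

end MomentLimit

section RootDistribution

variable {d : ℕ} {p : ℝ[X]}

theorem hasFiniteMoments_sum_dirac (M : Multiset ℝ) :
    HasFiniteMoments (M.map Measure.dirac).sum := fun n => by
  induction M using Multiset.induction_on with
  | empty => simp
  | cons a M ih =>
    rw [Multiset.map_cons, Multiset.sum_cons]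
    exact (integrable_dirac (by simp)).add_measure ih

theorem moment_sum_dirac (M : Multiset ℝ) (n : ℕ) :
    moment (M.map Measure.dirac).sum n = (M.map fun x => x ^ n).sum := by
  induction M using Multiset.induction_on with
  | empty => simp [moment]
  | cons a M ih =>
    rw [Multiset.map_cons, Multiset.sum_cons, moment, integral_add_measure
      (integrable_dirac (by simp)) (hasFiniteMoments_sum_dirac M n), integral_dirac,
      Multiset.map_cons, Multiset.sum_cons, ← ih, moment]

theorem sum_dirac_apply_univ (M : Multiset ℝ) :
    (M.map Measure.dirac).sum Set.univ = Multiset.card M := by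
  induction M using Multiset.induction_on with
  | empty => simp
  | cons a M ih => simp [ih, add_comm]

/-- The root distribution of a polynomial of degree `d`: the uniform probability measure on its
roots, counted with multiplicity. -/
noncomputable def rootDistribution (d : ℕ) (p : ℝ[X]) : Measure ℝ :=
  (d : ENNReal)⁻¹ • (p.roots.map Measure.dirac).sum

theorem isProbabilityMeasure_rootDistribution (hd : d ≠ 0) (hp : p ∈ realRooted d) :
    IsProbabilityMeasure (rootDistribution d p) := by
  constructor
  rw [rootDistribution, Measure.smul_apply, sum_dirac_apply_univ,
    ← hp.2.2.natDegree_eq_card_roots, hp.2.1, smul_eq_mul,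
    ENNReal.inv_mul_cancel (Nat.cast_ne_zero.mpr hd) (ENNReal.natCast_ne_top d)]

theorem hasFiniteMoments_rootDistribution (hd : d ≠ 0) (p : ℝ[X]) :
    HasFiniteMoments (rootDistribution d p) := fun n =>
  (hasFiniteMoments_sum_dirac _ n).smul_measure (ENNReal.inv_ne_top.mpr (Nat.cast_ne_zero.mpr hd))

theorem moment_rootDistribution (d n : ℕ) (p : ℝ[X]) :
    moment (rootDistribution d p) n = rootMoment d p n := by
  rw [rootMoment, ← moment_sum_dirac, moment, rootDistribution, integral_smul_measure, moment]
  simp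

end RootDistribution

/-! ## The infinitesimal distribution of a finite free convolution -/

theorem eq_indiscrete_of_mem_parts {α : Type*} [Lattice α] [OrderBot α] {a : α} (ha : a ≠ ⊥)
    {P : Finpartition a} (h : a ∈ P.parts) : P = Finpartition.indiscrete ha := by
  refine Finpartition.ext (Finset.eq_singleton_iff_unique_mem.mpr ⟨h, fun b hb => ?_⟩)
  by_contra hne
  exact P.ne_bot hb ((P.disjoint hb h hne).eq_bot_of_le (P.le hb))

theorem indiscrete_mem_NC {n : ℕ} (h : (Finset.univ : Finset (Fin n)) ≠ ⊥) :
    Finpartition.indiscrete h ∈ NC n := by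
  simp only [NC, Finset.mem_filter_univ]
  intro a b c d _ _ _ V hV W hW _ _ _ _
  rw [Finpartition.indiscrete_parts, Finset.mem_singleton] at hV hW
  rw [hV, hW]

theorem sum_NC_partProd {n : ℕ} (hn : 1 ≤ n) (u : ℕ → ℝ) :
    ∑ π ∈ NC n, partProd u π =
      u n + ∑ π ∈ NC n with ∀ V ∈ π.parts, V.card < n, partProd u π := by
  have hne : (Finset.univ : Finset (Fin n)) ≠ ⊥ :=
    Finset.Nonempty.ne_empty ⟨⟨0, hn⟩, Finset.mem_univ _⟩
  have hfull : {π ∈ NC n | ¬ ∀ V ∈ π.parts, V.card < n} = {Finpartition.indiscrete hne} := by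
    refine Finset.eq_singleton_iff_unique_mem.mpr
      ⟨by simp [indiscrete_mem_NC], fun π hπ => eq_indiscrete_of_mem_parts hne ?_⟩
    obtain ⟨V, hV, hVn⟩ : ∃ V ∈ π.parts, n ≤ V.card := by simpa using (Finset.mem_filter.mp hπ).2
    have hVuniv : V = Finset.univ :=
      Finset.eq_univ_of_card V ((Finset.card_le_univ V).antisymm (by simpa using hVn))
    exact hVuniv ▸ hV
  rw [← Finset.sum_filter_add_sum_filter_not (NC n) (fun π => ∀ V ∈ π.parts, V.card < n), hfull,
    Finset.sum_singleton, add_comm]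
  simp [partProd]

theorem cumulantOfMoments_eq_of_eq_sum_NC {m u : ℕ → ℝ}
    (h : ∀ n, 1 ≤ n → m n = ∑ π ∈ NC n, partProd u π) {n : ℕ} (hn : 1 ≤ n) :
    cumulantOfMoments m n = u n := by
  induction n using Nat.strong_induction_on with
  | _ n ih =>
  rw [cumulantOfMoments_eq, h n hn, sum_NC_partProd hn, sub_eq_iff_eq_add]
  congr 1
  refine Finset.sum_congr rfl fun π hπ => Finset.prod_congr rfl fun V hV => ?_
  exact (ih _ ((Finset.mem_filter.mp hπ).2 V hV)
    (Finset.card_pos.mpr (π.nonempty_of_mem_parts hV))).symm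

theorem rootMoment_zero {d : ℕ} (hd : d ≠ 0) {p : ℝ[X]} (hp : p ∈ realRooted d) :
    rootMoment d p 0 = 1 := by
  have := isProbabilityMeasure_rootDistribution hd hp
  simp [← moment_rootDistribution, moment]

theorem exists_linearMap_X_pow {R M : Type*} [CommSemiring R] [AddCommMonoid M] [Module R M]
    (f : ℕ → M) : ∃ φ : R[X] →ₗ[R] M, ∀ n, φ (X ^ n) = f n :=
  ⟨(basisMonomials R).constr R f, fun n => by
    rw [X_pow_eq_monomial, ← congrFun (coe_basisMonomials R) n, Module.Basis.constr_basis]⟩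

section Convolution

variable {p q : ℕ → ℝ[X]} {μ ν ρ : Measure ℝ} {μ' ν' : ℝ[X] →ₗ[ℝ] ℝ}

theorem HasInfinitesimalDistribution.exists_hasCumulantFluctuations
    (hp : HasInfinitesimalDistribution p μ μ') : ∃ s, HasCumulantFluctuations p μ s := by
  choose! r s hrs using fun n (hn : 1 ≤ n) =>
    exists_hasExpansion_finiteFreeCumulant hp.realRooted hp.tendsto_infinitesimal hn
  have hmoment (n : ℕ) (hn : 1 ≤ n) : moment μ n = ∑ π ∈ NC n, partProd r π :=
    tendsto_nhds_unique (hp.tendsto_moment n) (hasExpansion_rootMoment hp.realRooted hrs hn).tendsto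
  refine ⟨s, fun n hn => ?_⟩
  rw [freeCumulant, cumulantOfMoments_eq_of_eq_sum_NC hmoment hn]
  exact hrs n hn

theorem exists_hasInfinitesimalDistribution_of_hasCumulantFluctuations [IsProbabilityMeasure ρ]
    {s : ℕ → ℝ} (hp : ∀ d, 1 ≤ d → p d ∈ realRooted d) (hρ : HasFiniteMoments ρ)
    (hs : HasCumulantFluctuations p ρ s) :
    ∃ ρ', HasInfinitesimalDistribution p ρ ρ' ∧ ∀ n, 1 ≤ n → ρ' (X ^ n) =
      ∑ π ∈ NC n, partDeriv (freeCumulant ρ) s π - annularSum (freeCumulant ρ) n := by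
  obtain ⟨ρ', hρ'⟩ := exists_linearMap_X_pow (R := ℝ) fun n => if n = 0 then 0 else
    ∑ π ∈ NC n, partDeriv (freeCumulant ρ) s π - annularSum (freeCumulant ρ) n
  have hvalue (n : ℕ) (hn : 1 ≤ n) : ρ' (X ^ n) =
      ∑ π ∈ NC n, partDeriv (freeCumulant ρ) s π - annularSum (freeCumulant ρ) n := by
    rw [hρ', if_neg (by omega)]
  have hmoment (n : ℕ) (hn : 1 ≤ n) :
      HasExpansion (fun d => rootMoment d (p d) n) (moment ρ n) (ρ' (X ^ n)) := by
    rw [hvalue n hn, moment_eq_sum_NC (moment ρ) hn]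
    exact hasExpansion_rootMoment hp hs hn
  refine ⟨ρ', ⟨hp, inferInstance, hρ, fun n => ?_, by simpa using hρ' 0, hmoment⟩, hvalue⟩
  rcases n.eq_zero_or_pos with rfl | hn
  · refine tendsto_const_nhds.congr' ?_
    filter_upwards [eventually_ge_atTop 1] with d hd
    simp [rootMoment_zero (Nat.one_le_iff_ne_zero.mp hd) (hp d hd), moment]
  · exact (hmoment n hn).tendsto

theorem hasExpansion_finiteFreeCumulant_finiteFreeAdd {r r' s s' : ℕ → ℝ}
    (hp : ∀ d, 1 ≤ d → p d ∈ realRooted d) (hq : ∀ d, 1 ≤ d → q d ∈ realRooted d)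
    (h : ∀ k, 1 ≤ k → HasExpansion (fun d => finiteFreeCumulant d k (p d)) (r k) (s k))
    (h' : ∀ k, 1 ≤ k → HasExpansion (fun d => finiteFreeCumulant d k (q d)) (r' k) (s' k))
    (k : ℕ) (hk : 1 ≤ k) :
    HasExpansion (fun d => finiteFreeCumulant d k (finiteFreeAdd d (p d) (q d))) (r k + r' k)
      (s k + s' k) := by
  refine ((h k hk).add (h' k hk)).congr' ?_
  filter_upwards [eventually_ge_atTop k] with d hd
  rw [finiteFreeCumulant_finiteFreeAdd (hp d (hk.trans hd)) (hq d (hk.trans hd)) hk hd]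

theorem exists_moment_eq_sum_NC {r s : ℕ → ℝ} (hp : ∀ d, 1 ≤ d → p d ∈ realRooted d)
    (h : ∀ k, 1 ≤ k → HasExpansion (fun d => finiteFreeCumulant d k (p d)) (r k) (s k)) :
    ∃ ρ : Measure ℝ, IsProbabilityMeasure ρ ∧ HasFiniteMoments ρ ∧
      ∀ n, 1 ≤ n → moment ρ n = ∑ π ∈ NC n, partProd r π := by
  have hroots (d : ℕ) : p (d + 1) ∈ realRooted (d + 1) := hp (d + 1) (Nat.le_add_left 1 d)
  obtain ⟨ρ, hprob, hfin, hmoment⟩ := exists_moment_eq_of_tendsto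
    (μ := fun d => ⟨rootDistribution (d + 1) (p (d + 1)),
      isProbabilityMeasure_rootDistribution d.succ_ne_zero (hroots d)⟩)
    (m := fun n => if n = 0 then 1 else ∑ π ∈ NC n, partProd r π)
    (fun d => hasFiniteMoments_rootDistribution d.succ_ne_zero _) fun n => by
      simp only [ProbabilityMeasure.coe_mk, moment_rootDistribution]
      split_ifs with hn
      · simp only [hn, rootMoment_zero (Nat.succ_ne_zero _) (hroots _)]
        exact tendsto_const_nhds
      · exact (hasExpansion_rootMoment hp h (Nat.one_le_iff_ne_zero.mpr hn)).tendsto.comp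
          (tendsto_add_atTop_nat 1)
  exact ⟨ρ, hprob, hfin, fun n hn => by rw [hmoment, if_neg (by omega)]⟩

theorem HasInfinitesimalDistribution.exists_isFreeAddConv
    (hp : HasInfinitesimalDistribution p μ μ') (hq : HasInfinitesimalDistribution q ν ν') :
    ∃ ρ, IsFreeAddConv μ ν ρ := by
  obtain ⟨s, hs⟩ := hp.exists_hasCumulantFluctuations
  obtain ⟨s', hs'⟩ := hq.exists_hasCumulantFluctuations
  obtain ⟨ρ, hprob, hfin, hmoment⟩ := exists_moment_eq_sum_NC
    (fun d hd => finiteFreeAdd_mem_realRooted (hp.realRooted d hd) (hq.realRooted d hd))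
    (hasExpansion_finiteFreeCumulant_finiteFreeAdd hp.realRooted hq.realRooted hs hs')
  exact ⟨ρ, hprob, hfin, fun n hn => cumulantOfMoments_eq_of_eq_sum_NC hmoment hn⟩

end Convolution

end FiniteFree

theorem mainTheorem1 (p q : ℕ → ℝ[X]) (μ ν : Measure ℝ) (μ' ν' : ℝ[X] →ₗ[ℝ] ℝ)
    (hp : FiniteFree.HasInfinitesimalDistribution p μ μ')
    (hq : FiniteFree.HasInfinitesimalDistribution q ν ν') :
    ∃ rp rq : ℕ → ℝ,
      FiniteFree.HasCumulantFluctuations p μ rp ∧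
      FiniteFree.HasCumulantFluctuations q ν rq ∧
      (∃ ρ : Measure ℝ, FiniteFree.IsFreeAddConv μ ν ρ) ∧
      ∀ ρ : Measure ℝ, FiniteFree.IsFreeAddConv μ ν ρ →
        ∃ ρ' : ℝ[X] →ₗ[ℝ] ℝ,
          FiniteFree.HasInfinitesimalDistribution
            (fun d => FiniteFree.finiteFreeAdd d (p d) (q d)) ρ ρ' ∧
          FiniteFree.HasCumulantFluctuations
            (fun d => FiniteFree.finiteFreeAdd d (p d) (q d)) ρ (fun n => rp n + rq n) ∧
          ∀ n : ℕ, 1 ≤ n →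
            ρ' (X ^ n) =
              (∑ π ∈ FiniteFree.NC n,
                FiniteFree.partDeriv (FiniteFree.freeCumulant ρ) (fun k => rp k + rq k) π)
              - FiniteFree.annularSum (FiniteFree.freeCumulant ρ) n := by
  obtain ⟨rp, hrp⟩ := hp.exists_hasCumulantFluctuations
  obtain ⟨rq, hrq⟩ := hq.exists_hasCumulantFluctuations
  refine ⟨rp, rq, hrp, hrq, hp.exists_isFreeAddConv hq, fun ρ hρ => ?_⟩
  have hreal (d : ℕ) (hd : 1 ≤ d) :=
    FiniteFree.finiteFreeAdd_mem_realRooted (hp.realRooted d hd) (hq.realRooted d hd)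
  have hfluc : FiniteFree.HasCumulantFluctuations
      (fun d => FiniteFree.finiteFreeAdd d (p d) (q d)) ρ (fun n => rp n + rq n) := fun n hn => by
    rw [hρ.freeCumulant_add n hn]
    exact FiniteFree.hasExpansion_finiteFreeCumulant_finiteFreeAdd hp.realRooted hq.realRooted
      hrp hrq n hn
  have := hρ.isProbabilityMeasure
  obtain ⟨ρ', hρ', hvalue⟩ :=
    FiniteFree.exists_hasInfinitesimalDistribution_of_hasCumulantFluctuations hreal
      hρ.finiteMoments hfluc
  exact ⟨ρ', hρ', hfluc, hvalue⟩
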